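/- **Theorem.** The satisfiability problem of $\mathcal{RQSPA}$ is decidable: there is an algorithm that, given a formula $\Phi$ of the grammar below, decides whether $\Phi$ is an $\mathcal{RQSPA}$ formula that is satisfiable over $\mathbb{Z}$. *Syntax.* There are integer variables $x$ and set variables $S$. With $c\in\mathbb{Z}$, ${\bowtie}\in\{=,\le,\ge\}$ and ${\asymp}\in\{=,\subseteq,\supseteq,\subset,\supset\}$ (where $\subset,\supset$ are strict), formulas are given by $$\begin{aligned} \Phi &::= T_s \asymp T_s \mid T_i \bowtie T_i + c \mid T_m \bowtie 0 \mid \Phi\wedge\Phi \mid \neg\Phi \mid \forall x.\,\Phi \mid \forall S.\,\Phi,\\ T_s &::= \emptyset \mid S \mid \{T_i\} \mid T_s\cup T_s \mid T_s\cap T_s \mid T_s\setminus T_s,\\ T_i &::= c \mid x \mid \min(T_s) \mid \max(T_s),\\ T_m &::= c \mid x \mid \max(T_s) \mid \min(T_s) \mid T_m + T_m \mid T_m - T_m . \end{aligned}$$ An $\mathcal{RQSPA}$ formula is such a formula in which every occurrence of a variable, integer or set, in an atom $T_m\bowtie 0$ is free, i.e. is not bound by any quantifier of the formula. *Semantics.*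 Integer variables range over $\mathbb{Z}$ and set variables over the finite subsets of $\mathbb{Z}$, for free and quantified variables alike. The terms $\min(T_s)$ and $\max(T_s)$ denote the least and greatest element of $T_s$ and are undefined if $T_s$ denotes $\emptyset$; a term with an undefined subterm is undefined, and an atomic formula containing an undefined term is false. The connectives and quantifiers have their usual meaning. $\Phi$ is satisfiable if it is true under some assignment of values to its free variables. "Decidable" means that the set of satisfiable $\mathcal{RQSPA}$ formulas is a recursive set of formulas, with respect to an explicit Gödel numbering of syntax trees by natural numbers. -/

import Mathlib

/-! Syntax and semantics of RQSPA. Integer variables and set variables are two separate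
families, both named by natural numbers. -/

namespace RQSPA

mutual
/-- Set terms `T_s ::= ∅ | S | {T_i} | T_s ∪ T_s | T_s ∩ T_s | T_s \ T_s`. -/
inductive SetTerm : Type
  | empty : SetTerm
  | var (S : ℕ) : SetTerm
  | single (t : IntTerm) : SetTerm
  | union (s t : SetTerm) : SetTerm
  | inter (s t : SetTerm) : SetTerm
  | diff (s t : SetTerm) : SetTerm

/-- Integer terms `T_i ::= c | x | min(T_s) | max(T_s)`. -/
inductive IntTerm : Type
  | const (c : ℤ) : IntTerm
  | var (x : ℕ) : IntTerm
  | min (s : SetTerm) : IntTerm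
  | max (s : SetTerm) : IntTerm
end

/-- Presburger terms `T_m ::= c | x | max(T_s) | min(T_s) | T_m + T_m | T_m - T_m`;
the first four productions are exactly those of the integer terms. -/
inductive PresTerm : Type
  | base (t : IntTerm) : PresTerm
  | add (p q : PresTerm) : PresTerm
  | sub (p q : PresTerm) : PresTerm

/-- The comparison operators `=, ≤, ≥` between integers. -/
inductive IntRel : Type
  | eq | le | ge

/-- The comparison operators `=, ⊆, ⊇, ⊂, ⊃` between sets. -/
inductive SetRel : Type
  | eq | subset | supset | ssubset | ssupset

/-- Formulas
`Φ ::= T_s ≍ T_s | T_i ⋈ T_i + c | T_m ⋈ 0 | Φ ∧ Φ | ¬ Φ | ∀ x. Φ | ∀ S. Φ`,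
before the restriction on the variables of the atoms `T_m ⋈ 0` is imposed. -/
inductive Formula : Type
  | setAtom (r : SetRel) (s t : SetTerm) : Formula
  | diffAtom (r : IntRel) (t u : IntTerm) (c : ℤ) : Formula
  | presAtom (r : IntRel) (p : PresTerm) : Formula
  | and (φ ψ : Formula) : Formula
  | neg (φ : Formula) : Formula
  | allInt (x : ℕ) (φ : Formula) : Formula
  | allSet (S : ℕ) (φ : Formula) : Formula

/-! ### Variables and the restriction -/

mutual
/-- The integer variable `x` occurs in a set term. -/
def SetTerm.HasInt (x : ℕ) : SetTerm → Prop
  | .empty => False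
  | .var _ => False
  | .single t => t.HasInt x
  | .union s t => s.HasInt x ∨ t.HasInt x
  | .inter s t => s.HasInt x ∨ t.HasInt x
  | .diff s t => s.HasInt x ∨ t.HasInt x

/-- The integer variable `x` occurs in an integer term. -/
def IntTerm.HasInt (x : ℕ) : IntTerm → Prop
  | .const _ => False
  | .var y => y = x
  | .min s => s.HasInt x
  | .max s => s.HasInt x
end

mutual
/-- The set variable `S` occurs in a set term. -/
def SetTerm.HasSet (S : ℕ) : SetTerm → Prop
  | .empty => False
  | .var U => U = S
  | .single t => t.HasSet S
  | .union s t => s.HasSet S ∨ t.HasSet S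
  | .inter s t => s.HasSet S ∨ t.HasSet S
  | .diff s t => s.HasSet S ∨ t.HasSet S

/-- The set variable `S` occurs in an integer term. -/
def IntTerm.HasSet (S : ℕ) : IntTerm → Prop
  | .const _ => False
  | .var _ => False
  | .min s => s.HasSet S
  | .max s => s.HasSet S
end

/-- The integer variable `x` occurs in a Presburger term. -/
def PresTerm.HasInt (x : ℕ) : PresTerm → Prop
  | .base t => t.HasInt x
  | .add p q => p.HasInt x ∨ q.HasInt x
  | .sub p q => p.HasInt x ∨ q.HasInt x

/-- The set variable `S` occurs in a Presburger term. -/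
def PresTerm.HasSet (S : ℕ) : PresTerm → Prop
  | .base t => t.HasSet S
  | .add p q => p.HasSet S ∨ q.HasSet S
  | .sub p q => p.HasSet S ∨ q.HasSet S

/-- No atom `T_m ⋈ 0` of the formula has an occurrence of the integer variable `x` that is
not bound inside the formula; the quantifier `∀ x` in front of such a formula captures no
variable of a Presburger atom. -/
def Formula.PresAvoidsInt (x : ℕ) : Formula → Prop
  | .setAtom _ _ _ => True
  | .diffAtom _ _ _ _ => True
  | .presAtom _ p => ¬ p.HasInt x
  | .and φ ψ => φ.PresAvoidsInt x ∧ ψ.PresAvoidsInt x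
  | .neg φ => φ.PresAvoidsInt x
  | .allInt y φ => y = x ∨ φ.PresAvoidsInt x
  | .allSet _ φ => φ.PresAvoidsInt x

/-- The same for a set variable `S`. -/
def Formula.PresAvoidsSet (S : ℕ) : Formula → Prop
  | .setAtom _ _ _ => True
  | .diffAtom _ _ _ _ => True
  | .presAtom _ p => ¬ p.HasSet S
  | .and φ ψ => φ.PresAvoidsSet S ∧ ψ.PresAvoidsSet S
  | .neg φ => φ.PresAvoidsSet S
  | .allInt _ φ => φ.PresAvoidsSet S
  | .allSet U φ => U = S ∨ φ.PresAvoidsSet S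

/-- The RQSPA formulas: every occurrence of a variable in an atom `T_m ⋈ 0` is free, that is,
no quantifier of the formula binds it. -/
def Formula.IsRQSPA : Formula → Prop
  | .setAtom _ _ _ => True
  | .diffAtom _ _ _ _ => True
  | .presAtom _ _ => True
  | .and φ ψ => φ.IsRQSPA ∧ ψ.IsRQSPA
  | .neg φ => φ.IsRQSPA
  | .allInt x φ => φ.PresAvoidsInt x ∧ φ.IsRQSPA
  | .allSet S φ => φ.PresAvoidsSet S ∧ φ.IsRQSPA

/-! ### Semantics

The value of a term is `none` when the term is undefined. -/

/-- The minimum of a finite set of integers, undefined for the empty set. -/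
def minVal (A : Finset ℤ) : Option ℤ := if h : A.Nonempty then some (A.min' h) else none

/-- The maximum of a finite set of integers, undefined for the empty set. -/
def maxVal (A : Finset ℤ) : Option ℤ := if h : A.Nonempty then some (A.max' h) else none

mutual
/-- Value of a set term; it is undefined as soon as some subterm is. -/
def SetTerm.eval (v : ℕ → ℤ) (V : ℕ → Finset ℤ) : SetTerm → Option (Finset ℤ)
  | .empty => some ∅
  | .var S => some (V S)
  | .single t => (t.eval v V).bind fun n => some {n}
  | .union s t => (s.eval v V).bind fun A => (t.eval v V).bind fun B => some (A ∪ B)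
  | .inter s t => (s.eval v V).bind fun A => (t.eval v V).bind fun B => some (A ∩ B)
  | .diff s t => (s.eval v V).bind fun A => (t.eval v V).bind fun B => some (A \ B)

/-- Value of an integer term; it is undefined as soon as some subterm is. -/
def IntTerm.eval (v : ℕ → ℤ) (V : ℕ → Finset ℤ) : IntTerm → Option ℤ
  | .const c => some c
  | .var x => some (v x)
  | .min s => (s.eval v V).bind minVal
  | .max s => (s.eval v V).bind maxVal
end

/-- Value of a Presburger term; it is undefined as soon as some subterm is. -/
def PresTerm.eval (v : ℕ → ℤ) (V : ℕ → Finset ℤ) : PresTerm → Option ℤ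
  | .base t => t.eval v V
  | .add p q => (p.eval v V).bind fun m => (q.eval v V).bind fun n => some (m + n)
  | .sub p q => (p.eval v V).bind fun m => (q.eval v V).bind fun n => some (m - n)

/-- Meaning of the comparison operators between integers. -/
def IntRel.Holds : IntRel → ℤ → ℤ → Prop
  | .eq, m, n => m = n
  | .le, m, n => m ≤ n
  | .ge, m, n => m ≥ n

/-- Meaning of the comparison operators between sets. -/
def SetRel.Holds : SetRel → Finset ℤ → Finset ℤ → Prop
  | .eq, A, B => A = B
  | .subset, A, B => A ⊆ B
  | .supset, A, B => A ⊇ B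
  | .ssubset, A, B => A ⊂ B
  | .ssupset, A, B => A ⊃ B

/-- Truth of a formula when the integer variables take the values `v` and the set variables
the values `V`. Set variables range over the finite subsets of `ℤ`; an atomic formula that
contains an undefined term is false. -/
def Formula.Holds : Formula → (ℕ → ℤ) → (ℕ → Finset ℤ) → Prop
  | .setAtom r s t, v, V => ∃ A B, s.eval v V = some A ∧ t.eval v V = some B ∧ r.Holds A B
  | .diffAtom r t u c, v, V =>
      ∃ m n, t.eval v V = some m ∧ u.eval v V = some n ∧ r.Holds m (n + c)
  | .presAtom r p, v, V => ∃ m, p.eval v V = some m ∧ r.Holds m 0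
  | .and φ ψ, v, V => φ.Holds v V ∧ ψ.Holds v V
  | .neg φ, v, V => ¬ φ.Holds v V
  | .allInt x φ, v, V => ∀ n : ℤ, φ.Holds (Function.update v x n) V
  | .allSet S φ, v, V => ∀ A : Finset ℤ, φ.Holds v (Function.update V S A)

/-- A formula is satisfiable if some assignment of integers and of finite sets of integers to
the variables makes it true. -/
def Formula.Satisfiable (φ : Formula) : Prop :=
  ∃ (v : ℕ → ℤ) (V : ℕ → Finset ℤ), φ.Holds v V

/-! ### Gödel numbering

A formula is presented to an algorithm by its code, a natural number computed from its syntax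
tree by the pairing function `Nat.pair` and a tag for the outermost constructor. -/

mutual
/-- Code of a set term. -/
def SetTerm.code : SetTerm → ℕ
  | .empty => 0
  | .var S => 5 * S + 1
  | .single t => 5 * t.code + 2
  | .union s t => 5 * Nat.pair s.code t.code + 3
  | .inter s t => 5 * Nat.pair s.code t.code + 4
  | .diff s t => 5 * Nat.pair s.code t.code + 5

/-- Code of an integer term. -/
def IntTerm.code : IntTerm → ℕ
  | .const c => 4 * Equiv.intEquivNat c
  | .var x => 4 * x + 1
  | .min s => 4 * s.code + 2
  | .max s => 4 * s.code + 3
end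

/-- Code of a Presburger term. -/
def PresTerm.code : PresTerm → ℕ
  | .base t => 3 * t.code
  | .add p q => 3 * Nat.pair p.code q.code + 1
  | .sub p q => 3 * Nat.pair p.code q.code + 2

/-- Code of an integer comparison operator. -/
def IntRel.code : IntRel → ℕ
  | .eq => 0
  | .le => 1
  | .ge => 2

/-- Code of a set comparison operator. -/
def SetRel.code : SetRel → ℕ
  | .eq => 0
  | .subset => 1
  | .supset => 2
  | .ssubset => 3
  | .ssupset => 4

/-- Code of a formula. -/
def Formula.code : Formula → ℕ
  | .setAtom r s t => 7 * (5 * Nat.pair s.code t.code + r.code)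
  | .diffAtom r t u c =>
      7 * (3 * Nat.pair t.code (Nat.pair u.code (Equiv.intEquivNat c)) + r.code) + 1
  | .presAtom r p => 7 * (3 * p.code + r.code) + 2
  | .and φ ψ => 7 * Nat.pair φ.code ψ.code + 3
  | .neg φ => 7 * φ.code + 4
  | .allInt x φ => 7 * Nat.pair x φ.code + 5
  | .allSet S φ => 7 * Nat.pair S φ.code + 6

mutual
theorem SetTerm.code_inj : ∀ s t : SetTerm, s.code = t.code → s = t
  | .empty, t, h => by cases t <;> simp only [SetTerm.code] at h <;> first | rfl | omega
  | .var S, t, h => by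
      cases t <;> simp only [SetTerm.code] at h <;> first | omega | skip
      congr 1; omega
  | .single a, t, h => by
      cases t <;> simp only [SetTerm.code] at h <;> first | omega | skip
      rename_i a'
      rw [IntTerm.code_inj a a' (by omega)]
  | .union a b, t, h => by
      cases t <;> simp only [SetTerm.code] at h <;> first | omega | skip
      rename_i a' b'
      obtain ⟨h1, h2⟩ := Nat.pair_eq_pair.1
        (show Nat.pair a.code b.code = Nat.pair a'.code b'.code by omega)
      rw [SetTerm.code_inj a _ h1, SetTerm.code_inj b _ h2]
  | .inter a b, t, h => by
      cases t <;> simp only [SetTerm.code] at h <;> first | omega | skip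
      rename_i a' b'
      obtain ⟨h1, h2⟩ := Nat.pair_eq_pair.1
        (show Nat.pair a.code b.code = Nat.pair a'.code b'.code by omega)
      rw [SetTerm.code_inj a _ h1, SetTerm.code_inj b _ h2]
  | .diff a b, t, h => by
      cases t <;> simp only [SetTerm.code] at h <;> first | omega | skip
      rename_i a' b'
      obtain ⟨h1, h2⟩ := Nat.pair_eq_pair.1
        (show Nat.pair a.code b.code = Nat.pair a'.code b'.code by omega)
      rw [SetTerm.code_inj a _ h1, SetTerm.code_inj b _ h2]

theorem IntTerm.code_inj : ∀ s t : IntTerm, s.code = t.code → s = t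
  | .const c, t, h => by
      cases t <;> simp only [IntTerm.code] at h <;> first | omega | skip
      congr 1; exact Equiv.intEquivNat.injective (by omega)
  | .var x, t, h => by
      cases t <;> simp only [IntTerm.code] at h <;> first | omega | skip
      congr 1; omega
  | .min a, t, h => by
      cases t <;> simp only [IntTerm.code] at h <;> first | omega | skip
      rename_i a'
      rw [SetTerm.code_inj a a' (by omega)]
  | .max a, t, h => by
      cases t <;> simp only [IntTerm.code] at h <;> first | omega | skip
      rename_i a'
      rw [SetTerm.code_inj a a' (by omega)]
end

theorem PresTerm.code_inj : ∀ s t : PresTerm, s.code = t.code → s = t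
  | .base a, t, h => by
      cases t <;> simp only [PresTerm.code] at h <;> first | omega | skip
      rename_i a'
      rw [IntTerm.code_inj a a' (by omega)]
  | .add a b, t, h => by
      cases t <;> simp only [PresTerm.code] at h <;> first | omega | skip
      rename_i a' b'
      obtain ⟨h1, h2⟩ := Nat.pair_eq_pair.1
        (show Nat.pair a.code b.code = Nat.pair a'.code b'.code by omega)
      rw [PresTerm.code_inj a _ h1, PresTerm.code_inj b _ h2]
  | .sub a b, t, h => by
      cases t <;> simp only [PresTerm.code] at h <;> first | omega | skip
      rename_i a' b'
      obtain ⟨h1, h2⟩ := Nat.pair_eq_pair.1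
        (show Nat.pair a.code b.code = Nat.pair a'.code b'.code by omega)
      rw [PresTerm.code_inj a _ h1, PresTerm.code_inj b _ h2]

theorem IntRel.code_lt (r : IntRel) : r.code < 3 := by cases r <;> decide

theorem SetRel.code_lt (r : SetRel) : r.code < 5 := by cases r <;> decide

theorem IntRel.code_inj (r r' : IntRel) (h : r.code = r'.code) : r = r' := by
  cases r <;> cases r' <;> first | rfl | exact absurd h (by decide)

theorem SetRel.code_inj (r r' : SetRel) (h : r.code = r'.code) : r = r' := by
  cases r <;> cases r' <;> first | rfl | exact absurd h (by decide)

theorem Formula.code_inj : ∀ φ ψ : Formula, φ.code = ψ.code → φ = ψ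
  | .setAtom r a b, ψ, h => by
      cases ψ <;> simp only [Formula.code] at h <;> first | omega | skip
      rename_i r' a' b'
      have l := r.code_lt
      have l' := r'.code_lt
      obtain ⟨h1, h2⟩ := Nat.pair_eq_pair.1
        (show Nat.pair a.code b.code = Nat.pair a'.code b'.code by omega)
      rw [SetTerm.code_inj a _ h1, SetTerm.code_inj b _ h2, SetRel.code_inj r r' (by omega)]
  | .diffAtom r a b c, ψ, h => by
      cases ψ <;> simp only [Formula.code] at h <;> first | omega | skip
      rename_i r' a' b' c'
      have l := r.code_lt
      have l' := r'.code_lt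
      obtain ⟨h1, h2⟩ := Nat.pair_eq_pair.1
        (show Nat.pair a.code (Nat.pair b.code (Equiv.intEquivNat c)) =
          Nat.pair a'.code (Nat.pair b'.code (Equiv.intEquivNat c')) by omega)
      obtain ⟨h2, h3⟩ := Nat.pair_eq_pair.1 h2
      rw [IntTerm.code_inj a _ h1, IntTerm.code_inj b _ h2, Equiv.intEquivNat.injective h3,
        IntRel.code_inj r r' (by omega)]
  | .presAtom r p, ψ, h => by
      cases ψ <;> simp only [Formula.code] at h <;> first | omega | skip
      rename_i r' p'
      have l := r.code_lt
      have l' := r'.code_lt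
      rw [PresTerm.code_inj p p' (by omega), IntRel.code_inj r r' (by omega)]
  | .and a b, ψ, h => by
      cases ψ <;> simp only [Formula.code] at h <;> first | omega | skip
      rename_i a' b'
      obtain ⟨h1, h2⟩ := Nat.pair_eq_pair.1
        (show Nat.pair a.code b.code = Nat.pair a'.code b'.code by omega)
      rw [Formula.code_inj a _ h1, Formula.code_inj b _ h2]
  | .neg a, ψ, h => by
      cases ψ <;> simp only [Formula.code] at h <;> first | omega | skip
      rename_i a'
      rw [Formula.code_inj a a' (by omega)]
  | .allInt x a, ψ, h => by
      cases ψ <;> simp only [Formula.code] at h <;> first | omega | skip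
      rename_i a' b'
      obtain ⟨h1, h2⟩ := Nat.pair_eq_pair.1
        (show Nat.pair x a.code = Nat.pair a' b'.code by omega)
      rw [h1, Formula.code_inj a _ h2]
  | .allSet x a, ψ, h => by
      cases ψ <;> simp only [Formula.code] at h <;> first | omega | skip
      rename_i a' b'
      obtain ⟨h1, h2⟩ := Nat.pair_eq_pair.1
        (show Nat.pair x a.code = Nat.pair a' b'.code by omega)
      rw [h1, Formula.code_inj a _ h2]

theorem term_code_surj (n : ℕ) : (∃ s : SetTerm, s.code = n) ∧ ∃ t : IntTerm, t.code = n := by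
  induction n using Nat.strong_induction_on with
  | _ n ih =>
    constructor
    · rcases Nat.eq_zero_or_pos n with h0 | h0
      · exact ⟨.empty, h0.symm⟩
      have hm : (n - 1) % 5 < 5 := Nat.mod_lt _ (by norm_num)
      have hd := Nat.div_add_mod (n - 1) 5
      obtain ⟨q, hq⟩ : ∃ q, q = (n - 1) / 5 := ⟨_, rfl⟩
      rw [← hq] at hd
      have hl := Nat.unpair_left_le q
      have hr := Nat.unpair_right_le q
      have hp := Nat.pair_unpair q
      obtain ⟨a, ha⟩ := (ih q.unpair.1 (by omega)).1
      obtain ⟨b, hb⟩ := (ih q.unpair.2 (by omega)).1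
      obtain ⟨t, ht⟩ := (ih q (by omega)).2
      rw [← ha, ← hb] at hp
      interval_cases hk : (n - 1) % 5
      · exact ⟨.var q, by simp only [SetTerm.code]; omega⟩
      · exact ⟨.single t, by simp only [SetTerm.code]; omega⟩
      · exact ⟨.union a b, by simp only [SetTerm.code]; omega⟩
      · exact ⟨.inter a b, by simp only [SetTerm.code]; omega⟩
      · exact ⟨.diff a b, by simp only [SetTerm.code]; omega⟩
    · have hm : n % 4 < 4 := Nat.mod_lt _ (by norm_num)
      have hd := Nat.div_add_mod n 4
      obtain ⟨q, hq⟩ : ∃ q, q = n / 4 := ⟨_, rfl⟩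
      rw [← hq] at hd
      have hc := Equiv.intEquivNat.apply_symm_apply q
      interval_cases hk : n % 4
      · exact ⟨.const (Equiv.intEquivNat.symm q), by simp only [IntTerm.code]; omega⟩
      · exact ⟨.var q, by simp only [IntTerm.code]; omega⟩
      · obtain ⟨s, hs⟩ := (ih q (by omega)).1
        exact ⟨.min s, by simp only [IntTerm.code]; omega⟩
      · obtain ⟨s, hs⟩ := (ih q (by omega)).1
        exact ⟨.max s, by simp only [IntTerm.code]; omega⟩

theorem PresTerm.code_surj (n : ℕ) : ∃ p : PresTerm, p.code = n := by
  induction n using Nat.strong_induction_on with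
  | _ n ih =>
    have hm : n % 3 < 3 := Nat.mod_lt _ (by norm_num)
    have hd := Nat.div_add_mod n 3
    obtain ⟨q, hq⟩ : ∃ q, q = n / 3 := ⟨_, rfl⟩
    rw [← hq] at hd
    have hl := Nat.unpair_left_le q
    have hr := Nat.unpair_right_le q
    have hp := Nat.pair_unpair q
    interval_cases hk : n % 3
    · obtain ⟨t, ht⟩ := (term_code_surj q).2
      exact ⟨.base t, by simp only [PresTerm.code]; omega⟩
    · obtain ⟨a, ha⟩ := ih q.unpair.1 (by omega)
      obtain ⟨b, hb⟩ := ih q.unpair.2 (by omega)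
      rw [← ha, ← hb] at hp
      exact ⟨.add a b, by simp only [PresTerm.code]; omega⟩
    · obtain ⟨a, ha⟩ := ih q.unpair.1 (by omega)
      obtain ⟨b, hb⟩ := ih q.unpair.2 (by omega)
      rw [← ha, ← hb] at hp
      exact ⟨.sub a b, by simp only [PresTerm.code]; omega⟩

theorem IntRel.code_surj (n : ℕ) (h : n < 3) : ∃ r : IntRel, r.code = n := by
  interval_cases n
  exacts [⟨.eq, rfl⟩, ⟨.le, rfl⟩, ⟨.ge, rfl⟩]

theorem SetRel.code_surj (n : ℕ) (h : n < 5) : ∃ r : SetRel, r.code = n := by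
  interval_cases n
  exacts [⟨.eq, rfl⟩, ⟨.subset, rfl⟩, ⟨.supset, rfl⟩, ⟨.ssubset, rfl⟩, ⟨.ssupset, rfl⟩]

theorem Formula.code_surj (n : ℕ) : ∃ φ : Formula, φ.code = n := by
  induction n using Nat.strong_induction_on with
  | _ n ih =>
    have hm : n % 7 < 7 := Nat.mod_lt _ (by norm_num)
    have hd := Nat.div_add_mod n 7
    obtain ⟨q, hq⟩ : ∃ q, q = n / 7 := ⟨_, rfl⟩
    rw [← hq] at hd
    have hl := Nat.unpair_left_le q
    have hr := Nat.unpair_right_le q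
    have hp := Nat.pair_unpair q
    interval_cases hk : n % 7
    · obtain ⟨r, hr'⟩ := SetRel.code_surj (q % 5) (Nat.mod_lt _ (by norm_num))
      obtain ⟨a, ha⟩ := (term_code_surj (q / 5).unpair.1).1
      obtain ⟨b, hb⟩ := (term_code_surj (q / 5).unpair.2).1
      refine ⟨.setAtom r a b, ?_⟩
      simp only [Formula.code, ha, hb, Nat.pair_unpair, hr']
      omega
    · obtain ⟨r, hr'⟩ := IntRel.code_surj (q % 3) (Nat.mod_lt _ (by norm_num))
      obtain ⟨a, ha⟩ := (term_code_surj (q / 3).unpair.1).2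
      obtain ⟨b, hb⟩ := (term_code_surj (q / 3).unpair.2.unpair.1).2
      refine ⟨.diffAtom r a b (Equiv.intEquivNat.symm (q / 3).unpair.2.unpair.2), ?_⟩
      simp only [Formula.code, ha, hb, Equiv.apply_symm_apply, Nat.pair_unpair, hr']
      omega
    · obtain ⟨r, hr'⟩ := IntRel.code_surj (q % 3) (Nat.mod_lt _ (by norm_num))
      obtain ⟨p, hp'⟩ := PresTerm.code_surj (q / 3)
      exact ⟨.presAtom r p, by simp only [Formula.code, hp', hr']; omega⟩
    · obtain ⟨a, ha⟩ := ih q.unpair.1 (by omega)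
      obtain ⟨b, hb⟩ := ih q.unpair.2 (by omega)
      exact ⟨.and a b, by simp only [Formula.code, ha, hb, Nat.pair_unpair]; omega⟩
    · obtain ⟨a, ha⟩ := ih q (by omega)
      exact ⟨.neg a, by simp only [Formula.code, ha]; omega⟩
    · obtain ⟨b, hb⟩ := ih q.unpair.2 (by omega)
      exact ⟨.allInt q.unpair.1 b, by simp only [Formula.code, hb, Nat.pair_unpair]; omega⟩
    · obtain ⟨b, hb⟩ := ih q.unpair.2 (by omega)
      exact ⟨.allSet q.unpair.1 b, by simp only [Formula.code, hb, Nat.pair_unpair]; omega⟩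

/-- The Gödel numbering as a bijection between formulas and natural numbers. -/
noncomputable def Formula.codeEquiv : Formula ≃ ℕ :=
  Equiv.ofBijective Formula.code ⟨fun φ ψ h => Formula.code_inj φ ψ h, Formula.code_surj⟩

/-- Computability of predicates on formulas is meant with respect to this numbering. -/
noncomputable instance : Denumerable Formula := Denumerable.mk' Formula.codeEquiv

/-- The code of a formula as an element of a denumerable type is its Gödel number. -/
theorem Formula.encode_eq (φ : Formula) : Encodable.encode φ = φ.code := rfl

end RQSPA

/-!
Satisfiability of RQSPA is decided by a search: a satisfiable formula has a model of a size that is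
a primitive recursive function of its code, and truth in a model of bounded size is decided by
letting the quantifiers range over a large enough window.

An assignment is written as a word over the alphabet of sets of tracks, one letter for each position
of a window of integers and one track for each variable, together with a track that marks the
origin. For a formula without atoms `T_m ⋈ 0` the words of its models form a regular language
(`Formula.recog`), and the number of states of an automaton is at most a tower of exponentials
whose height is linear in the code of the formula: each quantifier costs one subset construction
(`Recog.ex`). An RQSPA formula is no different while the values of the variables of its atoms
`T_m ⋈ 0` are kept fixed, because no quantifier binds them; each of these atoms is then a constant
(`Formula.holds_iff_holdsGiven`).

This is used twice. First, a witness of a quantified variable may stick out of the window of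
the other values by at most the number of states, since longer excursions can be cut by the
pigeonhole principle (`Recog.exists_small_witness`). So quantifiers may be bounded
(`Formula.allInt_holds_iff_bounded`, `Formula.allSet_holds_iff_bounded`).

Second, take a model, and mark the origin and the values of all integer terms with code at most `N`,
the code of the formula. The marked letters cut the word of the model into at most `N + 3` blocks of
unmarked letters. With `K` states in the automaton, a block of length at least
`2 ^ K + c * (2 ^ K)!` can be replaced by an unmarked block that is shorter by `c * (2 ^ K)!` and
has the same effect (`exists_shorter_word`). The values of the terms `T_m` are affine forms in the
lengths of the blocks, and an atom `T_m ⋈ 0` depends only on the sign of `T_m`. If the blocks are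
long in total, a zero-sum argument in several coordinates (`exists_zero_sum_subset_vec`) yields
multiples of `(2 ^ K)!` that can be taken from the lengths without changing any of these signs
(`exists_shrink`). Repeating this gives a model of bounded size (`Formula.exists_small_model`).

The search itself is primitive recursive. By recursion on the code of a formula one computes the
table of all environments with bounded entries that satisfy it (`Formula.table`, `PR.table`),
and the formula is satisfiable if and only if the table contains an environment with entries below
the bound for models (`Formula.satisfiable_iff`).
-/

namespace RQSPA

/-! ### Configurations and automata -/

/-- The tracks of a configuration: `org` marks the origin, `int x` and `set S` carry the values of
the variables, `mark k` the value of the integer term with code `k`, and `scr k` is a scratch track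
for intermediate values. -/
inductive Track : Type
  | org
  | int (x : ℕ)
  | set (S : ℕ)
  | mark (k : ℕ)
  | scr (k : ℕ)
deriving DecidableEq

/-- A finite set of integers on each track. -/
abbrev Config := Track → Finset ℤ

/-- The letter at position `p`: the set of tracks that contain `p`. -/
def letter (X : Config) (p : ℤ) : Set Track := {i | p ∈ X i}

/-- The letters at the `n` positions from `a` on. -/
def word (X : Config) (a : ℤ) (n : ℕ) : List (Set Track) :=
  (List.range n).map fun k : ℕ => letter X (a + (k : ℤ))

/-- Iterated exponentials of `2`. They start at `4` because from there on `2 ^ k` is at least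
`k * k`, so that a product of automata costs no more than one level. -/
def tower : ℕ → ℕ
  | 0 => 4
  | n + 1 => 2 ^ tower n

theorem tower_ge (n : ℕ) : n + 4 ≤ tower n := by
  induction n with
  | zero => simp [tower]
  | succ n ih =>
    have := Nat.lt_two_pow_self (n := tower n)
    simp only [tower]; omega

theorem tower_mono : Monotone tower :=
  monotone_nat_of_le_succ fun n => (Nat.lt_two_pow_self (n := tower n)).le

theorem sq_le_two_pow (k : ℕ) (h : 4 ≤ k) : k * k ≤ 2 ^ k := by
  induction k, h using Nat.le_induction with
  | base => norm_num
  | succ k hk ih => rw [pow_succ]; nlinarith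

/-- All tracks of the configuration lie in the window of length `m` that begins at `a`. -/
def InWindow (X : Config) (a : ℤ) (m : ℕ) : Prop := ∀ i, X i ⊆ Finset.Ico a (a + m)

/-- The relation `R` is recognized by an automaton with at most `tower n` states: on configurations
whose track `org` marks the origin, the automaton tells from the word of any window that contains
the configuration whether `R` holds. The answer does not depend on the window, so the automaton
is insensitive to empty letters at both ends of a word. -/
def Recog (n : ℕ) (R : Config → Prop) : Prop :=
  ∃ (Q : Type) (_ : Fintype Q) (M : DFA (Set Track) Q), Fintype.card Q ≤ tower n ∧
    ∀ (X : Config) (a : ℤ) (m : ℕ), X .org = {0} → InWindow X a m →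
      (R X ↔ word X a m ∈ M.accepts)

@[simp] theorem word_length (X : Config) (a : ℤ) (n : ℕ) : (word X a n).length = n := by
  simp [word]

theorem word_succ (X : Config) (a : ℤ) (n : ℕ) :
    word X a (n + 1) = word X a n ++ [letter X (a + n)] := by
  simp [word, List.range_succ]

theorem word_add (X : Config) (a : ℤ) (n m : ℕ) :
    word X a (n + m) = word X a n ++ word X (a + n) m := by
  induction m with
  | zero => simp [word]
  | succ m ih =>
    rw [← add_assoc, word_succ, ih, word_succ, List.append_assoc]
    push_cast; rw [add_assoc a]

theorem Recog.mono {n n' : ℕ} {R : Config → Prop} (h : Recog n R) (hn : n ≤ n') : Recog n' R := by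
  obtain ⟨Q, i, M, hc, H⟩ := h
  exact ⟨Q, i, M, hc.trans (tower_mono hn), H⟩

theorem Recog.congr {n : ℕ} {R R' : Config → Prop} (h : Recog n R)
    (hR : ∀ X : Config, X .org = {0} → (R' X ↔ R X)) : Recog n R' := by
  obtain ⟨Q, i, M, hc, H⟩ := h
  exact ⟨Q, i, M, hc, fun X a m hX hw => (hR X hX).trans (H X a m hX hw)⟩

theorem Recog.not {n : ℕ} {R : Config → Prop} (h : Recog n R) : Recog n (fun X => ¬ R X) := by
  obtain ⟨Q, i, M, hc, H⟩ := h
  refine ⟨Q, i, Mᶜ, hc, fun X a m hX hw => ?_⟩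
  change ¬ R X ↔ _
  rw [H X a m hX hw, DFA.accepts_compl]
  rfl

theorem Recog.and {n : ℕ} {R R' : Config → Prop} (h : Recog n R) (h' : Recog n R') :
    Recog (n + 1) (fun X => R X ∧ R' X) := by
  obtain ⟨Q, i, M, hc, H⟩ := h
  obtain ⟨Q', i', M', hc', H'⟩ := h'
  refine ⟨Q × Q', inferInstance, M.inter M', ?_, fun X a m hX hw => ?_⟩
  · rw [Fintype.card_prod]
    exact (Nat.mul_le_mul hc hc').trans (sq_le_two_pow _ (by have := tower_ge n; omega))
  · change R X ∧ R' X ↔ _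
    rw [H X a m hX hw, H' X a m hX hw, DFA.accepts_inter]
    rfl

theorem Recog.or {n : ℕ} {R R' : Config → Prop} (h : Recog n R) (h' : Recog n R') :
    Recog (n + 1) (fun X => R X ∨ R' X) :=
  (h.not.and h'.not).not.congr fun X _ => by tauto

theorem Recog.const (p : Prop) : Recog 0 (fun _ => p) := by
  refine ⟨Unit, inferInstance, ⟨fun _ _ => (), (), {_x | p}⟩, by simp [tower], fun X a m _ _ => ?_⟩
  rw [DFA.mem_accepts]
  rfl

/-- Cutting loops shortens a word over the letters in `L` to at most as many letters as there are
states, with the same effect on a given state. -/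
theorem exists_short_word {α Q : Type} [Fintype Q] (M : DFA α Q) (L : Set α) (w : List α)
    (hw : ∀ l ∈ w, l ∈ L) (s : Q) :
    ∃ w', (∀ l ∈ w', l ∈ L) ∧ M.evalFrom s w' = M.evalFrom s w ∧ w'.length ≤ Fintype.card Q := by
  induction hn : w.length using Nat.strong_induction_on generalizing w with
  | _ n ih =>
    by_cases hl : w.length ≤ Fintype.card Q
    · exact ⟨w, hw, rfl, hl⟩
    obtain ⟨q, a, b, c, rfl, -, hb, ha, hq, hc⟩ := M.evalFrom_split (not_le.1 hl).le rfl (s := s)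
    have hb' := List.length_pos_iff.2 hb
    obtain ⟨w', h1, h2, h3⟩ := ih (a ++ c).length (by simp at hn ⊢; omega) (a ++ c)
      (fun l hl => hw l (by simp at hl ⊢; tauto)) rfl
    refine ⟨w', h1, ?_, h3⟩
    rw [h2, DFA.evalFrom_of_append, DFA.evalFrom_of_append, DFA.evalFrom_of_append, ha, hq]

/-! ### Projection and small witnesses -/

/-- Two letters agree off the track `i`. -/
def AgreeOff (i : Track) (l l' : Set Track) : Prop := ∀ j, j ≠ i → (j ∈ l ↔ j ∈ l')

theorem agreeOff_word_update (X : Config) (i : Track) (A : Finset ℤ) (a : ℤ) (n : ℕ) :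
    List.Forall₂ (AgreeOff i) (word (Function.update X i A) a n) (word X a n) := by
  rw [word, word, List.forall₂_map_left_iff, List.forall₂_map_right_iff, List.forall₂_same]
  intro k _ j hj
  simp [letter, Function.update_of_ne hj]

/-- Every word that agrees with `X` off the track `i` comes from changing `X` on that track. -/
theorem exists_update_word_eq (X : Config) (i : Track) (a : ℤ) (n : ℕ) (w : List (Set Track))
    (h : List.Forall₂ (AgreeOff i) w (word X a n)) :
    ∃ A ⊆ Finset.Ico a (a + n), word (Function.update X i A) a n = w := by
  classical
  have hl : w.length = n := by simpa using h.length_eq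
  refine ⟨((Finset.range n).filter fun k => i ∈ w.getD k ∅).image fun k : ℕ => a + k, ?_, ?_⟩
  · intro p hp
    simp only [Finset.mem_image, Finset.mem_filter, Finset.mem_range] at hp
    obtain ⟨k, ⟨hk, -⟩, rfl⟩ := hp
    simp; omega
  · apply List.ext_getElem (by simp [hl])
    intro k h1 h2
    have hk : k < n := by simpa using h1
    have h3 := List.forall₂_iff_get.1 h
    have h4 := h3.2 k h2 (by simpa using hk)
    simp only [word, List.get_eq_getElem, List.getElem_map, List.getElem_range] at h4 ⊢
    ext j
    by_cases hj : j = i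
    · subst hj
      simp only [letter, Set.mem_ofPred_eq, Function.update_self, Finset.mem_image,
        Finset.mem_filter, Finset.mem_range, add_right_inj, Nat.cast_inj, exists_eq_right]
      simp [List.getElem?_eq_getElem h2, hk]
    · rw [h4 j hj]
      simp [letter, Function.update_of_ne hj]

theorem word_eq_replicate_of_disjoint (X : Config) (a b : ℤ) (m n : ℕ) (hw : InWindow X a m)
    (h : b + n ≤ a ∨ a + m ≤ b) : word X b n = List.replicate n ∅ := by
  rw [List.eq_replicate_iff]
  refine ⟨by simp, fun l hl => ?_⟩
  simp only [word, List.mem_map, List.mem_range] at hl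
  obtain ⟨k, hk, rfl⟩ := hl
  ext j
  simp only [letter, Set.mem_ofPred_eq, Set.mem_empty_iff_false, iff_false]
  intro hp
  have := Finset.mem_Ico.1 (hw j hp)
  omega

theorem agreeOff_replicate_empty (i : Track) (w : List (Set Track)) :
    List.Forall₂ (AgreeOff i) w (List.replicate w.length ∅) ↔ ∀ l ∈ w, l ⊆ {i} := by
  have key : ∀ l : Set Track, AgreeOff i l ∅ ↔ l ⊆ {i} := fun l => by
    simp only [AgreeOff, Set.mem_empty_iff_false, iff_false, Set.subset_singleton_iff]
    exact forall_congr' fun j => not_imp_not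
  induction w with
  | nil => simp
  | cons l w ih => simp [List.replicate_succ, ih, key]

/-- Changing the track `i` of a configuration that lies in a window gives, in a larger window, a
word whose middle part agrees with the old word off `i` and whose outer parts use the track `i`
only. -/
theorem exists_agreeOff_split {X : Config} {i : Track} {A : Finset ℤ} {a : ℤ} {m : ℕ}
    (hw : InWindow X a m) :
    ∃ (b : ℤ) (n : ℕ) (wl wm wr : List (Set Track)), InWindow (Function.update X i A) b n ∧
      word (Function.update X i A) b n = wl ++ wm ++ wr ∧ (∀ l ∈ wl, l ⊆ {i}) ∧
      List.Forall₂ (AgreeOff i) wm (word X a m) ∧ ∀ l ∈ wr, l ⊆ {i} := by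
  obtain ⟨c, hc⟩ : ∃ c : ℕ, ∀ p ∈ A, |p - a| ≤ c := by
    obtain ⟨c, hc⟩ := (A.image fun p => |p - a|).bddAbove
    refine ⟨c.toNat, fun p hp => (hc (Finset.mem_coe.2 (Finset.mem_image_of_mem _ hp))).trans ?_⟩
    exact Int.self_le_toNat c
  refine ⟨a - c, c + m + (c + 1), word (Function.update X i A) (a - c) c,
    word (Function.update X i A) a m, word (Function.update X i A) (a + m) (c + 1),
    ?_, ?_, ?_, agreeOff_word_update _ _ _ _ _, ?_⟩
  · intro j p hp
    rw [Finset.mem_Ico]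
    by_cases hj : j = i
    · subst hj
      rw [Function.update_self] at hp
      have := abs_le.1 (hc p hp)
      push_cast; omega
    · rw [Function.update_of_ne hj] at hp
      have := Finset.mem_Ico.1 (hw j hp)
      push_cast; omega
  · rw [word_add, word_add]
    rw [sub_add_cancel, show a - c + ((c + m : ℕ) : ℤ) = a + m by push_cast; ring]
  · have h := agreeOff_word_update X i A (a - c) c
    rw [word_eq_replicate_of_disjoint X a _ m c hw (by omega)] at h
    have h2 := agreeOff_replicate_empty i (word (Function.update X i A) (a - c) c)
    rw [word_length] at h2
    exact h2.1 h
  · have h := agreeOff_word_update X i A (a + m) (c + 1)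
    rw [word_eq_replicate_of_disjoint X a _ m (c + 1) hw (by omega)] at h
    have h2 := agreeOff_replicate_empty i (word (Function.update X i A) (a + m) (c + 1))
    rw [word_length] at h2
    exact h2.1 h

/-- The converse of `exists_agreeOff_split`, with control over the size of the new window. -/
theorem exists_update_of_split {X : Config} {i : Track} {a : ℤ} {m : ℕ}
    (hw : InWindow X a m) {wl wm wr : List (Set Track)} (hl : ∀ l ∈ wl, l ⊆ {i})
    (hm : List.Forall₂ (AgreeOff i) wm (word X a m)) (hr : ∀ l ∈ wr, l ⊆ {i}) :
    ∃ A ⊆ Finset.Ico (a - wl.length) (a + m + wr.length),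
      InWindow (Function.update X i A) (a - wl.length) (wl.length + m + wr.length) ∧
      word (Function.update X i A) (a - wl.length) (wl.length + m + wr.length) =
        wl ++ wm ++ wr := by
  obtain ⟨A, hA, hA'⟩ := exists_update_word_eq X i (a - wl.length) (wl.length + m + wr.length)
    (wl ++ wm ++ wr) (by
      rw [word_add, word_add]
      refine List.rel_append (List.rel_append ?_ ?_) ?_
      · rw [word_eq_replicate_of_disjoint X a _ m _ hw (by omega)]
        exact (agreeOff_replicate_empty i wl).2 hl
      · simpa using hm
      · rw [word_eq_replicate_of_disjoint X a _ m _ hw (by push_cast; omega)]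
        exact (agreeOff_replicate_empty i wr).2 hr)
  refine ⟨A, hA.trans (Finset.Ico_subset_Ico le_rfl (by push_cast; omega)), ?_, hA'⟩
  intro j p hp
  by_cases hj : j = i
  · subst hj
    rw [Function.update_self] at hp
    exact hA hp
  · rw [Function.update_of_ne hj] at hp
    have := Finset.mem_Ico.1 (hw j hp)
    rw [Finset.mem_Ico]
    push_cast; omega

/-- The automaton that guesses the track `i` by the subset construction. The guessed track may
extend beyond the word on both sides: the start set allows for a prefix, and acceptance for a
suffix, of letters that use the track `i` only. -/
def projDFA {Q : Type} (M : DFA (Set Track) Q) (i : Track) : DFA (Set Track) (Set Q) where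
  step S l := {q' | ∃ q ∈ S, ∃ l', AgreeOff i l' l ∧ q' = M.step q l'}
  start := {q | ∃ w, (∀ l ∈ w, l ⊆ {i}) ∧ q = M.eval w}
  accept := {S | ∃ q ∈ S, ∃ w, (∀ l ∈ w, l ⊆ {i}) ∧ M.evalFrom q w ∈ M.accept}

theorem mem_projDFA_evalFrom {Q : Type} (M : DFA (Set Track) Q) (i : Track)
    (w : List (Set Track)) (S : Set Q) (q' : Q) :
    q' ∈ (projDFA M i).evalFrom S w ↔
      ∃ q ∈ S, ∃ w', List.Forall₂ (AgreeOff i) w' w ∧ q' = M.evalFrom q w' := by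
  induction w generalizing S with
  | nil => simp
  | cons l w ih =>
    rw [DFA.evalFrom_cons, ih]
    constructor
    · rintro ⟨_, ⟨q, hq, l', hl', rfl⟩, w', hw', rfl⟩
      exact ⟨q, hq, l' :: w', .cons hl' hw', rfl⟩
    · rintro ⟨q, hq, _, hw', rfl⟩
      cases hw' with
      | cons hl' hw' => exact ⟨_, ⟨q, hq, _, hl', rfl⟩, _, hw', rfl⟩

theorem mem_projDFA_accepts {Q : Type} (M : DFA (Set Track) Q) (i : Track)
    (w : List (Set Track)) :
    w ∈ (projDFA M i).accepts ↔ ∃ wl wm wr, (∀ l ∈ wl, l ⊆ {i}) ∧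
      List.Forall₂ (AgreeOff i) wm w ∧ (∀ l ∈ wr, l ⊆ {i}) ∧ wl ++ wm ++ wr ∈ M.accepts := by
  rw [DFA.mem_accepts]
  constructor
  · rintro ⟨q, hq, wr, hr, hacc⟩
    obtain ⟨_, ⟨wl, hl, rfl⟩, wm, hm, rfl⟩ := (mem_projDFA_evalFrom M i w _ q).1 hq
    refine ⟨wl, wm, wr, hl, hm, hr, ?_⟩
    rw [DFA.mem_accepts, DFA.eval, DFA.evalFrom_of_append, DFA.evalFrom_of_append]
    exact hacc
  · rintro ⟨wl, wm, wr, hl, hm, hr, hacc⟩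
    rw [DFA.mem_accepts, DFA.eval, DFA.evalFrom_of_append, DFA.evalFrom_of_append] at hacc
    exact ⟨_, (mem_projDFA_evalFrom M i w _ _).2 ⟨_, ⟨wl, hl, rfl⟩, wm, hm, rfl⟩, wr, hr, hacc⟩

/-- Projection costs one exponential, that is, one level of the tower. -/
theorem Recog.ex {n : ℕ} {R : Config → Prop} (h : Recog n R) {i : Track} (hi : i ≠ .org) :
    Recog (n + 1) (fun X => ∃ A, R (Function.update X i A)) := by
  classical
  obtain ⟨Q, _, M, hc, H⟩ := h
  refine ⟨Set Q, inferInstance, projDFA M i, ?_, fun X a m hX hw => ?_⟩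
  · rw [Fintype.card_set]
    exact Nat.pow_le_pow_right (by norm_num) hc
  · have hX' : ∀ A, Function.update X i A .org = {0} := fun A => by
      rw [Function.update_of_ne hi.symm, hX]
    rw [mem_projDFA_accepts]
    constructor
    · rintro ⟨A, hA⟩
      obtain ⟨b, k, wl, wm, wr, hb, hk, hl, hm, hr⟩ := exists_agreeOff_split (i := i) (A := A) hw
      exact ⟨wl, wm, wr, hl, hm, hr, hk ▸ (H _ b k (hX' A) hb).1 hA⟩
    · rintro ⟨wl, wm, wr, hl, hm, hr, hacc⟩
      obtain ⟨A, -, hA, hA'⟩ := exists_update_of_split hw hl hm hr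
      exact ⟨A, (H _ _ _ (hX' A) hA).2 (hA' ▸ hacc)⟩

/-- A track that makes `R` true can be chosen to extend beyond the window of the other tracks by at
most the number of states on each side. -/
theorem Recog.exists_small_witness {n : ℕ} {R : Config → Prop} (h : Recog n R) {i : Track}
    (hi : i ≠ .org) {X : Config} (hX : X .org = {0}) {a : ℤ} {m : ℕ} (hw : InWindow X a m)
    (hR : ∃ A, R (Function.update X i A)) :
    ∃ A ⊆ Finset.Ico (a - tower n) (a + m + tower n), R (Function.update X i A) := by
  classical
  obtain ⟨Q, _, M, hc, H⟩ := h
  have hX' : ∀ A, Function.update X i A .org = {0} := fun A => by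
    rw [Function.update_of_ne hi.symm, hX]
  obtain ⟨A, hA⟩ := hR
  obtain ⟨b, k, wl, wm, wr, hb, hk, hl, hm, hr⟩ := exists_agreeOff_split (i := i) (A := A) hw
  have hacc := (H _ b k (hX' A) hb).1 hA
  rw [hk, DFA.mem_accepts, DFA.eval, DFA.evalFrom_of_append, DFA.evalFrom_of_append] at hacc
  obtain ⟨wl', hl', el, cl⟩ := exists_short_word M {l | l ⊆ {i}} wl hl M.start
  obtain ⟨wr', hr', er, cr⟩ := exists_short_word M {l | l ⊆ {i}} wr hr
    (M.evalFrom (M.evalFrom M.start wl) wm)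
  obtain ⟨A', hs, hA, hA'⟩ := exists_update_of_split hw hl' hm hr'
  refine ⟨A', hs.trans (Finset.Ico_subset_Ico (by omega) (by omega)),
    (H _ _ _ (hX' A') hA).2 ?_⟩
  rw [hA', DFA.mem_accepts, DFA.eval, DFA.evalFrom_of_append, DFA.evalFrom_of_append, el, er]
  exact hacc

/-! ### Basic recognizable relations -/

theorem InWindow.mem {X : Config} {a : ℤ} {m : ℕ} (h : InWindow X a m) {i : Track} {p : ℤ}
    (hp : p ∈ X i) : a ≤ p ∧ p < a + m :=
  Finset.mem_Ico.1 (h i hp)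

/-- A condition that is imposed on every letter. The empty letter has to satisfy it because the
condition extends over all integers, also those outside of the window. -/
theorem Recog.pointwise (β : Set Track → Prop) (hβ : β ∅) :
    Recog 0 (fun X => ∀ p, β (letter X p)) := by
  refine ⟨Prop, inferInstance, ⟨fun s l => s ∧ β l, True, {s | s}⟩, by simp [tower],
    fun X a m _ hw => ?_⟩
  have key : ∀ n : ℕ, DFA.eval ⟨fun s l => s ∧ β l, True, {s | s}⟩ (word X a n) ↔
      ∀ p, a ≤ p → p < a + n → β (letter X p) := by
    intro n
    induction n with
    | zero =>
      refine iff_of_true trivial fun p h1 h2 => ?_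
      push_cast at h2; omega
    | succ n ih =>
      rw [word_succ, DFA.eval_append_singleton]
      dsimp only
      rw [ih]
      constructor
      · rintro ⟨h1, h2⟩ p hp hp'
        rcases eq_or_ne p (a + n) with rfl | hne
        · exact h2
        · exact h1 p hp (by push_cast at hp'; omega)
      · exact fun h => ⟨fun p hp hp' => h p hp (by push_cast; omega),
          h _ (by omega) (by push_cast; omega)⟩
  rw [DFA.mem_accepts]
  refine Iff.trans ?_ (key m).symm
  refine ⟨fun h p _ _ => h p, fun h p => ?_⟩
  by_cases hp : a ≤ p ∧ p < a + m
  · exact h p hp.1 hp.2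
  · have : letter X p = ∅ := by
      ext i
      exact iff_of_false (fun hi => hp (hw.mem hi)) (fun h => h)
    rwa [this]

/-- One track lies weakly to the left of another one. -/
theorem Recog.allLe (k j : Track) : Recog 0 (fun X => ∀ p ∈ X k, ∀ q ∈ X j, p ≤ q) := by
  -- The state records whether the condition holds so far and whether `j` has been seen.
  let M : DFA (Set Track) (Prop × Prop) :=
    ⟨fun s l => (s.1 ∧ ¬ (s.2 ∧ k ∈ l), s.2 ∨ j ∈ l), (True, False), {s | s.1}⟩
  refine ⟨Prop × Prop, inferInstance, M, by simp [tower], fun X a m _ hw => ?_⟩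
  have key : ∀ n : ℕ, ((M.eval (word X a n)).1 ↔
        ∀ p ∈ X k, p < a + n → ∀ q ∈ X j, p ≤ q) ∧
      ((M.eval (word X a n)).2 ↔ ∃ q ∈ X j, q < a + n) := by
    intro n
    induction n with
    | zero =>
      refine ⟨iff_of_true trivial fun p hp h => ?_, iff_of_false (fun h => h) ?_⟩
      · have := hw.mem hp
        push_cast at h; omega
      · rintro ⟨q, hq, h⟩
        have := hw.mem hq
        push_cast at h; omega
    | succ n ih =>
      rw [word_succ, DFA.eval_append_singleton]
      constructor
      · change (_ ∧ ¬ (_ ∧ _ ∈ X k)) ↔ _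
        rw [ih.1, ih.2]
        constructor
        · rintro ⟨h1, h2⟩ p hp hlt q hq
          rcases eq_or_ne p (a + n) with rfl | hne
          · by_contra hc
            exact h2 ⟨⟨q, hq, not_le.1 hc⟩, hp⟩
          · exact h1 p hp (by push_cast at hlt; omega) q hq
        · refine fun h => ⟨fun p hp hlt q hq => h p hp (by push_cast; omega) q hq, ?_⟩
          rintro ⟨⟨q, hq, hlt⟩, hp⟩
          have := h _ hp (by push_cast; omega) q hq
          omega
      · change (_ ∨ _ ∈ X j) ↔ _
        rw [ih.2]
        constructor
        · rintro (⟨q, hq, h⟩ | h)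
          · exact ⟨q, hq, by push_cast; omega⟩
          · exact ⟨_, h, by push_cast; omega⟩
        · rintro ⟨q, hq, h⟩
          rcases eq_or_ne q (a + n) with rfl | hne
          · exact Or.inr hq
          · exact Or.inl ⟨q, hq, by push_cast at h; omega⟩
  rw [DFA.mem_accepts]
  refine Iff.trans ?_ (key m).1.symm
  exact ⟨fun h p hp _ => h p hp, fun h p hp => h p hp (hw.mem hp).2⟩

/-- One track is another one moved by one position to the right. -/
theorem Recog.succ (k j : Track) : Recog 0 (fun X => ∀ p, p ∈ X k ↔ p - 1 ∈ X j) := by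
  -- The state records whether the condition holds so far and whether `j` is on the last letter;
  -- at the end of the window `j` must not be, since `k` contains no position beyond it.
  let M : DFA (Set Track) (Prop × Prop) :=
    ⟨fun s l => (s.1 ∧ (k ∈ l ↔ s.2), j ∈ l), (True, False), {s | s.1 ∧ ¬ s.2}⟩
  refine ⟨Prop × Prop, inferInstance, M, by simp [tower], fun X a m _ hw => ?_⟩
  have key : ∀ n : ℕ, ((M.eval (word X a n)).1 ↔
        ∀ p < a + n, (p ∈ X k ↔ p - 1 ∈ X j)) ∧
      ((M.eval (word X a n)).2 ↔ a + n - 1 ∈ X j) := by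
    intro n
    induction n with
    | zero =>
      refine ⟨iff_of_true trivial fun p h => iff_of_false (fun hp => ?_) (fun hp => ?_),
        iff_of_false (fun h => h) (fun hp => ?_)⟩ <;>
      · have := hw.mem hp
        push_cast at *; omega
    | succ n ih =>
      rw [word_succ, DFA.eval_append_singleton]
      constructor
      · change (_ ∧ (_ ∈ X k ↔ _)) ↔ _
        rw [ih.1, ih.2]
        constructor
        · rintro ⟨h1, h2⟩ p hlt
          rcases eq_or_ne p (a + n) with rfl | hne
          · exact h2
          · exact h1 p (by push_cast at hlt; omega)
        · exact fun h => ⟨fun p hlt => h p (by push_cast; omega), h _ (by push_cast; omega)⟩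
      · change (_ ∈ X j) ↔ _
        rw [show a + ((n + 1 : ℕ) : ℤ) - 1 = a + n by push_cast; ring]
  rw [DFA.mem_accepts]
  change _ ↔ (M.eval _).1 ∧ ¬ (M.eval _).2
  rw [(key m).1, (key m).2]
  constructor
  · refine fun h => ⟨fun p _ => h p, fun hp => ?_⟩
    have := hw.mem ((h (a + m)).2 hp)
    omega
  · rintro ⟨h, hl⟩ p
    by_cases hp : p < a + m
    · exact h p hp
    · refine iff_of_false (fun hp' => hp (hw.mem hp').2) fun hp' => ?_
      have := hw.mem hp'
      rw [show p = a + m by omega] at hp'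
      exact hl hp'

/-! ### Definable relations -/

theorem Recog.all {n : ℕ} {R : Config → Prop} (h : Recog n R) {i : Track} (hi : i ≠ .org) :
    Recog (n + 1) (fun X => ∀ A, R (Function.update X i A)) :=
  (h.not.ex hi).not.congr fun X _ => by simp

theorem minVal_eq_some {A : Finset ℤ} {n : ℤ} :
    minVal A = some n ↔ n ∈ A ∧ ∀ q ∈ A, n ≤ q := by
  unfold minVal
  split_ifs with h
  · rw [Option.some.injEq]
    constructor
    · rintro rfl
      exact ⟨A.min'_mem h, fun q hq => A.min'_le q hq⟩
    · rintro ⟨h1, h2⟩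
      exact le_antisymm (A.min'_le _ h1) (h2 _ (A.min'_mem h))
  · simp only [false_iff, not_and]
    exact fun hn => absurd ⟨n, hn⟩ h

theorem maxVal_eq_some {A : Finset ℤ} {n : ℤ} :
    maxVal A = some n ↔ n ∈ A ∧ ∀ q ∈ A, q ≤ n := by
  unfold maxVal
  split_ifs with h
  · rw [Option.some.injEq]
    constructor
    · rintro rfl
      exact ⟨A.max'_mem h, fun q hq => A.le_max' q hq⟩
    · rintro ⟨h1, h2⟩
      exact le_antisymm (h2 _ (A.max'_mem h)) (A.le_max' _ h1)
  · simp only [false_iff, not_and]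
    exact fun hn => absurd ⟨n, hn⟩ h

theorem minVal_eq_none {A : Finset ℤ} : minVal A = none ↔ A = ∅ := by
  unfold minVal
  split_ifs with h
  · simp [h.ne_empty]
  · simpa using Finset.not_nonempty_iff_eq_empty.1 h

theorem Recog.subset (k j : Track) : Recog 0 (fun X => X k ⊆ X j) :=
  (Recog.pointwise (fun l => k ∈ l → j ∈ l) (by simp)).congr fun _ _ => Iff.rfl

theorem Recog.eqTrack (k j : Track) : Recog 0 (fun X => X k = X j) :=
  (Recog.pointwise (fun l => k ∈ l ↔ j ∈ l) (by simp)).congr fun _ _ => Finset.ext_iff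

theorem Recog.eqEmpty (k : Track) : Recog 0 (fun X => X k = ∅) :=
  (Recog.pointwise (fun l => k ∉ l) (by simp)).congr fun _ _ => Finset.eq_empty_iff_forall_notMem

theorem Recog.isMin (k j : Track) :
    Recog 2 (fun X => ∃ n, minVal (X j) = some n ∧ X k = {n}) :=
  (((Recog.allLe k j).and (Recog.subset k j)).and
    ((Recog.eqEmpty k).not.mono zero_le_one)).congr fun X _ => by
    constructor
    · rintro ⟨n, hn, hk⟩
      rw [minVal_eq_some] at hn
      rw [hk]
      simpa using hn.symm
    · rintro ⟨⟨h1, h2⟩, h3⟩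
      obtain ⟨n, hn⟩ := Finset.nonempty_iff_ne_empty.2 h3
      refine ⟨n, minVal_eq_some.2 ⟨h2 hn, h1 n hn⟩, Finset.eq_singleton_iff_unique_mem.2 ⟨hn, ?_⟩⟩
      exact fun p hp => le_antisymm (h1 p hp n (h2 hn)) (h1 n hn p (h2 hp))

theorem Recog.isMax (k j : Track) :
    Recog 2 (fun X => ∃ n, maxVal (X j) = some n ∧ X k = {n}) :=
  (((Recog.allLe j k).and (Recog.subset k j)).and
    ((Recog.eqEmpty k).not.mono zero_le_one)).congr fun X _ => by
    constructor
    · rintro ⟨n, hn, hk⟩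
      rw [maxVal_eq_some] at hn
      rw [hk]
      simpa using hn.symm
    · rintro ⟨⟨h1, h2⟩, h3⟩
      obtain ⟨n, hn⟩ := Finset.nonempty_iff_ne_empty.2 h3
      have h1' : ∀ p ∈ X j, p ≤ n := fun p hp => h1 p hp n hn
      refine ⟨n, maxVal_eq_some.2 ⟨h2 hn, h1'⟩, Finset.eq_singleton_iff_unique_mem.2 ⟨hn, ?_⟩⟩
      exact fun p hp => le_antisymm (h1' p (h2 hp)) (h1 n (h2 hn) p hp)

/-! ### Automata for terms and formulas -/

/-- The value of the integer variable `x` in a configuration. An integer is carried by its track as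
a singleton; taking the minimum, and `0` if the track is empty, gives every configuration a
meaning, so that quantification over integers becomes quantification over sets. -/
def intVal (X : Config) (x : ℕ) : ℤ := (minVal (X (.int x))).getD 0

/-- The value of the set variable `S` in a configuration. -/
def setVal (X : Config) (S : ℕ) : Finset ℤ := X (.set S)

@[simp] theorem intVal_update_scr (X : Config) (k : ℕ) (A : Finset ℤ) :
    intVal (Function.update X (.scr k) A) = intVal X := by
  ext x; simp [intVal]

@[simp] theorem setVal_update_scr (X : Config) (k : ℕ) (A : Finset ℤ) :
    setVal (Function.update X (.scr k) A) = setVal X := by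
  ext x; simp [setVal]

/-- Translation by a natural number, as a chain of translations by one. The scratch tracks from `f`
on have to be free. -/
theorem Recog.addConst (n : ℕ) (j k : Track) (f : ℕ)
    (hf : ∀ i ≥ f, j ≠ .scr i ∧ k ≠ .scr i) :
    Recog (2 * n) (fun X => ∀ p, p ∈ X k ↔ p - n ∈ X j) := by
  induction n generalizing j f with
  | zero => exact (Recog.eqTrack k j).congr fun X _ => by simp [Finset.ext_iff]
  | succ n ih =>
    refine ((((Recog.succ (.scr f) j).mono (Nat.zero_le (2 * n))).and
      (ih (.scr f) (f + 1) fun i hi => ⟨by simp; omega, (hf i (by omega)).2⟩)).ex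
        (i := .scr f) (by simp)).congr fun X _ => ?_
    simp only [Function.update_self, Function.update_of_ne (hf f le_rfl).1,
      Function.update_of_ne (hf f le_rfl).2]
    have e : ∀ p : ℤ, p - n - 1 = p - ((n + 1 : ℕ) : ℤ) := fun p => by push_cast; ring
    constructor
    · refine fun h => ⟨(X j).map (Equiv.addRight (1 : ℤ)).toEmbedding, fun p => ?_, fun p => ?_⟩
      · simp [Finset.mem_map_equiv, sub_eq_add_neg]
      · rw [h p, ← e p]
        simp [Finset.mem_map_equiv, sub_eq_add_neg]
    · rintro ⟨A, h1, h2⟩ p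
      rw [h2, h1, e]

/-- Translation by an integer. -/
theorem Recog.addInt (c : ℤ) (j k : Track) (f : ℕ)
    (hf : ∀ i ≥ f, j ≠ .scr i ∧ k ≠ .scr i) :
    Recog (2 * c.natAbs) (fun X => ∀ p, p ∈ X k ↔ p - c ∈ X j) := by
  rcases Int.natAbs_eq c with h | h
  · refine (Recog.addConst c.natAbs j k f hf).congr fun X _ => ?_
    rw [← h]
  · refine (Recog.addConst c.natAbs k j f fun i hi => (hf i hi).symm).congr fun X _ => ?_
    constructor
    · intro H p
      rw [H, show p - (c.natAbs : ℤ) - c = p by omega]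
    · intro H p
      rw [H, show p - c - (c.natAbs : ℤ) = p by omega]

theorem natAbs_le_code (c : ℤ) : c.natAbs ≤ Equiv.intEquivNat c := by
  cases c with
  | ofNat n =>
    have h : Equiv.intEquivNat (Int.ofNat n) = 2 * n := rfl
    rw [h]
    change n ≤ 2 * n
    omega
  | negSucc n =>
    have h : Equiv.intEquivNat (Int.negSucc n) = 2 * n + 1 := rfl
    rw [h]
    change n + 1 ≤ 2 * n + 1
    omega

/-- A binary operation on sets that is computed letter by letter by `β`. The two arguments are
guessed on the scratch tracks `k + 1` and `k + 2`; the hypotheses `ho` and `ho'` say that their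
values do not depend on scratch tracks. -/
theorem Recog.binop {n k : ℕ} {o o' : Config → Option (Finset ℤ)}
    (ho : ∀ X j A, o (Function.update X (.scr j) A) = o X)
    (ho' : ∀ X j A, o' (Function.update X (.scr j) A) = o' X)
    (h : Recog n (fun X => o X = some (X (.scr (k + 1)))))
    (h' : Recog n (fun X => o' X = some (X (.scr (k + 2)))))
    (f : Finset ℤ → Finset ℤ → Finset ℤ) (β : Prop → Prop → Prop) (hβ : ¬ β False False)
    (hf : ∀ A B p, p ∈ f A B ↔ β (p ∈ A) (p ∈ B)) :
    Recog (n + 4) (fun X => ((o X).bind fun A => (o' X).bind fun B => some (f A B)) =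
      some (X (.scr k))) := by
  refine (((h.and h').and ((Recog.pointwise
    (fun l => β (.scr (k + 1) ∈ l) (.scr (k + 2) ∈ l) ↔ .scr k ∈ l)
    (by simpa using hβ)).mono (Nat.zero_le _))).ex (i := .scr (k + 2)) (by simp)).ex
    (i := .scr (k + 1)) (by simp) |>.congr fun X _ => ?_
  simp only [Option.bind_eq_some_iff, Option.some.injEq, ho, ho', letter, Set.mem_ofPred_eq,
    Finset.ext_iff, hf, Function.update_self]
  have h1 : Track.scr (k + 1) ≠ .scr (k + 2) := by simp
  have h2 : Track.scr k ≠ .scr (k + 2) := by simp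
  have h3 : Track.scr k ≠ .scr (k + 1) := by simp
  simp only [Function.update_of_ne h1, Function.update_of_ne h2, Function.update_of_ne h3,
    Function.update_self, and_assoc]
  exact exists_congr fun A => ⟨fun ⟨hA, B, hB⟩ => ⟨B, hA, hB⟩, fun ⟨B, hA, hB⟩ => ⟨hA, B, hB⟩⟩

/-- The scratch track `k` holds the value of an integer term. -/
def HasValue (X : Config) (k : ℕ) (o : Option ℤ) : Prop := ∃ n, o = some n ∧ X (.scr k) = {n}

mutual
/-- That the scratch track `k` holds the value of the set term `s` is recognized. -/
theorem SetTerm.recog : ∀ (s : SetTerm) (k : ℕ),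
    Recog (2 * s.code + 4) (fun X => s.eval (intVal X) (setVal X) = some (X (.scr k)))
  | .empty, k => ((Recog.eqEmpty (.scr k)).mono (Nat.zero_le _)).congr fun X _ => by
      simp [SetTerm.eval, eq_comm]
  | .var S, k => ((Recog.eqTrack (.set S) (.scr k)).mono (Nat.zero_le _)).congr fun X _ => by
      simp [SetTerm.eval, setVal]
  | .single t, k => ((IntTerm.recog t k).mono (by simp only [SetTerm.code]; omega)).congr
      fun X _ => by
        simp only [SetTerm.eval, HasValue, Option.bind_eq_some_iff, Option.some.injEq]
        exact exists_congr fun n => and_congr_right fun _ => eq_comm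
  | .union s t, k => by
      have h := Nat.left_le_pair s.code t.code
      have h' := Nat.right_le_pair s.code t.code
      exact (Recog.binop (by simp) (by simp)
        ((SetTerm.recog s (k + 1)).mono (n' := 2 * Nat.pair s.code t.code + 4) (by omega))
        ((SetTerm.recog t (k + 2)).mono (by omega)) (· ∪ ·) (fun P Q => P ∨ Q) (by simp)
        (by simp)).mono (by simp only [SetTerm.code]; omega) |>.congr fun X _ => Iff.rfl
  | .inter s t, k => by
      have h := Nat.left_le_pair s.code t.code
      have h' := Nat.right_le_pair s.code t.code
      exact (Recog.binop (by simp) (by simp)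
        ((SetTerm.recog s (k + 1)).mono (n' := 2 * Nat.pair s.code t.code + 4) (by omega))
        ((SetTerm.recog t (k + 2)).mono (by omega)) (· ∩ ·) (fun P Q => P ∧ Q) (by simp)
        (by simp)).mono (by simp only [SetTerm.code]; omega) |>.congr fun X _ => Iff.rfl
  | .diff s t, k => by
      have h := Nat.left_le_pair s.code t.code
      have h' := Nat.right_le_pair s.code t.code
      exact (Recog.binop (by simp) (by simp)
        ((SetTerm.recog s (k + 1)).mono (n' := 2 * Nat.pair s.code t.code + 4) (by omega))
        ((SetTerm.recog t (k + 2)).mono (by omega)) (· \ ·) (fun P Q => P ∧ ¬ Q) (by simp)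
        (by simp)).mono (by simp only [SetTerm.code]; omega) |>.congr fun X _ => Iff.rfl

theorem IntTerm.recog : ∀ (t : IntTerm) (k : ℕ),
    Recog (2 * t.code + 4) (fun X => HasValue X k (t.eval (intVal X) (setVal X)))
  | .const c, k => by
      refine ((Recog.addInt c .org (.scr k) (k + 1) fun i hi => ⟨by simp, by simp; omega⟩).mono
        (by have := natAbs_le_code c; simp only [IntTerm.code]; omega)).congr fun X hX => ?_
      simp [IntTerm.eval, HasValue, hX, Finset.ext_iff, sub_eq_zero]
  | .var x, k => by
      -- By the convention of `intVal`, an empty track stands for `0`, the value on `org`.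
      refine ((((Recog.isMin (.scr k) (.int x)).or
        (((Recog.eqEmpty (.int x)).and (Recog.eqTrack (.scr k) .org)).mono one_le_two))).mono
        (by omega)).congr fun X hX => ?_
      simp only [IntTerm.eval, HasValue, Option.some.injEq, exists_eq_left', intVal, hX]
      rw [← minVal_eq_none]
      cases minVal (X (.int x)) <;> simp
  | .min s, k => by
      refine ((((SetTerm.recog s (k + 1)).and ((Recog.isMin (.scr k) (.scr (k + 1))).mono
        (by omega))).ex (i := .scr (k + 1)) (by simp)).mono
        (by simp only [IntTerm.code]; omega)).congr fun X hX => ?_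
      simp [IntTerm.eval, HasValue, Option.bind_eq_some_iff]
      aesop
  | .max s, k => by
      refine ((((SetTerm.recog s (k + 1)).and ((Recog.isMax (.scr k) (.scr (k + 1))).mono
        (by omega))).ex (i := .scr (k + 1)) (by simp)).mono
        (by simp only [IntTerm.code]; omega)).congr fun X hX => ?_
      simp [IntTerm.eval, HasValue, Option.bind_eq_some_iff]
      aesop
end

/-- Truth of a formula when the truth values of the atoms `T_m ⋈ 0` are prescribed by `τ`. -/
def Formula.HoldsGiven (τ : IntRel → PresTerm → Prop) :
    Formula → (ℕ → ℤ) → (ℕ → Finset ℤ) → Prop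
  | .setAtom r s t, v, V => (Formula.setAtom r s t).Holds v V
  | .diffAtom r t u c, v, V => (Formula.diffAtom r t u c).Holds v V
  | .presAtom r p, _, _ => τ r p
  | .and φ ψ, v, V => φ.HoldsGiven τ v V ∧ ψ.HoldsGiven τ v V
  | .neg φ, v, V => ¬ φ.HoldsGiven τ v V
  | .allInt x φ, v, V => ∀ n : ℤ, φ.HoldsGiven τ (Function.update v x n) V
  | .allSet S φ, v, V => ∀ A : Finset ℤ, φ.HoldsGiven τ v (Function.update V S A)

/-- A relation that compares two tracks which carry an integer each. -/
theorem Recog.intRel (r : IntRel) (j k : Track) :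
    ∃ R, Recog 0 R ∧ ∀ (X : Config) (m n : ℤ), X j = {m} → X k = {n} → (R X ↔ r.Holds m n) := by
  cases r with
  | eq => exact ⟨_, Recog.eqTrack j k, fun X m n h h' => by simp [h, h', IntRel.Holds]⟩
  | le => exact ⟨_, Recog.allLe j k, fun X m n h h' => by simp [h, h', IntRel.Holds]⟩
  | ge => exact ⟨_, Recog.allLe k j, fun X m n h h' => by simp [h, h', IntRel.Holds]⟩

theorem Recog.setRel (r : SetRel) (j k : Track) : Recog 1 (fun X => r.Holds (X j) (X k)) := by
  cases r with
  | eq => exact (Recog.eqTrack j k).mono zero_le_one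
  | subset => exact (Recog.subset j k).mono zero_le_one
  | supset => exact (Recog.subset k j).mono zero_le_one
  | ssubset => exact (Recog.subset j k).and (Recog.subset k j).not
  | ssupset => exact (Recog.subset k j).and (Recog.subset j k).not

theorem intVal_update_int (X : Config) (x : ℕ) (A : Finset ℤ) :
    intVal (Function.update X (.int x) A) =
      Function.update (intVal X) x ((minVal A).getD 0) := by
  ext y
  by_cases h : y = x
  · subst h; simp [intVal]
  · simp [intVal, h]

theorem setVal_update_int (X : Config) (x : ℕ) (A : Finset ℤ) :
    setVal (Function.update X (.int x) A) = setVal X := by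
  ext y; simp [setVal]

theorem intVal_update_set (X : Config) (x : ℕ) (A : Finset ℤ) :
    intVal (Function.update X (.set x) A) = intVal X := by
  ext y; simp [intVal]

theorem setVal_update_set (X : Config) (x : ℕ) (A : Finset ℤ) :
    setVal (Function.update X (.set x) A) = Function.update (setVal X) x A := by
  ext y
  by_cases h : y = x
  · subst h; simp [setVal]
  · simp [setVal, h]

theorem minVal_singleton (n : ℤ) : minVal {n} = some n := by
  simp [minVal_eq_some]

/-- With prescribed truth values of the atoms `T_m ⋈ 0`, the models of a formula are recognized by
an automaton. The code of a formula exceeds the codes of its parts by enough to pay for the levels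
of the tower that the outermost constructor costs. -/
theorem Formula.recog (τ : IntRel → PresTerm → Prop) : ∀ φ : Formula,
    Recog (2 * φ.code + 20) (fun X => φ.HoldsGiven τ (intVal X) (setVal X))
  | .setAtom r s t => by
      have h := Nat.left_le_pair s.code t.code
      have h' := Nat.right_le_pair s.code t.code
      refine (((((s.recog 0).mono (n' := 2 * Nat.pair s.code t.code + 4)
        (by omega)).and ((t.recog 1).mono (by omega))).and
        ((Recog.setRel r (.scr 0) (.scr 1)).mono (by omega))).ex (i := .scr 1) (by simp)).ex
        (i := .scr 0) (by simp) |>.mono (by simp only [Formula.code]; omega) |>.congr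
        fun X _ => ?_
      simp [Formula.HoldsGiven, Formula.Holds, and_assoc]
  | .diffAtom r t u c => by
      have h := Nat.left_le_pair t.code (Nat.pair u.code (Equiv.intEquivNat c))
      have h' := Nat.right_le_pair t.code (Nat.pair u.code (Equiv.intEquivNat c))
      have h2 := Nat.left_le_pair u.code (Equiv.intEquivNat c)
      have h2' := Nat.right_le_pair u.code (Equiv.intEquivNat c)
      have h3 := natAbs_le_code c
      obtain ⟨R, hR, hR'⟩ := Recog.intRel r (.scr 0) (.scr 2)
      refine (((((t.recog 0).mono
        (n' := 2 * Nat.pair t.code (Nat.pair u.code (Equiv.intEquivNat c)) + 4)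
        (by omega)).and ((u.recog 1).mono (by omega))).and
        (((Recog.addInt c (.scr 1) (.scr 2) 3 fun i hi => ⟨by simp; omega, by simp; omega⟩).mono
          (by omega)).and (hR.mono (by omega)))).ex (i := .scr 2)
        (by simp)).ex (i := .scr 1) (by simp) |>.ex
        (i := .scr 0) (by simp) |>.mono (by simp only [Formula.code]; omega) |>.congr
        fun X _ => ?_
      simp only [Formula.HoldsGiven, Formula.Holds, HasValue, intVal_update_scr,
        setVal_update_scr]
      constructor
      · rintro ⟨m, n, hm, hn, h⟩
        refine ⟨{m}, {n}, {n + c}, ⟨⟨m, hm, by simp⟩, n, hn, by simp⟩, fun p => ?_, ?_⟩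
        · simp [sub_eq_iff_eq_add]
        · exact (hR' _ m (n + c) (by simp) (by simp)).2 h
      · rintro ⟨A₀, A₁, A, ⟨⟨m, hm, h0⟩, n, hn, h1⟩, hA, h⟩
        simp only [ne_eq, Track.scr.injEq,
          zero_ne_one, not_false_eq_true, Function.update_of_ne, Function.update_self,
          OfNat.zero_ne_ofNat, OfNat.one_ne_ofNat] at h0 h1 hA
        refine ⟨m, n, hm, hn, (hR' _ m (n + c) (by simp [h0]) ?_).1 h⟩
        ext p
        simp [hA, h1, sub_eq_iff_eq_add]
  | .presAtom r p => ((Recog.const (τ r p)).mono (Nat.zero_le _)).congr fun X _ => Iff.rfl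
  | .and φ ψ => by
      have h := Nat.left_le_pair φ.code ψ.code
      have h' := Nat.right_le_pair φ.code ψ.code
      exact (((φ.recog τ).mono (n' := 2 * Nat.pair φ.code ψ.code + 20) (by omega)).and
        ((ψ.recog τ).mono (by omega))).mono (by simp only [Formula.code]; omega) |>.congr
        fun X _ => Iff.rfl
  | .neg φ => ((φ.recog τ).not.mono (by simp only [Formula.code]; omega)).congr fun X _ => Iff.rfl
  | .allInt x φ => by
      have h := Nat.right_le_pair x φ.code
      refine (((φ.recog τ).all (i := .int x) (by simp)).mono
        (by simp only [Formula.code]; omega)).congr fun X _ => ?_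
      simp only [intVal_update_int, setVal_update_int, Formula.HoldsGiven]
      exact ⟨fun H A => H _, fun H n => by simpa [minVal_singleton] using H {n}⟩
  | .allSet S φ => by
      have h := Nat.right_le_pair S φ.code
      refine (((φ.recog τ).all (i := .set S) (by simp)).mono
        (by simp only [Formula.code]; omega)).congr fun X _ => ?_
      simp only [intVal_update_set, setVal_update_set, Formula.HoldsGiven]

/-! ### Dependence on the variables -/

mutual
theorem SetTerm.eval_congr {v v' : ℕ → ℤ} {V V' : ℕ → Finset ℤ} : ∀ s : SetTerm,
    (∀ x, s.HasInt x → v x = v' x) → (∀ S, s.HasSet S → V S = V' S) → s.eval v V = s.eval v' V'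
  | .empty, _, _ => rfl
  | .var S, _, h => by rw [SetTerm.eval, SetTerm.eval, h S rfl]
  | .single t, h, h' => by rw [SetTerm.eval, SetTerm.eval, IntTerm.eval_congr t h h']
  | .union s t, h, h' => by
      rw [SetTerm.eval, SetTerm.eval,
        SetTerm.eval_congr s (fun x hx => h x (.inl hx)) (fun x hx => h' x (.inl hx)),
        SetTerm.eval_congr t (fun x hx => h x (.inr hx)) (fun x hx => h' x (.inr hx))]
  | .inter s t, h, h' => by
      rw [SetTerm.eval, SetTerm.eval,
        SetTerm.eval_congr s (fun x hx => h x (.inl hx)) (fun x hx => h' x (.inl hx)),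
        SetTerm.eval_congr t (fun x hx => h x (.inr hx)) (fun x hx => h' x (.inr hx))]
  | .diff s t, h, h' => by
      rw [SetTerm.eval, SetTerm.eval,
        SetTerm.eval_congr s (fun x hx => h x (.inl hx)) (fun x hx => h' x (.inl hx)),
        SetTerm.eval_congr t (fun x hx => h x (.inr hx)) (fun x hx => h' x (.inr hx))]

theorem IntTerm.eval_congr {v v' : ℕ → ℤ} {V V' : ℕ → Finset ℤ} : ∀ t : IntTerm,
    (∀ x, t.HasInt x → v x = v' x) → (∀ S, t.HasSet S → V S = V' S) → t.eval v V = t.eval v' V'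
  | .const c, _, _ => rfl
  | .var x, h, _ => by rw [IntTerm.eval, IntTerm.eval, h x rfl]
  | .min s, h, h' => by rw [IntTerm.eval, IntTerm.eval, SetTerm.eval_congr s h h']
  | .max s, h, h' => by rw [IntTerm.eval, IntTerm.eval, SetTerm.eval_congr s h h']
end

theorem PresTerm.eval_congr {v v' : ℕ → ℤ} {V V' : ℕ → Finset ℤ} : ∀ p : PresTerm,
    (∀ x, p.HasInt x → v x = v' x) → (∀ S, p.HasSet S → V S = V' S) → p.eval v V = p.eval v' V'
  | .base t, h, h' => t.eval_congr h h'
  | .add s t, h, h' => by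
      rw [PresTerm.eval, PresTerm.eval,
        PresTerm.eval_congr s (fun x hx => h x (.inl hx)) (fun x hx => h' x (.inl hx)),
        PresTerm.eval_congr t (fun x hx => h x (.inr hx)) (fun x hx => h' x (.inr hx))]
  | .sub s t, h, h' => by
      rw [PresTerm.eval, PresTerm.eval,
        PresTerm.eval_congr s (fun x hx => h x (.inl hx)) (fun x hx => h' x (.inl hx)),
        PresTerm.eval_congr t (fun x hx => h x (.inr hx)) (fun x hx => h' x (.inr hx))]

theorem le_pair_of_hasVar {x a b : ℕ} {P P' Q Q' : Prop} (h : P ∨ P' → x ≤ a)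
    (h' : Q ∨ Q' → x ≤ b) : (P ∨ Q) ∨ (P' ∨ Q') → x ≤ Nat.pair a b := by
  rintro ((hp | hq) | (hp | hq))
  · exact (h (.inl hp)).trans (Nat.left_le_pair a b)
  · exact (h' (.inl hq)).trans (Nat.right_le_pair a b)
  · exact (h (.inr hp)).trans (Nat.left_le_pair a b)
  · exact (h' (.inr hq)).trans (Nat.right_le_pair a b)

mutual
/-- The variables of a term have names that are at most its code. -/
theorem SetTerm.le_code {x : ℕ} : ∀ s : SetTerm, s.HasInt x ∨ s.HasSet x → x ≤ s.code
  | .empty, h => by simp [SetTerm.HasInt, SetTerm.HasSet] at h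
  | .var S, h => by
      rcases h with h | rfl
      · exact h.elim
      · simp only [SetTerm.code]; omega
  | .single t, h => by
      have := IntTerm.le_code t h
      simp only [SetTerm.code]; omega
  | .union s t, h => by
      have := le_pair_of_hasVar s.le_code t.le_code h
      simp only [SetTerm.code]; omega
  | .inter s t, h => by
      have := le_pair_of_hasVar s.le_code t.le_code h
      simp only [SetTerm.code]; omega
  | .diff s t, h => by
      have := le_pair_of_hasVar s.le_code t.le_code h
      simp only [SetTerm.code]; omega

theorem IntTerm.le_code {x : ℕ} : ∀ t : IntTerm, t.HasInt x ∨ t.HasSet x → x ≤ t.code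
  | .const c, h => by simp [IntTerm.HasInt, IntTerm.HasSet] at h
  | .var S, h => by
      rcases h with rfl | h
      · simp only [IntTerm.code]; omega
      · exact h.elim
  | .min s, h => by
      have := SetTerm.le_code s h
      simp only [IntTerm.code]; omega
  | .max s, h => by
      have := SetTerm.le_code s h
      simp only [IntTerm.code]; omega
end

theorem PresTerm.le_code {x : ℕ} : ∀ p : PresTerm, p.HasInt x ∨ p.HasSet x → x ≤ p.code
  | .base t, h => by
      have := t.le_code h
      simp only [PresTerm.code]; omega
  | .add s t, h => by
      have := le_pair_of_hasVar s.le_code t.le_code h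
      simp only [PresTerm.code]; omega
  | .sub s t, h => by
      have := le_pair_of_hasVar s.le_code t.le_code h
      simp only [PresTerm.code]; omega

/-- Truth of a formula depends only on the variables whose names are at most its code. -/
theorem Formula.holds_congr {N : ℕ} : ∀ (φ : Formula) {v v' : ℕ → ℤ} {V V' : ℕ → Finset ℤ},
    φ.code ≤ N → (∀ x ≤ N, v x = v' x) → (∀ S ≤ N, V S = V' S) → (φ.Holds v V ↔ φ.Holds v' V')
  | .setAtom r s t, v, v', V, V', hN, h, h' => by
      have h3 := Nat.left_le_pair s.code t.code
      have h4 := Nat.right_le_pair s.code t.code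
      simp only [Formula.code] at hN
      rw [Formula.Holds, Formula.Holds,
        s.eval_congr (fun x hx => h x ((s.le_code (.inl hx)).trans (by omega)))
          (fun x hx => h' x ((s.le_code (.inr hx)).trans (by omega))),
        t.eval_congr (fun x hx => h x ((t.le_code (.inl hx)).trans (by omega)))
          (fun x hx => h' x ((t.le_code (.inr hx)).trans (by omega)))]
  | .diffAtom r s t c, v, v', V, V', hN, h, h' => by
      have h3 := Nat.left_le_pair s.code (Nat.pair t.code (Equiv.intEquivNat c))
      have h4 := Nat.right_le_pair s.code (Nat.pair t.code (Equiv.intEquivNat c))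
      have h5 := Nat.left_le_pair t.code (Equiv.intEquivNat c)
      simp only [Formula.code] at hN
      rw [Formula.Holds, Formula.Holds,
        s.eval_congr (fun x hx => h x ((s.le_code (.inl hx)).trans (by omega)))
          (fun x hx => h' x ((s.le_code (.inr hx)).trans (by omega))),
        t.eval_congr (fun x hx => h x ((t.le_code (.inl hx)).trans (by omega)))
          (fun x hx => h' x ((t.le_code (.inr hx)).trans (by omega)))]
  | .presAtom r p, v, v', V, V', hN, h, h' => by
      simp only [Formula.code] at hN
      rw [Formula.Holds, Formula.Holds,
        p.eval_congr (fun x hx => h x ((p.le_code (.inl hx)).trans (by omega)))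
          (fun x hx => h' x ((p.le_code (.inr hx)).trans (by omega)))]
  | .and φ ψ, v, v', V, V', hN, h, h' => by
      have h3 := Nat.left_le_pair φ.code ψ.code
      have h4 := Nat.right_le_pair φ.code ψ.code
      simp only [Formula.code] at hN
      exact and_congr (φ.holds_congr (by omega) h h') (ψ.holds_congr (by omega) h h')
  | .neg φ, v, v', V, V', hN, h, h' => by
      simp only [Formula.code] at hN
      exact not_congr (φ.holds_congr (by omega) h h')
  | .allInt x φ, v, v', V, V', hN, h, h' => by
      have h4 := Nat.right_le_pair x φ.code
      simp only [Formula.code] at hN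
      refine forall_congr' fun n => φ.holds_congr (by omega) (fun y hy => ?_) h'
      simp only [Function.update_apply, h y hy]
  | .allSet S φ, v, v', V, V', hN, h, h' => by
      have h4 := Nat.right_le_pair S φ.code
      simp only [Formula.code] at hN
      refine forall_congr' fun n => φ.holds_congr (by omega) h (fun y hy => ?_)
      simp only [Function.update_apply, h' y hy]

/-- Every Presburger atom of the formula satisfies `P`. -/
def Formula.AllPres (P : IntRel → PresTerm → Prop) : Formula → Prop
  | .setAtom _ _ _ => True
  | .diffAtom _ _ _ _ => True
  | .presAtom r p => P r p
  | .and φ ψ => φ.AllPres P ∧ ψ.AllPres P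
  | .neg φ => φ.AllPres P
  | .allInt _ φ => φ.AllPres P
  | .allSet _ φ => φ.AllPres P

theorem Formula.AllPres.imp {P P' : IntRel → PresTerm → Prop} (h : ∀ r p, P r p → P' r p) :
    ∀ φ : Formula, φ.AllPres P → φ.AllPres P'
  | .setAtom _ _ _, _ => trivial
  | .diffAtom _ _ _ _, _ => trivial
  | .presAtom r p, hφ => h r p hφ
  | .and φ ψ, hφ => ⟨AllPres.imp h φ hφ.1, AllPres.imp h ψ hφ.2⟩
  | .neg φ, hφ => AllPres.imp h φ hφ
  | .allInt _ φ, hφ => AllPres.imp h φ hφ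
  | .allSet _ φ, hφ => AllPres.imp h φ hφ

theorem Formula.AllPres.and {P P' : IntRel → PresTerm → Prop} :
    ∀ φ : Formula, φ.AllPres P → φ.AllPres P' → φ.AllPres (fun r p => P r p ∧ P' r p)
  | .setAtom _ _ _, _, _ => trivial
  | .diffAtom _ _ _ _, _, _ => trivial
  | .presAtom _ _, h, h' => ⟨h, h'⟩
  | .and φ ψ, h, h' => ⟨AllPres.and φ h.1 h'.1, AllPres.and ψ h.2 h'.2⟩
  | .neg φ, h, h' => AllPres.and φ h h'
  | .allInt _ φ, h, h' => AllPres.and φ h h'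
  | .allSet _ φ, h, h' => AllPres.and φ h h'

theorem Formula.allPres_code_le {N : ℕ} : ∀ φ : Formula, φ.code ≤ N →
    φ.AllPres (fun _ p => p.code ≤ N)
  | .setAtom _ _ _, _ => trivial
  | .diffAtom _ _ _ _, _ => trivial
  | .presAtom r p, h => by simp only [Formula.code, Formula.AllPres] at h ⊢; omega
  | .and φ ψ, h => by
      have h3 := Nat.left_le_pair φ.code ψ.code
      have h4 := Nat.right_le_pair φ.code ψ.code
      simp only [Formula.code] at h
      exact ⟨φ.allPres_code_le (by omega), ψ.allPres_code_le (by omega)⟩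
  | .neg φ, h => by
      simp only [Formula.code] at h
      exact φ.allPres_code_le (by omega)
  | .allInt x φ, h => by
      have h4 := Nat.right_le_pair x φ.code
      simp only [Formula.code] at h
      exact φ.allPres_code_le (by omega)
  | .allSet x φ, h => by
      have h4 := Nat.right_le_pair x φ.code
      simp only [Formula.code] at h
      exact φ.allPres_code_le (by omega)

theorem Formula.allPres_not_hasInt {x : ℕ} : ∀ φ : Formula, φ.IsRQSPA → φ.PresAvoidsInt x →
    φ.AllPres (fun _ p => ¬ p.HasInt x)
  | .setAtom _ _ _, _, _ => trivial
  | .diffAtom _ _ _ _, _, _ => trivial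
  | .presAtom _ _, _, h => h
  | .and φ ψ, h, h' => ⟨φ.allPres_not_hasInt h.1 h'.1, ψ.allPres_not_hasInt h.2 h'.2⟩
  | .neg φ, h, h' => φ.allPres_not_hasInt h h'
  | .allInt y φ, h, h' => by
      rcases h' with rfl | h'
      · exact φ.allPres_not_hasInt h.2 h.1
      · exact φ.allPres_not_hasInt h.2 h'
  | .allSet _ φ, h, h' => φ.allPres_not_hasInt h.2 h'

theorem Formula.allPres_not_hasSet {S : ℕ} : ∀ φ : Formula, φ.IsRQSPA → φ.PresAvoidsSet S →
    φ.AllPres (fun _ p => ¬ p.HasSet S)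
  | .setAtom _ _ _, _, _ => trivial
  | .diffAtom _ _ _ _, _, _ => trivial
  | .presAtom _ _, _, h => h
  | .and φ ψ, h, h' => ⟨φ.allPres_not_hasSet h.1 h'.1, ψ.allPres_not_hasSet h.2 h'.2⟩
  | .neg φ, h, h' => φ.allPres_not_hasSet h h'
  | .allSet y φ, h, h' => by
      rcases h' with rfl | h'
      · exact φ.allPres_not_hasSet h.2 h.1
      · exact φ.allPres_not_hasSet h.2 h'
  | .allInt _ φ, h, h' => φ.allPres_not_hasSet h.2 h'

/-- The quantifiers of an RQSPA formula do not affect its atoms `T_m ⋈ 0`, which therefore keep the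
truth values that they have under the outer assignment. -/
theorem Formula.holds_iff_holdsGiven {τ : IntRel → PresTerm → Prop} :
    ∀ (φ : Formula) {v : ℕ → ℤ} {V : ℕ → Finset ℤ}, φ.IsRQSPA →
    φ.AllPres (fun r p => ((Formula.presAtom r p).Holds v V ↔ τ r p)) →
    (φ.Holds v V ↔ φ.HoldsGiven τ v V)
  | .setAtom _ _ _, _, _, _, _ => Iff.rfl
  | .diffAtom _ _ _ _, _, _, _, _ => Iff.rfl
  | .presAtom _ _, _, _, _, h => h
  | .and φ ψ, _, _, h, h' =>
      and_congr (φ.holds_iff_holdsGiven h.1 h'.1) (ψ.holds_iff_holdsGiven h.2 h'.2)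
  | .neg φ, _, _, h, h' => not_congr (φ.holds_iff_holdsGiven h h')
  | .allInt x φ, v, V, h, h' => by
      refine forall_congr' fun n => φ.holds_iff_holdsGiven h.2 ?_
      refine AllPres.imp (fun r p hp => ?_) φ (AllPres.and φ h' (φ.allPres_not_hasInt h.2 h.1))
      rw [← hp.1, Formula.Holds, Formula.Holds, p.eval_congr (fun y hy => ?_) fun _ _ => rfl]
      exact Function.update_of_ne (by rintro rfl; exact hp.2 hy) _ _
  | .allSet x φ, v, V, h, h' => by
      refine forall_congr' fun n => φ.holds_iff_holdsGiven h.2 ?_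
      refine AllPres.imp (fun r p hp => ?_) φ (AllPres.and φ h' (φ.allPres_not_hasSet h.2 h.1))
      rw [← hp.1, Formula.Holds, Formula.Holds, p.eval_congr (fun _ _ => rfl) fun y hy => ?_]
      exact Function.update_of_ne (by rintro rfl; exact hp.2 hy) _ _

/-! ### Bounded quantification -/

/-- The configuration of an assignment; its auxiliary tracks are empty. -/
def configOf (v : ℕ → ℤ) (V : ℕ → Finset ℤ) : Config
  | .org => {0}
  | .int x => {v x}
  | .set S => V S
  | .mark _ => ∅
  | .scr _ => ∅

theorem intVal_configOf (v : ℕ → ℤ) (V : ℕ → Finset ℤ) : intVal (configOf v V) = v := by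
  ext x; simp [intVal, configOf, minVal_singleton]

theorem setVal_configOf (v : ℕ → ℤ) (V : ℕ → Finset ℤ) : setVal (configOf v V) = V := rfl

/-- All values of the assignment have absolute value at most `W`. -/
structure Bounded (v : ℕ → ℤ) (V : ℕ → Finset ℤ) (W : ℕ) : Prop where
  int : ∀ x, |v x| ≤ W
  set : ∀ S, ∀ p ∈ V S, |p| ≤ W

theorem Bounded.mono {v : ℕ → ℤ} {V : ℕ → Finset ℤ} {W W' : ℕ} (h : Bounded v V W)
    (hW : W ≤ W') : Bounded v V W' :=
  ⟨fun x => (h.int x).trans (by exact_mod_cast hW),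
    fun S p hp => (h.set S p hp).trans (by exact_mod_cast hW)⟩

theorem Bounded.inWindow {v : ℕ → ℤ} {V : ℕ → Finset ℤ} {W : ℕ} (h : Bounded v V W) :
    InWindow (configOf v V) (-W) (2 * W + 1) := by
  intro i p hp
  rw [Finset.mem_Ico]
  have : |p| ≤ W := by
    cases i <;> simp only [configOf, Finset.mem_singleton, Finset.notMem_empty] at hp
    · simp [hp]
    · exact hp ▸ h.int _
    · exact h.set _ _ hp
  rw [abs_le] at this
  push_cast; omega

theorem Bounded.update_int {v : ℕ → ℤ} {V : ℕ → Finset ℤ} {W W' : ℕ} (h : Bounded v V W)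
    (hW : W ≤ W') (x : ℕ) {n : ℤ} (hn : |n| ≤ W') : Bounded (Function.update v x n) V W' := by
  refine ⟨fun y => ?_, fun S p hp => (h.set S p hp).trans (by exact_mod_cast hW)⟩
  rw [Function.update_apply]
  split_ifs
  · exact hn
  · exact (h.int y).trans (by exact_mod_cast hW)

theorem Bounded.update_set {v : ℕ → ℤ} {V : ℕ → Finset ℤ} {W W' : ℕ} (h : Bounded v V W)
    (hW : W ≤ W') (x : ℕ) {A : Finset ℤ} (hn : ∀ p ∈ A, |p| ≤ W') :
    Bounded v (Function.update V x A) W' := by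
  refine ⟨fun y => (h.int y).trans (by exact_mod_cast hW), fun S => ?_⟩
  rw [Function.update_apply]
  split_ifs
  · exact hn
  · exact fun p hp => (h.set S p hp).trans (by exact_mod_cast hW)

theorem abs_minVal_getD_le {A : Finset ℤ} {W : ℕ} (h : ∀ p ∈ A, |p| ≤ W) :
    |(minVal A).getD 0| ≤ W := by
  cases hA : minVal A with
  | none => simp
  | some n => exact h n (minVal_eq_some.1 hA).1

/-- A counterexample to a universally quantified formula can be found close to the values of the
other variables, at a distance of at most the number of states of an automaton for the formula. -/
theorem Formula.allInt_holds_iff_bounded {x : ℕ} {φ : Formula} (h : (Formula.allInt x φ).IsRQSPA)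
    {v : ℕ → ℤ} {V : ℕ → Finset ℤ} {W W' : ℕ} (hb : Bounded v V W)
    (hW : W + tower (2 * φ.code + 20) ≤ W') :
    (Formula.allInt x φ).Holds v V ↔
      ∀ n : ℤ, |n| ≤ W' → φ.Holds (Function.update v x n) V := by
  refine ⟨fun H n _ => H n, fun H => ?_⟩
  let τ : IntRel → PresTerm → Prop := fun r p => (Formula.presAtom r p).Holds v V
  have hτ : ∀ n, φ.Holds (Function.update v x n) V ↔
      φ.HoldsGiven τ (Function.update v x n) V := fun n => by
    refine φ.holds_iff_holdsGiven h.2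
      (AllPres.imp (fun r p hp => ?_) φ (φ.allPres_not_hasInt h.2 h.1))
    change _ ↔ (Formula.presAtom r p).Holds v V
    rw [Formula.Holds, Formula.Holds, p.eval_congr (fun y hy => ?_) fun _ _ => rfl]
    exact Function.update_of_ne (by rintro rfl; exact hp hy) _ _
  by_contra hc
  obtain ⟨n, hn⟩ := not_forall.1 hc
  obtain ⟨A, hA, hA'⟩ := (φ.recog τ).not.exists_small_witness (i := .int x) (by simp)
    (X := configOf v V) rfl hb.inWindow ⟨{n}, by
      rw [intVal_update_int, setVal_update_int, intVal_configOf, setVal_configOf,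
        minVal_singleton]
      exact fun hn' => hn ((hτ n).2 hn')⟩
  rw [intVal_update_int, setVal_update_int, intVal_configOf, setVal_configOf, ← hτ] at hA'
  refine hA' (H _ (abs_minVal_getD_le fun p hp => abs_le.2 ?_))
  have := Finset.mem_Ico.1 (hA hp)
  push_cast at this
  zify at hW
  constructor <;> linarith

/-- The analogue of `Formula.allInt_holds_iff_bounded` for set quantifiers. -/
theorem Formula.allSet_holds_iff_bounded {S : ℕ} {φ : Formula} (h : (Formula.allSet S φ).IsRQSPA)
    {v : ℕ → ℤ} {V : ℕ → Finset ℤ} {W W' : ℕ} (hb : Bounded v V W)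
    (hW : W + tower (2 * φ.code + 20) ≤ W') :
    (Formula.allSet S φ).Holds v V ↔
      ∀ A : Finset ℤ, (∀ p ∈ A, |p| ≤ W') → φ.Holds v (Function.update V S A) := by
  refine ⟨fun H n _ => H n, fun H => ?_⟩
  let τ : IntRel → PresTerm → Prop := fun r p => (Formula.presAtom r p).Holds v V
  have hτ : ∀ A, φ.Holds v (Function.update V S A) ↔
      φ.HoldsGiven τ v (Function.update V S A) := fun n => by
    refine φ.holds_iff_holdsGiven h.2
      (AllPres.imp (fun r p hp => ?_) φ (φ.allPres_not_hasSet h.2 h.1))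
    change _ ↔ (Formula.presAtom r p).Holds v V
    rw [Formula.Holds, Formula.Holds, p.eval_congr (fun _ _ => rfl) fun y hy => ?_]
    exact Function.update_of_ne (by rintro rfl; exact hp hy) _ _
  by_contra hc
  obtain ⟨n, hn⟩ := not_forall.1 hc
  obtain ⟨A, hA, hA'⟩ := (φ.recog τ).not.exists_small_witness (i := .set S) (by simp)
    (X := configOf v V) rfl hb.inWindow ⟨n, by
      rw [intVal_update_set, setVal_update_set, intVal_configOf, setVal_configOf]
      exact fun hn' => hn ((hτ n).2 hn')⟩
  rw [intVal_update_set, setVal_update_set, intVal_configOf, setVal_configOf, ← hτ] at hA'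
  refine hA' (H _ fun p hp => abs_le.2 ?_)
  have := Finset.mem_Ico.1 (hA hp)
  push_cast at this
  zify at hW
  constructor <;> linarith

/-! ### Pumping -/

/-- On at most `c` points, an iteration is periodic from step `c` on, and `c !` is a multiple of its
period. -/
theorem iterate_add_mul_factorial {S : Type} [Fintype S] (f : S → S) (x : S) {c n : ℕ}
    (hc : Fintype.card S ≤ c) (hn : c ≤ n) (k : ℕ) : f^[n + k * c.factorial] x = f^[n] x := by
  obtain ⟨i, j, hij, e⟩ : ∃ i j : Fin (c + 1), i < j ∧ f^[i] x = f^[j] x := by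
    obtain ⟨i, j, hne, e⟩ := Fintype.exists_ne_map_eq_of_card_lt
      (fun i : Fin (c + 1) => f^[i] x) (by simpa using Nat.lt_succ_of_le hc)
    rcases lt_or_gt_of_ne hne with h | h
    exacts [⟨i, j, h, e⟩, ⟨j, i, h, e.symm⟩]
  have hij' : (i : ℕ) < j := hij
  have hi : (i : ℕ) ≤ c := by omega
  have key : ∀ n ≥ (i : ℕ), f^[n + (j - i)] x = f^[n] x := fun n hn => by
    rw [show n + ((j : ℕ) - i) = (n - i) + j by omega, Function.iterate_add_apply, ← e,
      ← Function.iterate_add_apply, Nat.sub_add_cancel hn]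
  have key' : ∀ n ≥ (i : ℕ), ∀ t, f^[n + t * (j - i)] x = f^[n] x := fun n hn t => by
    induction t with
    | zero => simp
    | succ t ih => rw [Nat.succ_mul, ← add_assoc, key _ (by omega), ih]
  obtain ⟨t, ht⟩ : (j - i : ℕ) ∣ c.factorial := Nat.dvd_factorial (by omega) (by omega)
  rw [ht, mul_comm (j - i : ℕ) t, ← mul_assoc]
  exact key' n (by omega) _

/-- A long word over the letters in `U` can be shortened by a prescribed multiple of `(2 ^ K)!`
without changing its effect on the state `q`. The point is that the length is prescribed: the sets
of states that are reached from `q` by words of length `n` over `U` form an iteration on at most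
`2 ^ K` sets. -/
theorem exists_shorter_word {α Q : Type} [Fintype Q] (M : DFA α Q) (U : Set α) {K n c : ℕ}
    (hK : Fintype.card Q ≤ K) (hn : 2 ^ K ≤ n) (q : Q) (u : List α) (hu : ∀ l ∈ u, l ∈ U)
    (hl : u.length = n + c * (2 ^ K).factorial) :
    ∃ u' : List α, (∀ l ∈ u', l ∈ U) ∧ u'.length = n ∧ M.evalFrom q u' = M.evalFrom q u := by
  classical
  let F : Set Q → Set Q := fun S => {q' | ∃ q ∈ S, ∃ l ∈ U, q' = M.step q l}
  have hF : ∀ (n : ℕ) (q' : Q), q' ∈ F^[n] {q} ↔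
      ∃ u : List α, (∀ l ∈ u, l ∈ U) ∧ u.length = n ∧ M.evalFrom q u = q' := by
    intro n
    induction n with
    | zero =>
      intro q'
      simp only [Function.iterate_zero, id_eq, Set.mem_singleton_iff]
      constructor
      · rintro rfl
        exact ⟨[], by simp⟩
      · rintro ⟨u, -, h, rfl⟩
        rw [List.length_eq_zero_iff.1 h]
        rfl
    | succ n ih =>
      intro q'
      rw [Function.iterate_succ_apply']
      constructor
      · rintro ⟨q₁, hq, l, hlU, rfl⟩
        obtain ⟨u, hu, hl, rfl⟩ := (ih q₁).1 hq
        refine ⟨u ++ [l], fun l' hl' => ?_, by simp [hl], by simp⟩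
        rcases List.mem_append.1 hl' with h | h
        · exact hu _ h
        · rwa [List.mem_singleton.1 h]
      · rintro ⟨u, hu, hl, rfl⟩
        obtain ⟨u₀, l, rfl⟩ : ∃ u₀ l, u = u₀ ++ [l] := by
          rcases List.eq_nil_or_concat u with rfl | ⟨u₀, l, rfl⟩
          · simp at hl
          · exact ⟨u₀, l, by simp⟩
        refine ⟨M.evalFrom q u₀, (ih _).2 ⟨u₀, fun l' hl' => hu _ (by simp [hl']),
          by simpa using hl, rfl⟩, l, hu _ (by simp), by simp⟩
  have h1 := (hF _ _).2 ⟨u, hu, hl, rfl⟩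
  rw [iterate_add_mul_factorial F {q} (by
    rw [Fintype.card_set]; exact Nat.pow_le_pow_right (by norm_num) hK) hn c] at h1
  exact (hF _ _).1 h1

/-- The word `us 0, ls 0, us 1, ls 1, …, ls (m - 1), us m`. -/
def assemble {α : Type} (us : ℕ → List α) (ls : ℕ → α) : ℕ → List α
  | 0 => us 0
  | m + 1 => assemble us ls m ++ ls m :: us (m + 1)

theorem assemble_congr {α : Type} {us us' : ℕ → List α} {ls ls' : ℕ → α} {m : ℕ}
    (h : ∀ j ≤ m, us j = us' j) (h' : ∀ j < m, ls j = ls' j) :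
    assemble us ls m = assemble us' ls' m := by
  induction m with
  | zero => exact h 0 le_rfl
  | succ m ih =>
    rw [assemble, assemble, ih (fun j hj => h j (by omega)) (fun j hj => h' j (by omega)),
      h _ le_rfl, h' _ (Nat.lt_succ_self m)]

/-- A word is cut by its letters outside `U` into blocks of letters in `U`. -/
theorem exists_assemble {α : Type} [Inhabited α] (U : Set α) (w : List α) :
    ∃ us ls m, w = assemble us ls m ∧ (∀ j, ∀ l ∈ us j, l ∈ U) ∧ ∀ j < m, ls j ∉ U := by
  induction w using List.reverseRecOn with
  | nil => exact ⟨fun _ => [], default, 0, rfl, by simp, by simp⟩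
  | append_singleton w a ih =>
    obtain ⟨us, ls, m, rfl, hU, hM⟩ := ih
    by_cases ha : a ∈ U
    · refine ⟨Function.update us m (us m ++ [a]), ls, m, ?_, fun j l hl => ?_, hM⟩
      · cases m with
        | zero => simp [assemble]
        | succ m =>
          rw [assemble, assemble, Function.update_self, List.append_assoc]
          congr 1
          exact assemble_congr (fun j hj => (Function.update_of_ne (by omega) _ _).symm)
            fun _ _ => rfl
      · rw [Function.update_apply] at hl
        split_ifs at hl
        · rcases List.mem_append.1 hl with h | h
          · exact hU _ _ h
          · rwa [List.mem_singleton.1 h]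
        · exact hU _ _ hl
    · refine ⟨Function.update us (m + 1) [], Function.update ls m a, m + 1, ?_, fun j l hl => ?_,
        fun j hj => ?_⟩
      · rw [assemble, Function.update_self, Function.update_self]
        congr 1
        exact assemble_congr (fun j hj => (Function.update_of_ne (by omega) _ _).symm)
          fun j hj => (Function.update_of_ne (by omega) _ _).symm
      · rw [Function.update_apply] at hl
        split_ifs at hl
        · simp at hl
        · exact hU _ _ hl
      · rw [Function.update_apply]
        split_ifs
        · exact ha
        · exact hM _ (by omega)

/-- The position of the letter `ls i` in `assemble us ls m` when the blocks `us j` have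
lengths `g j`. -/
def position (g : ℕ → ℕ) (i : ℕ) : ℕ := ∑ j ∈ Finset.range (i + 1), g j + i

theorem length_assemble {α : Type} {us : ℕ → List α} {ls : ℕ → α} {g : ℕ → ℕ} {m : ℕ}
    (h : ∀ j ≤ m, (us j).length = g j) : (assemble us ls m).length = position g m := by
  induction m with
  | zero => simp [assemble, position, h]
  | succ m ih =>
    rw [assemble, List.length_append, ih fun j hj => h j (by omega), List.length_cons,
      h _ le_rfl, position, position, Finset.sum_range_succ _ (m + 1)]
    omega

theorem position_strictMono (g : ℕ → ℕ) : StrictMono (position g) :=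
  strictMono_nat_of_lt_succ fun i => by
    rw [position, position, Finset.sum_range_succ _ (i + 1)]; omega

/-- A property that fails on all letters of the blocks holds in the word exactly at the positions of
those separating letters that have it. -/
theorem assemble_getElem? {α : Type} {us : ℕ → List α} {ls : ℕ → α} {g : ℕ → ℕ} {m : ℕ}
    (h : ∀ j ≤ m, (us j).length = g j) {P : α → Prop} (hP : ∀ j, ∀ l ∈ us j, ¬ P l) (k : ℕ) :
    (∃ l, (assemble us ls m)[k]? = some l ∧ P l) ↔ ∃ j < m, k = position g j ∧ P (ls j) := by
  induction m with
  | zero =>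
    simp only [assemble, not_lt_zero, false_and, exists_false, iff_false]
    rintro ⟨l, hl, hl'⟩
    exact hP 0 l (List.mem_of_getElem? hl) hl'
  | succ m ih =>
    have hlen := length_assemble (ls := ls) fun j (hj : j ≤ m) => h j (by omega)
    have ih := ih fun j hj => h j (by omega)
    rw [assemble]
    rcases lt_trichotomy k (position g m) with hk | rfl | hk
    · rw [List.getElem?_append_left (by omega), ih]
      constructor
      · rintro ⟨j, hj, h1⟩
        exact ⟨j, by omega, h1⟩
      · rintro ⟨j, hj, rfl, h1⟩
        exact ⟨j, (position_strictMono g).lt_iff_lt.1 hk, rfl, h1⟩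
    · rw [List.getElem?_append_right (by omega), hlen, Nat.sub_self]
      simp only [List.getElem?_cons_zero, Option.some.injEq, exists_eq_left']
      constructor
      · exact fun h => ⟨m, by omega, rfl, h⟩
      · rintro ⟨j, hj, e, h1⟩
        rwa [(position_strictMono g).injective e]
    · rw [List.getElem?_append_right (by omega), hlen,
        show k - position g m = (k - position g m - 1) + 1 by omega, List.getElem?_cons_succ]
      refine iff_of_false ?_ ?_
      · rintro ⟨l, hl, hl'⟩
        exact hP _ l (List.mem_of_getElem? hl) hl'
      · rintro ⟨j, hj, rfl, -⟩
        have := (position_strictMono g).lt_iff_lt.1 hk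
        omega

/-- Blocks can be shortened by multiples of `(2 ^ K)!`, as long as the shortened ones keep length at
least `2 ^ K`, without changing the state that the whole word leads to. -/
theorem exists_resized_assemble {α Q : Type} [Fintype Q] (M : DFA α Q) (U : Set α) {K m : ℕ}
    (hK : Fintype.card Q ≤ K) {us : ℕ → List α} (ls : ℕ → α) (hU : ∀ j, ∀ l ∈ us j, l ∈ U)
    {g' : ℕ → ℕ} (hg : ∀ j ≤ m, ∃ c, (us j).length = g' j + c * (2 ^ K).factorial ∧
      (c = 0 ∨ 2 ^ K ≤ g' j)) :
    ∃ us' : ℕ → List α, (∀ j, ∀ l ∈ us' j, l ∈ U) ∧ (∀ j ≤ m, (us' j).length = g' j) ∧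
      M.eval (assemble us' ls m) = M.eval (assemble us ls m) := by
  let q : ℕ → Q := fun j => j.casesOn M.start fun j => M.step (M.eval (assemble us ls j)) (ls j)
  have : ∀ j, ∃ u : List α, (∀ l ∈ u, l ∈ U) ∧ (j ≤ m → u.length = g' j) ∧
      M.evalFrom (q j) u = M.evalFrom (q j) (us j) := by
    intro j
    by_cases hj : j ≤ m
    · obtain ⟨c, hc, rfl | hc'⟩ := hg j hj
      · exact ⟨us j, hU j, fun _ => by simpa using hc, rfl⟩
      · obtain ⟨u, h1, h2, h3⟩ := exists_shorter_word M U hK hc' (q j) (us j) (hU j) hc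
        exact ⟨u, h1, fun _ => h2, h3⟩
    · exact ⟨us j, hU j, fun h => absurd h hj, rfl⟩
  choose us' h1 h2 h3 using this
  refine ⟨us', h1, h2, ?_⟩
  have key : ∀ j, M.eval (assemble us' ls j) = M.eval (assemble us ls j) := by
    intro j
    induction j with
    | zero => exact h3 0
    | succ j ih =>
      rw [assemble, assemble, DFA.eval, DFA.evalFrom_of_append, DFA.evalFrom_of_append]
      have e := h3 (j + 1)
      change M.evalFrom (M.eval (assemble us' ls j)) _ = M.evalFrom (M.eval (assemble us ls j)) _
      rw [ih]
      exact e
  exact key m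

/-! ### Zero-sum subfamilies -/

/-- Numbers of absolute value at most `C` with total at most `C` can be ordered such that all
partial sums are at most `C` in absolute value: the next number is chosen with the sign opposite to that of
the sum so far; when no such number is left, the sums move monotonically to the total. -/
theorem exists_list_partial_sums_bounded {ι : Type} [DecidableEq ι] (f : ι → ℤ) (C : ℤ) :
    ∀ (U : Finset ι) (s : ℤ), |s| ≤ C → (∀ x ∈ U, |f x| ≤ C) → |s + ∑ x ∈ U, f x| ≤ C →
      ∃ l : List ι, l.Nodup ∧ l.toFinset = U ∧ ∀ k, |s + ((l.take k).map f).sum| ≤ C := by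
  intro U
  induction hn : U.card generalizing U with
  | zero =>
    intro s hs _ _
    rw [Finset.card_eq_zero] at hn
    exact ⟨[], by simp, by simp [hn], by simpa using hs⟩
  | succ n ih =>
    intro s hs hU hsum
    obtain ⟨x, hx, hsx⟩ : ∃ x ∈ U, |s + f x| ≤ C := by
      have hne : U.Nonempty := by rw [← Finset.card_pos]; omega
      rw [abs_le] at hs hsum
      by_cases h0 : s ≤ 0
      · by_cases h : ∃ x ∈ U, 0 ≤ f x
        · obtain ⟨x, hx, h⟩ := h
          have := abs_le.1 (hU x hx)
          exact ⟨x, hx, abs_le.2 ⟨by linarith, by linarith⟩⟩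
        · push Not at h
          obtain ⟨x, hx⟩ := hne
          have h1 : ∑ y ∈ U.erase x, f y ≤ 0 :=
            Finset.sum_nonpos fun y hy => (h y (Finset.mem_of_mem_erase hy)).le
          rw [← Finset.add_sum_erase U f hx] at hsum
          have := h x hx
          exact ⟨x, hx, abs_le.2 ⟨by linarith, by linarith⟩⟩
      · by_cases h : ∃ x ∈ U, f x ≤ 0
        · obtain ⟨x, hx, h⟩ := h
          have := abs_le.1 (hU x hx)
          exact ⟨x, hx, abs_le.2 ⟨by linarith, by linarith⟩⟩
        · push Not at h
          obtain ⟨x, hx⟩ := hne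
          have h1 : 0 ≤ ∑ y ∈ U.erase x, f y :=
            Finset.sum_nonneg fun y hy => (h y (Finset.mem_of_mem_erase hy)).le
          rw [← Finset.add_sum_erase U f hx] at hsum
          have := h x hx
          exact ⟨x, hx, abs_le.2 ⟨by linarith, by linarith⟩⟩
    obtain ⟨l, hl, hlU, hl'⟩ := ih (U.erase x) (by rw [Finset.card_erase_of_mem hx, hn]; rfl)
      (s + f x) hsx (fun y hy => hU y (Finset.mem_of_mem_erase hy))
      (by rwa [add_assoc, Finset.add_sum_erase U f hx])
    refine ⟨x :: l, List.nodup_cons.2 ⟨fun h => ?_, hl⟩, ?_, fun k => ?_⟩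
    · have : x ∈ U.erase x := hlU ▸ List.mem_toFinset.2 h
      simp at this
    · rw [List.toFinset_cons, hlU, Finset.insert_erase hx]
    · cases k with
      | zero => simpa using hs
      | succ k => simpa [add_assoc] using hl' k

/-- Among the `2 * C + 2` first partial sums of the ordering in `exists_list_partial_sums_bounded`
two agree, and the numbers between them have sum zero. -/
theorem exists_zero_sum_subset {ι : Type} [DecidableEq ι] (f : ι → ℤ) (C : ℕ) (U : Finset ι)
    (hf : ∀ x ∈ U, |f x| ≤ C) (hsum : |∑ x ∈ U, f x| ≤ C) (hU : 2 * C + 1 ≤ U.card) :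
    ∃ T ⊆ U, T.Nonempty ∧ T.card ≤ 2 * C + 1 ∧ ∑ x ∈ T, f x = 0 := by
  obtain ⟨l, hl, rfl, hl'⟩ := exists_list_partial_sums_bounded f C U 0 (by simp) hf
    (by simpa using hsum)
  rw [List.toFinset_card_of_nodup hl] at hU
  obtain ⟨i, hi, j, hj, hne, e⟩ := Finset.exists_ne_map_eq_of_card_lt_of_maps_to
    (s := Finset.range (2 * C + 2)) (t := Finset.Icc (-(C : ℤ)) C)
    (f := fun k => ((l.take k).map f).sum) (by simp; omega) fun k _ => by
      have := hl' k
      rw [zero_add, abs_le] at this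
      simpa using this
  wlog hij : i < j generalizing i j
  · exact this j hj i hi hne.symm e.symm (by omega)
  rw [Finset.mem_range] at hi hj
  have hsub : ((l.take j).drop i).Sublist l := (List.drop_sublist _ _).trans (List.take_sublist _ _)
  have hlen : ((l.take j).drop i).length = j - i := by
    rw [List.length_drop, List.length_take]; omega
  refine ⟨((l.take j).drop i).toFinset, ?_, ?_, ?_, ?_⟩
  · intro x hx
    rw [List.mem_toFinset] at hx ⊢
    exact hsub.subset hx
  · rw [← Finset.card_pos, List.toFinset_card_of_nodup (hl.sublist hsub), hlen]
    omega
  · rw [List.toFinset_card_of_nodup (hl.sublist hsub), hlen]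
    omega
  · rw [List.sum_toFinset _ (hl.sublist hsub)]
    have h1 : l.take j = l.take i ++ (l.take j).drop i := by
      conv_lhs => rw [← List.take_append_drop i (l.take j), List.take_take, min_eq_left hij.le]
    rw [h1, List.map_append, List.sum_append] at e
    linarith

/-- All but `2 * C + 1` of the numbers fall into disjoint small families with sum zero. -/
theorem exists_zero_sum_packing {ι : Type} [DecidableEq ι] (f : ι → ℤ) (C : ℕ) (U : Finset ι)
    (hf : ∀ x ∈ U, |f x| ≤ C) (hsum : |∑ x ∈ U, f x| ≤ C) :
    ∃ F : Finset (Finset ι), (∀ B ∈ F, B ⊆ U ∧ B.Nonempty ∧ B.card ≤ 2 * C + 1 ∧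
      ∑ x ∈ B, f x = 0) ∧ (F : Set (Finset ι)).PairwiseDisjoint id ∧
      (U \ F.biUnion id).card ≤ 2 * C + 1 := by
  induction hn : U.card using Nat.strong_induction_on generalizing U with
  | _ n ih =>
    by_cases hU : 2 * C + 1 ≤ U.card
    · obtain ⟨T, hTU, hT, hTc, hT0⟩ := exists_zero_sum_subset f C U hf hsum hU
      obtain ⟨F, h1, h2, h3⟩ := ih (U \ T).card
        (by rw [← hn]; exact Finset.card_lt_card (Finset.sdiff_ssubset hTU hT)) (U \ T)
        (fun x hx => hf x (Finset.sdiff_subset hx))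
        (by rwa [← Finset.sum_sdiff hTU, hT0, add_zero] at hsum) rfl
      refine ⟨insert T F, ?_, ?_, ?_⟩
      · intro B hB
        rcases Finset.mem_insert.1 hB with rfl | hB
        · exact ⟨hTU, hT, hTc, hT0⟩
        · exact ⟨(h1 B hB).1.trans Finset.sdiff_subset, (h1 B hB).2⟩
      · rw [Finset.coe_insert]
        refine h2.insert fun B hB _ => ?_
        exact (Finset.disjoint_of_subset_left (h1 B hB).1 Finset.sdiff_disjoint).symm
      · rwa [Finset.biUnion_insert, id, ← Finset.sup_eq_union, ← sdiff_sdiff_left]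
    · exact ⟨∅, by simp, by simp, by simp; omega⟩

/-- The growth of the bound on the coordinates when families of at most `2 * C + 1` vectors are
added up, with room for the sum of the vectors that are left over. -/
def boxGrowth (C : ℕ) : ℕ := C * (2 * C + 2)

theorem le_iterate_boxGrowth (d C : ℕ) : C ≤ boxGrowth^[d] C := by
  induction d generalizing C with
  | zero => exact le_rfl
  | succ d ih =>
    rw [Function.iterate_succ_apply]
    exact le_trans (by unfold boxGrowth; nlinarith) (ih _)

/-- The zero-sum argument for vectors. The vectors are packed into families whose sums vanish in the
last coordinate, and the sums of these families are vectors with one coordinate less. -/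
theorem exists_zero_sum_subset_vec (d : ℕ) : ∀ (C H : ℕ), 2 * boxGrowth^[d] C + 1 ≤ H →
    ∀ {ι : Type} [DecidableEq ι] (f : ι → ℕ → ℤ) (U : Finset ι),
      (∀ x ∈ U, ∀ j < d, |f x j| ≤ C) → (∀ j < d, |∑ x ∈ U, f x j| ≤ C) →
      (2 * H) ^ d ≤ U.card → ∃ T ⊆ U, T.Nonempty ∧ ∀ j < d, ∑ x ∈ T, f x j = 0 := by
  induction d with
  | zero =>
    intro C H _ ι _ f U _ _ hU
    exact ⟨U, subset_rfl, by rw [← Finset.card_pos]; simpa using hU, by simp⟩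
  | succ d ih =>
    intro C H hH ι _ f U hf hsum hU
    have hCH : 2 * C + 1 ≤ H := by
      have := le_iterate_boxGrowth (d + 1) C
      omega
    obtain ⟨F, h1, h2, h3⟩ := exists_zero_sum_packing (fun x => f x d) C U
      (fun x hx => hf x hx d (Nat.lt_succ_self d)) (hsum d (Nat.lt_succ_self d))
    have hFU : F.biUnion id ⊆ U := Finset.biUnion_subset.2 fun B hB => (h1 B hB).1
    have hbd : ∀ B ⊆ U, B.card ≤ 2 * C + 1 → ∀ j < d, |∑ x ∈ B, f x j| ≤ (2 * C + 1) * C := by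
      intro B hB hBc j hj
      refine (Finset.abs_sum_le_sum_abs _ _).trans
        ((Finset.sum_le_card_nsmul B _ (C : ℤ) fun x hx => hf x (hB hx) j (by omega)).trans ?_)
      rw [nsmul_eq_mul]
      have : (B.card : ℤ) ≤ 2 * C + 1 := by exact_mod_cast hBc
      exact mul_le_mul_of_nonneg_right this (by positivity)
    have hcardU : U.card ≤ (2 * C + 1) + F.card * (2 * C + 1) := by
      rw [← Finset.card_sdiff_add_card_eq_card hFU]
      exact add_le_add h3 (Finset.card_biUnion_le_card_mul _ _ _ fun B hB => (h1 B hB).2.2.1)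
    obtain ⟨T, hT, hTne, hT0⟩ := ih (boxGrowth C) H (by rwa [Function.iterate_succ_apply] at hH)
      (fun B j => ∑ x ∈ B, f x j) F
      (fun B hB j hj => (hbd B (h1 B hB).1 (h1 B hB).2.2.1 j hj).trans (by
        unfold boxGrowth; push_cast; nlinarith))
      (fun j hj => by
        change |∑ B ∈ F, ∑ x ∈ id B, f x j| ≤ _
        rw [← Finset.sum_biUnion (f := fun x => f x j) h2]
        have e := Finset.sum_sdiff (f := fun x => f x j) hFU
        have e1 := abs_le.1 (hbd _ Finset.sdiff_subset h3 j hj)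
        have e2 := abs_le.1 (hsum j (by omega))
        unfold boxGrowth
        push_cast
        exact abs_le.2 ⟨by nlinarith, by nlinarith⟩)
      (by
        have hpos : 0 < (2 * H) ^ d := by apply Nat.pow_pos; omega
        have h4 : (2 * H) ^ d * (2 * H) ≤ H + F.card * H := by
          rw [← pow_succ]
          refine hU.trans (hcardU.trans ?_)
          gcongr
        have h5 : 2 * (2 * H) ^ d * H ≤ (1 + F.card) * H := by linarith
        have h6 := Nat.le_of_mul_le_mul_right h5 (by omega)
        omega)
    refine ⟨T.biUnion id, (Finset.biUnion_subset_biUnion_of_subset_left _ hT).trans hFU, ?_, ?_⟩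
    · obtain ⟨B, hB⟩ := hTne
      obtain ⟨x, hx⟩ := (h1 B (hT hB)).2.1
      exact ⟨x, Finset.mem_biUnion.2 ⟨B, hB, hx⟩⟩
    · intro j hj
      rw [Finset.sum_biUnion (h2.subset (by exact_mod_cast hT))]
      rcases Nat.lt_succ_iff_lt_or_eq.1 hj with hj | rfl
      · exact hT0 j hj
      · exact Finset.sum_eq_zero fun B hB => (h1 B (hT hB)).2.2.2

/-- The zero-sum argument for vectors `f t` with multiplicities `n t`. -/
theorem exists_zero_sum_counts {κ : Type} [DecidableEq κ] (d C H : ℕ)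
    (hH : 2 * boxGrowth^[d] C + 1 ≤ H) (S : Finset κ) (n : κ → ℕ) (f : κ → ℕ → ℤ)
    (hf : ∀ t ∈ S, ∀ j < d, |f t j| ≤ C) (hsum : ∀ j < d, |∑ t ∈ S, n t * f t j| ≤ C)
    (hn : (2 * H) ^ d ≤ ∑ t ∈ S, n t) :
    ∃ c : κ → ℕ, (∀ t ∈ S, c t ≤ n t) ∧ (∃ t ∈ S, c t ≠ 0) ∧
      ∀ j < d, ∑ t ∈ S, c t * f t j = 0 := by
  obtain ⟨T, hT, hne, hT0⟩ := exists_zero_sum_subset_vec d C H hH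
    (fun x : (_ : κ) × ℕ => f x.1) (S.sigma fun t => Finset.range (n t))
    (fun x hx j hj => hf x.1 (Finset.mem_sigma.1 hx).1 j hj)
    (fun j hj => by
      rw [Finset.sum_sigma]
      simpa using hsum j hj)
    (by simpa using hn)
  have hmaps : ∀ x ∈ T, x.1 ∈ S := fun x hx => (Finset.mem_sigma.1 (hT hx)).1
  refine ⟨fun t => (T.filter fun x => x.1 = t).card, fun t ht => ?_, ?_, fun j hj => ?_⟩
  · conv_rhs => rw [← Finset.card_range (n t)]
    refine Finset.card_le_card_of_injOn (fun x => x.2) (fun x hx => ?_) ?_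
    · obtain ⟨hxT, rfl⟩ := Finset.mem_filter.1 (Finset.mem_coe.1 hx)
      exact (Finset.mem_sigma.1 (hT hxT)).2
    · rintro ⟨a, b⟩ hx ⟨a', b'⟩ hy hxy
      obtain ⟨-, rfl⟩ := Finset.mem_filter.1 (Finset.mem_coe.1 hx)
      obtain ⟨-, e⟩ := Finset.mem_filter.1 (Finset.mem_coe.1 hy)
      dsimp only at e hxy
      subst e hxy
      rfl
  · obtain ⟨x, hx⟩ := hne
    exact ⟨x.1, hmaps x hx, Finset.card_ne_zero_of_mem (Finset.mem_filter.2 ⟨hx, rfl⟩)⟩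
  · rw [← hT0 j hj, ← Finset.sum_fiberwise_of_maps_to hmaps]
    refine Finset.sum_congr rfl fun t _ => ?_
    rw [Finset.sum_congr rfl (g := fun _ => f t j) fun x hx => by
      rw [(Finset.mem_filter.1 hx).2]]
    simp

/-! ### Shrinking the arguments of affine forms -/

/-- The affine forms with coefficients `e i j` and constants `γ j`, indexed by `j`, in the `M`
natural numbers `g i`. -/
def affineForm (M : ℕ) (e : ℕ → ℕ → ℤ) (γ : ℕ → ℤ) (g : ℕ → ℕ) (j : ℕ) : ℤ :=
  ∑ i ∈ Finset.range M, g i * e i j + γ j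

theorem sign_sub_sign_mul (v : ℤ) (c : ℕ) (hc : c ≤ v.natAbs - 1) :
    (v - v.sign * c).sign = v.sign := by
  rcases lt_trichotomy v 0 with h | rfl | h
  · rw [Int.sign_eq_neg_one_of_neg h]
    apply Int.sign_eq_neg_one_of_neg
    omega
  · simp
  · rw [Int.sign_eq_one_of_pos h]
    apply Int.sign_eq_one_of_pos
    omega

theorem sign_mul_natAbs_sub_one (v : ℤ) : v.sign * ((v.natAbs - 1 : ℕ) : ℤ) = v - v.sign := by
  rcases lt_trichotomy v 0 with h | rfl | h
  · rw [Int.sign_eq_neg_one_of_neg h]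
    omega
  · simp
  · rw [Int.sign_eq_one_of_pos h]
    omega

/-- The bound on the coordinates and on the sums of the vectors in `exists_shrink`. -/
def slackBound (M P N₀ C : ℕ) : ℕ := P * C + C + M * ((N₀ + P) * C) + 1

/-- If the total of the arguments exceeds this number, some of them can be decreased by multiples of
`P` and stay above `N₀`, without changing the signs of `J` affine forms with coefficients at
most `C`. -/
def gapBound (M J P N₀ C : ℕ) : ℕ :=
  M * (N₀ + P) + P * (2 * (2 * boxGrowth^[J] (slackBound M P N₀ C) + 1)) ^ J

/-- One step of the decrease. The argument `g i` contributes about `g i / P` copies of the vector of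
its coefficients multiplied by `P`. To keep the sign of the form `j`, whose value is `v j`, slack
vectors `-sign (v j)` in the coordinate `j` are added, with multiplicity `|v j| - 1`. The sum of all
these vectors is small, so some of them have sum zero; removing those from the arguments moves each
value by at most `|v j| - 1` towards zero. -/
theorem exists_shrink {M J P N₀ C : ℕ} (hP : 0 < P) {e : ℕ → ℕ → ℤ} {γ : ℕ → ℤ}
    (he : ∀ i < M, ∀ j < J, |e i j| ≤ C) (hγ : ∀ j < J, |γ j| ≤ C) (g : ℕ → ℕ)
    (hg : gapBound M J P N₀ C < ∑ i ∈ Finset.range M, g i) :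
    ∃ c : ℕ → ℕ, (∀ i < M, c i = 0 ∨ N₀ + c i * P ≤ g i) ∧ (∃ i < M, c i ≠ 0) ∧
      ∀ j < J, (affineForm M e γ (fun i => g i - c i * P) j).sign =
        (affineForm M e γ g j).sign := by
  let nb : ℕ → ℕ := fun i => (g i - N₀) / P
  have hnb : ∀ i, nb i * P ≤ g i - N₀ := fun i => Nat.div_mul_le_self _ _
  have hnb' : ∀ i, g i - nb i * P ≤ N₀ + P := fun i => by
    have := Nat.lt_div_mul_add hP (a := g i - N₀)
    have := hnb i
    change g i - (g i - N₀) / P * P ≤ _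
    omega
  have hnb'' : ∀ i, nb i * P ≤ g i := fun i => (hnb i).trans (Nat.sub_le _ _)
  let v : ℕ → ℤ := affineForm M e γ g
  let n : ℕ ⊕ ℕ → ℕ := Sum.elim nb fun j => (v j).natAbs - 1
  let f : ℕ ⊕ ℕ → ℕ → ℤ := fun t j => Sum.elim (fun i => P * e i j)
    (fun j' => if j' = j then -(v j).sign else 0) t
  have hsumf : ∀ (c : ℕ ⊕ ℕ → ℕ), ∀ j < J,
      ∑ t ∈ (Finset.range M).disjSum (Finset.range J), (c t : ℤ) * f t j =
        ∑ i ∈ Finset.range M, ((c (.inl i) * P : ℕ) : ℤ) * e i j - (v j).sign * c (.inr j) := by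
    intro c j hj
    rw [Finset.sum_disjSum]
    simp only [f, Sum.elim_inl, Sum.elim_inr, mul_ite, mul_zero, Finset.sum_ite_eq',
      Finset.mem_range, hj, if_true]
    rw [sub_eq_add_neg]
    congr 1
    · exact Finset.sum_congr rfl fun i _ => by push_cast; ring
    · ring
  have hPC' : P * C ≤ slackBound M P N₀ C := by unfold slackBound; omega
  have h1C' : 1 ≤ slackBound M P N₀ C := by unfold slackBound; omega
  have hsign : ∀ v : ℤ, |v.sign| ≤ 1 := fun v => by
    rcases Int.sign_trichotomy v with h | h | h <;> simp [h]
  obtain ⟨c, hcn, hc0, hcs⟩ := exists_zero_sum_counts J (slackBound M P N₀ C)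
    (2 * boxGrowth^[J] (slackBound M P N₀ C) + 1) le_rfl
    ((Finset.range M).disjSum (Finset.range J)) n f
    (by
      intro t ht j hj
      rcases t with i | j'
      · rw [Finset.inl_mem_disjSum, Finset.mem_range] at ht
        simp only [f, Sum.elim_inl, abs_mul, Nat.abs_cast]
        calc (P : ℤ) * |e i j| ≤ P * C := by gcongr; exact he i ht j hj
          _ ≤ _ := by exact_mod_cast hPC'
      · simp only [f, Sum.elim_inr]
        split_ifs
        · rw [abs_neg]
          exact (hsign _).trans (by exact_mod_cast h1C')
        · simp)
    (by
      intro j hj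
      rw [hsumf n j hj]
      simp only [n, Sum.elim_inl, Sum.elim_inr]
      rw [sign_mul_natAbs_sub_one]
      have e1 : ∑ i ∈ Finset.range M, ((nb i * P : ℕ) : ℤ) * e i j - (v j - (v j).sign) =
          (v j).sign - γ j - ∑ i ∈ Finset.range M, ((g i - nb i * P : ℕ) : ℤ) * e i j := by
        have : ∑ i ∈ Finset.range M, ((g i - nb i * P : ℕ) : ℤ) * e i j =
            ∑ i ∈ Finset.range M, (g i : ℤ) * e i j -
              ∑ i ∈ Finset.range M, ((nb i * P : ℕ) : ℤ) * e i j := by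
          rw [← Finset.sum_sub_distrib]
          exact Finset.sum_congr rfl fun i _ => by rw [Nat.cast_sub (hnb'' i)]; ring
        rw [this]
        simp only [v, affineForm]
        ring
      rw [e1]
      have e2 : |∑ i ∈ Finset.range M, ((g i - nb i * P : ℕ) : ℤ) * e i j| ≤
          M * ((N₀ + P) * C) := by
        refine (Finset.abs_sum_le_sum_abs _ _).trans ((Finset.sum_le_card_nsmul _ _
          (((N₀ + P) * C : ℕ) : ℤ) fun i hi => ?_).trans ?_)
        · rw [abs_mul, Nat.abs_cast]
          push_cast
          have := he i (Finset.mem_range.1 hi) j hj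
          have h2 : ((g i - nb i * P : ℕ) : ℤ) ≤ N₀ + P := by exact_mod_cast hnb' i
          exact mul_le_mul h2 this (abs_nonneg _) (by positivity)
        · simp
      have e3 := abs_le.1 (hsign (v j))
      have e4 := abs_le.1 (hγ j hj)
      have e5 := abs_le.1 e2
      have e6 : (0 : ℤ) ≤ P * C := by positivity
      unfold slackBound
      push_cast
      exact abs_le.2 ⟨by linarith, by linarith⟩)
    (by
      rw [Finset.sum_disjSum]
      refine le_trans ?_ (Nat.le_add_right _ _)
      simp only [n, Sum.elim_inl]
      have h1 : ∑ i ∈ Finset.range M, g i ≤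
          M * (N₀ + P) + P * ∑ i ∈ Finset.range M, nb i := by
        rw [Finset.mul_sum]
        calc ∑ i ∈ Finset.range M, g i ≤ ∑ i ∈ Finset.range M, ((N₀ + P) + P * nb i) :=
              Finset.sum_le_sum fun i _ => by
                have := hnb' i
                rw [mul_comm P]
                omega
          _ = _ := by rw [Finset.sum_add_distrib]; simp
      have h2 := hg.trans_le h1
      unfold gapBound at h2
      exact Nat.le_of_mul_le_mul_left (by omega) hP)
  have hcl : ∀ i < M, c (.inl i) ≤ nb i := fun i hi => hcn (.inl i) (by simpa using hi)
  have hcr : ∀ j < J, c (.inr j) ≤ (v j).natAbs - 1 := fun j hj => hcn (.inr j) (by simpa using hj)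
  have hcP : ∀ i < M, c (.inl i) * P ≤ g i - N₀ := fun i hi =>
    (Nat.mul_le_mul_right P (hcl i hi)).trans (hnb i)
  refine ⟨fun i => c (.inl i), fun i hi => ?_, ?_, fun j hj => ?_⟩
  · rcases Nat.eq_zero_or_pos (c (.inl i)) with h | h
    · exact Or.inl h
    · have h1 := hcP i hi
      have h2 : 0 < c (.inl i) * P := Nat.mul_pos h hP
      exact Or.inr (show N₀ + c (.inl i) * P ≤ g i by omega)
  · -- A family of slack vectors alone has sum zero only if it is empty.
    by_contra hc
    push Not at hc
    obtain ⟨t, ht, ht0⟩ := hc0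
    rcases t with i | j
    · exact ht0 (hc i (by simpa using ht))
    · have hj : j < J := by simpa using ht
      have h1 := hcs j hj
      rw [hsumf c j hj, Finset.sum_eq_zero fun i hi => by
        rw [hc i (Finset.mem_range.1 hi)]; simp] at h1
      have h2 := hcr j hj
      have h3 : (v j).sign ≠ 0 := by
        rw [Ne, Int.sign_eq_zero_iff_zero]
        intro h
        rw [h] at h2
        exact ht0 (by simpa using h2)
      have h4 : (c (.inr j) : ℤ) ≠ 0 := by exact_mod_cast ht0
      exact mul_ne_zero h3 h4 (by linarith)
  · have h1 := hcs j hj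
    rw [hsumf c j hj] at h1
    have h2 : affineForm M e γ (fun i => g i - c (.inl i) * P) j =
        v j - (v j).sign * c (.inr j) := by
      have : ∑ i ∈ Finset.range M, ((g i - c (.inl i) * P : ℕ) : ℤ) * e i j =
          ∑ i ∈ Finset.range M, (g i : ℤ) * e i j -
            ∑ i ∈ Finset.range M, ((c (.inl i) * P : ℕ) : ℤ) * e i j := by
        rw [← Finset.sum_sub_distrib]
        exact Finset.sum_congr rfl fun i hi => by
          rw [Nat.cast_sub ((hcP i (Finset.mem_range.1 hi)).trans (Nat.sub_le _ _))]; ring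
      have h3 : v j = ∑ i ∈ Finset.range M, (g i : ℤ) * e i j + γ j := rfl
      rw [affineForm, this]
      linarith
    rw [h2]
    exact sign_sub_sign_mul _ _ (hcr j hj)

/-- Repeated decrease until the total of the arguments is bounded. -/
theorem exists_small_gaps {M J P N₀ C : ℕ} (hP : 0 < P) {e : ℕ → ℕ → ℤ} {γ : ℕ → ℤ}
    (he : ∀ i < M, ∀ j < J, |e i j| ≤ C) (hγ : ∀ j < J, |γ j| ≤ C) (g : ℕ → ℕ) :
    ∃ g' : ℕ → ℕ, (∀ i < M, ∃ c, g i = g' i + c * P ∧ (c = 0 ∨ N₀ ≤ g' i)) ∧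
      (∀ j < J, (affineForm M e γ g' j).sign = (affineForm M e γ g j).sign) ∧
      ∑ i ∈ Finset.range M, g' i ≤ gapBound M J P N₀ C := by
  induction hn : ∑ i ∈ Finset.range M, g i using Nat.strong_induction_on generalizing g with
  | _ n ih =>
    by_cases hg : gapBound M J P N₀ C < ∑ i ∈ Finset.range M, g i
    · obtain ⟨c, h1, ⟨i, hi, hi0⟩, h3⟩ := exists_shrink hP he hγ g hg
      have hle : ∀ i < M, c i * P ≤ g i := fun i hi => by
        rcases h1 i hi with h | h
        · simp [h]
        · omega
      obtain ⟨g', h4, h5, h6⟩ := ih (∑ i ∈ Finset.range M, (g i - c i * P)) (by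
        rw [← hn]
        refine Finset.sum_lt_sum (fun i _ => Nat.sub_le _ _) ⟨i, Finset.mem_range.2 hi, ?_⟩
        have := hle i hi
        have : 0 < c i * P := Nat.mul_pos (Nat.pos_of_ne_zero hi0) hP
        omega) (fun i => g i - c i * P) rfl
      refine ⟨g', fun i hi => ?_, fun j hj => (h5 j hj).trans (h3 j hj), h6⟩
      obtain ⟨c', hc', hc''⟩ := h4 i hi
      refine ⟨c' + c i, ?_, ?_⟩
      · have := hle i hi
        rw [add_mul]
        omega
      · rcases h1 i hi with h | h
        · rw [h, add_zero]
          exact hc''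
        · rcases hc'' with rfl | h'
          · exact Or.inr (by simp at hc'; omega)
          · exact Or.inr h'
    · exact ⟨g, fun i _ => ⟨0, by simp⟩, fun _ _ => rfl, not_lt.1 hg⟩

/-! ### The small model property -/

theorem Recog.forall_le {n : ℕ} {R : ℕ → Config → Prop} (N : ℕ) (h : ∀ k ≤ N, Recog n (R k)) :
    Recog (n + N) (fun X => ∀ k ≤ N, R k X) := by
  induction N with
  | zero => exact (h 0 le_rfl).congr fun X _ => by simp
  | succ N ih =>
    refine ((ih fun k hk => h k (by omega)).and ((h (N + 1) le_rfl).mono (by omega))).congr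
      fun X _ => ⟨fun H => ⟨fun k hk => H k (by omega), H _ le_rfl⟩, fun H k hk => ?_⟩
    rcases Nat.lt_or_ge k (N + 1) with h | h
    · exact H.1 k (by omega)
    · obtain rfl : k = N + 1 := by omega
      exact H.2

/-- The mark track of an integer term holds its value, and is empty when the term is undefined. -/
def IsMarked (t : IntTerm) (X : Config) : Prop :=
  ∀ n, n ∈ X (.mark t.code) ↔ t.eval (intVal X) (setVal X) = some n

theorem Recog.isMarked (t : IntTerm) : Recog (2 * t.code + 7) (IsMarked t) := by
  have h1 := (((t.recog 0).and ((Recog.eqTrack (.mark t.code) (.scr 0)).mono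
    (Nat.zero_le _))).ex (i := .scr 0) (by simp))
  have h2 := (t.recog 0).ex (i := .scr 0) (by simp)
  refine (h1.or ((h2.not.and ((Recog.eqEmpty (.mark t.code)).mono (Nat.zero_le _))))).congr
    fun X _ => ?_
  simp only [IsMarked, HasValue, intVal_update_scr, setVal_update_scr, Function.update_self,
    ne_eq, reduceCtorEq, not_false_eq_true, Function.update_of_ne]
  cases t.eval (intVal X) (setVal X) with
  | none => simp [Finset.eq_empty_iff_forall_notMem]
  | some m =>
    constructor
    · exact fun H => .inl ⟨{m}, ⟨m, rfl, rfl⟩, by ext n; rw [H]; simp [eq_comm]⟩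
    · rintro (⟨_, ⟨m', hm, rfl⟩, h⟩ | ⟨h, -⟩) n
      · rw [h, hm, Finset.mem_singleton, Option.some.injEq, eq_comm]
      · exact absurd ⟨{m}, m, rfl, rfl⟩ h

/-- The value of a Presburger term when the integer term with code `k` has the value `μ k`. -/
def PresTerm.lin (μ : ℕ → ℤ) : PresTerm → ℤ
  | .base t => μ t.code
  | .add p q => p.lin μ + q.lin μ
  | .sub p q => p.lin μ - q.lin μ

/-- All integer terms in a Presburger term have a code that satisfies `D`. -/
def PresTerm.DefinedOn (D : ℕ → Prop) : PresTerm → Prop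
  | .base t => D t.code
  | .add p q => p.DefinedOn D ∧ q.DefinedOn D
  | .sub p q => p.DefinedOn D ∧ q.DefinedOn D

theorem PresTerm.eval_eq_some_iff {N : ℕ} {D : ℕ → Prop} {μ : ℕ → ℤ} {v : ℕ → ℤ}
    {V : ℕ → Finset ℤ}
    (h : ∀ t : IntTerm, t.code ≤ N → ∀ a, t.eval v V = some a ↔ D t.code ∧ a = μ t.code) :
    ∀ p : PresTerm, p.code ≤ N → ∀ a, p.eval v V = some a ↔ p.DefinedOn D ∧ a = p.lin μ
  | .base t, hp, a => h t (by simp only [PresTerm.code] at hp; omega) a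
  | .add p q, hp, a => by
      have h3 := Nat.left_le_pair p.code q.code
      have h4 := Nat.right_le_pair p.code q.code
      simp only [PresTerm.code] at hp
      simp only [PresTerm.eval, Option.bind_eq_some_iff, p.eval_eq_some_iff h (by omega),
        q.eval_eq_some_iff h (by omega), PresTerm.DefinedOn, PresTerm.lin]
      aesop
  | .sub p q, hp, a => by
      have h3 := Nat.left_le_pair p.code q.code
      have h4 := Nat.right_le_pair p.code q.code
      simp only [PresTerm.code] at hp
      simp only [PresTerm.eval, Option.bind_eq_some_iff, p.eval_eq_some_iff h (by omega),
        q.eval_eq_some_iff h (by omega), PresTerm.DefinedOn, PresTerm.lin]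
      aesop

/-- `PresTerm.lin` is linear in the values of the integer terms. -/
theorem PresTerm.lin_sum (s : Finset ℕ) (g : ℕ → ℤ) (ν : ℕ → ℕ → ℤ) (γ : ℕ → ℤ) :
    ∀ p : PresTerm, p.lin (fun k => ∑ i ∈ s, g i * ν i k + γ k) =
      ∑ i ∈ s, g i * p.lin (ν i) + p.lin γ
  | .base t => rfl
  | .add p q => by
      simp only [PresTerm.lin, p.lin_sum, q.lin_sum, mul_add, Finset.sum_add_distrib]
      ring
  | .sub p q => by
      simp only [PresTerm.lin, p.lin_sum, q.lin_sum, mul_sub, Finset.sum_sub_distrib]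
      ring

theorem PresTerm.abs_lin_le {μ : ℕ → ℤ} {B : ℕ} (h : ∀ k, |μ k| ≤ B) :
    ∀ p : PresTerm, |p.lin μ| ≤ ((p.code + 1) * B : ℕ)
  | .base t => (h _).trans (by
      have : B ≤ ((PresTerm.base t).code + 1) * B := Nat.le_mul_of_pos_left _ (by omega)
      exact_mod_cast this)
  | .add p q => by
      have h3 := Nat.left_le_pair p.code q.code
      have h4 := Nat.right_le_pair p.code q.code
      refine (abs_add_le _ _).trans ((add_le_add (p.abs_lin_le h) (q.abs_lin_le h)).trans ?_)
      rw [← Nat.cast_add, ← add_mul]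
      have : (p.code + 1 + (q.code + 1)) * B ≤ ((PresTerm.add p q).code + 1) * B :=
        Nat.mul_le_mul_right _ (by simp only [PresTerm.code]; omega)
      exact_mod_cast this
  | .sub p q => by
      have h3 := Nat.left_le_pair p.code q.code
      have h4 := Nat.right_le_pair p.code q.code
      refine (abs_sub _ _).trans ((add_le_add (p.abs_lin_le h) (q.abs_lin_le h)).trans ?_)
      rw [← Nat.cast_add, ← add_mul]
      have : (p.code + 1 + (q.code + 1)) * B ≤ ((PresTerm.sub p q).code + 1) * B :=
        Nat.mul_le_mul_right _ (by simp only [PresTerm.code]; omega)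
      exact_mod_cast this

theorem IntRel.holds_zero_iff_of_sign_eq (r : IntRel) {m n : ℤ} (h : m.sign = n.sign) :
    r.Holds m 0 ↔ r.Holds n 0 := by
  have h0 : m = 0 ↔ n = 0 := by rw [← Int.sign_eq_zero_iff_zero, h, Int.sign_eq_zero_iff_zero]
  have h1 : 0 < m ↔ 0 < n := by
    rw [← Int.sign_eq_one_iff_pos, h, Int.sign_eq_one_iff_pos]
  cases r <;> simp only [IntRel.Holds] <;> omega

/-- The elements of a track are read off from the word of a window. -/
theorem mem_iff_word_getElem? {X : Config} {a : ℤ} {m : ℕ} (hw : InWindow X a m) (i : Track)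
    (p : ℤ) : p ∈ X i ↔ ∃ k : ℕ, p = a + k ∧ ∃ l, (word X a m)[k]? = some l ∧ i ∈ l := by
  constructor
  · intro hp
    have := hw.mem hp
    refine ⟨(p - a).toNat, by omega, letter X p, ?_, hp⟩
    rw [word, List.getElem?_map, List.getElem?_range (by omega)]
    simp only [Option.map_some, Option.some.injEq]
    congr 1
    omega
  · rintro ⟨k, rfl, l, hl, hi⟩
    rw [word, List.getElem?_map, Option.map_eq_some_iff] at hl
    obtain ⟨k', hk', rfl⟩ := hl
    obtain ⟨hk, rfl⟩ := List.getElem?_eq_some_iff.1 hk'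
    simpa [letter] using hi

theorem exists_config_word_eq (w : List (Set Track)) (a : ℤ) :
    ∃ Y : Config, InWindow Y a w.length ∧ word Y a w.length = w := by
  classical
  refine ⟨fun i => ((Finset.range w.length).filter fun k => i ∈ w.getD k ∅).image
    fun k : ℕ => a + (k : ℤ), ?_, ?_⟩
  · intro i p hp
    simp only [Finset.mem_image, Finset.mem_filter, Finset.mem_range] at hp
    obtain ⟨k, ⟨hk, -⟩, rfl⟩ := hp
    simp; omega
  · apply List.ext_getElem (by simp)
    intro k h1 h2
    ext j
    simp [word, letter, h2]

theorem exists_nat_bound (B : Finset ℤ) : ∃ W : ℕ, ∀ p ∈ B, |p| ≤ W := by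
  obtain ⟨c, hc⟩ := (B.image fun p => |p|).bddAbove
  exact ⟨c.toNat, fun p hp => (hc (Finset.mem_coe.2 (Finset.mem_image_of_mem _ hp))).trans
    (Int.self_le_toNat c)⟩

/-- Only finitely many variables matter, so the others can be given the values `0` and `∅`. -/
theorem Formula.exists_bounded_of_satisfiable {φ : Formula} (h : φ.Satisfiable) :
    ∃ v V, (∃ W, Bounded v V W) ∧ φ.Holds v V := by
  obtain ⟨v, V, hφ⟩ := h
  obtain ⟨W, hW⟩ := exists_nat_bound ((Finset.range (φ.code + 1)).image v ∪
    (Finset.range (φ.code + 1)).biUnion V)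
  refine ⟨fun x => if x ≤ φ.code then v x else 0, fun S => if S ≤ φ.code then V S else ∅,
    ⟨W, fun x => ?_, fun S p hp => ?_⟩, ?_⟩
  · split_ifs with hx
    · exact hW _ (Finset.mem_union_left _ (Finset.mem_image_of_mem _ (by simp; omega)))
    · simp
  · split_ifs at hp with hS
    · exact hW _ (Finset.mem_union_right _ (Finset.mem_biUnion.2 ⟨S, by simp; omega, hp⟩))
    · simp at hp
  · exact (φ.holds_congr le_rfl (fun x hx => by simp [hx]) fun x hx => by simp [hx]).1 hφ

theorem exists_intTerm (k : ℕ) : ∃ t : IntTerm, t.code = k := (term_code_surj k).2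

/-- A bound on the number of states of an automaton for a formula with code `N` together with the
marks for the integer terms with code at most `N`. -/
def stateBound (N : ℕ) : ℕ := tower (3 * N + 30)

/-- The bound on the values in a small model of a formula with code `N`: there are at most `N + 3`
blocks between at most `N + 2` marked letters, and one affine form for every Presburger term with
code at most `N`. -/
def modelBound (N : ℕ) : ℕ :=
  gapBound (N + 3) (N + 1) (2 ^ stateBound N).factorial (2 ^ stateBound N) ((N + 1) * (N + 3)) +
    (N + 2)

theorem position_eq_sum {g : ℕ → ℕ} {i M : ℕ} (h : i < M) : (position g i : ℤ) =
    ∑ j ∈ Finset.range M, (g j : ℤ) * (if j ≤ i then 1 else 0) + i := by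
  rw [position]
  push_cast
  congr 1
  simp only [mul_ite, mul_one, mul_zero]
  rw [← Finset.sum_filter]
  refine Finset.sum_congr ?_ fun _ _ => rfl
  ext j
  simp only [Finset.mem_range, Finset.mem_filter]
  omega

/-- The letters without a mark: neither the origin nor a mark track with index at most `N`. -/
def markLetters (N : ℕ) : Set (Set Track) :=
  {l | Track.org ∉ l ∧ ∀ k ≤ N, Track.mark k ∉ l}

set_option maxHeartbeats 1600000 in
/-- A satisfiable RQSPA formula has a model whose size is bounded in terms of its code. -/
theorem Formula.exists_small_model {φ : Formula} (hφ : φ.IsRQSPA) (h : φ.Satisfiable) :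
    ∃ v V, Bounded v V (modelBound φ.code) ∧ φ.Holds v V := by
  classical
  obtain ⟨v, V, ⟨W, hW⟩, hv⟩ := Formula.exists_bounded_of_satisfiable h
  obtain ⟨N, hN⟩ : ∃ N, N = φ.code := ⟨_, rfl⟩
  choose tm htm using exists_intTerm
  choose pm hpm using PresTerm.code_surj
  rw [← hN]
  -- The configuration of the model, with the values of the integer terms on the mark tracks.
  let mk : ℕ → Finset ℤ := fun k => if k ≤ N then ((tm k).eval v V).toFinset else ∅
  let X : Config := fun i => match i with
    | .mark k => mk k
    | i => configOf v V i
  have hXv : intVal X = v := intVal_configOf v V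
  have hXV : setVal X = V := rfl
  have hXorg : X .org = {0} := rfl
  obtain ⟨a, m, hw⟩ : ∃ a m, InWindow X a m := by
    obtain ⟨W', hW'⟩ := exists_nat_bound ((Finset.range (N + 1)).biUnion mk)
    refine ⟨-(W + W' : ℕ), 2 * (W + W') + 1, fun i p hp => ?_⟩
    have : |p| ≤ (W + W' : ℕ) := by
      rcases i with _ | x | S | k | k
      · rw [Finset.mem_singleton.1 hp]; simp; positivity
      · rw [Finset.mem_singleton.1 hp]; exact (hW.int x).trans (by push_cast; omega)
      · exact (hW.set S p hp).trans (by push_cast; omega)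
      · refine (hW' p (Finset.mem_biUnion.2 ⟨k, ?_, hp⟩)).trans (by push_cast; omega)
        by_contra hk
        change p ∈ mk k at hp
        simp only [mk] at hp
        rw [if_neg (by simpa using hk)] at hp
        simp at hp
      · simp [X, configOf] at hp
    rw [Finset.mem_Ico]
    rw [abs_le] at this
    push_cast at this ⊢
    omega
  let τ : IntRel → PresTerm → Prop := fun r p => (Formula.presAtom r p).Holds v V
  let R : Config → Prop := fun X =>
    φ.HoldsGiven τ (intVal X) (setVal X) ∧ ∀ k ≤ N, IsMarked (tm k) X
  have hR : Recog (3 * N + 30) R :=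
    ((φ.recog τ).mono (n' := 3 * N + 29) (by omega)).and ((Recog.forall_le N fun k hk =>
      (Recog.isMarked (tm k)).mono (n' := 2 * N + 7) (by rw [htm]; omega)).mono (by omega))
  have hRX : R X := by
    refine ⟨?_, fun k hk n => ?_⟩
    · rw [hXv, hXV]
      exact (φ.holds_iff_holdsGiven hφ (AllPres.imp (fun _ _ _ => Iff.rfl) φ
        (φ.allPres_code_le le_rfl))).1 hv
    · rw [hXv, hXV, htm]
      change n ∈ mk k ↔ _
      simp only [mk, if_pos hk, Option.mem_toFinset, Option.mem_def]
  obtain ⟨Q, _, M, hQ, HM⟩ := hR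
  have hacc := (HM X a m hXorg hw).1 hRX
  obtain ⟨us, ls, n, hword, hU, hM⟩ := exists_assemble (markLetters N) (word X a m)
  let g : ℕ → ℕ := fun j => (us j).length
  -- A marked track occurs exactly on some of the marked letters.
  have hpos : ∀ {us' : ℕ → List (Set Track)} {g' : ℕ → ℕ} {Y : Config} {b : ℤ} {m' : ℕ},
      InWindow Y b m' → word Y b m' = assemble us' ls n →
      (∀ j, ∀ l ∈ us' j, l ∈ markLetters N) → (∀ j ≤ n, (us' j).length = g' j) →
      ∀ i : Track, (i = .org ∨ ∃ k ≤ N, i = .mark k) → ∀ p,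
        p ∈ Y i ↔ ∃ j < n, p = b + position g' j ∧ i ∈ ls j := by
    intro us' g' Y b m' hY hYw hU' hg' i hi p
    have hP : ∀ j, ∀ l ∈ us' j, ¬ i ∈ l := by
      intro j l hl
      rcases hi with rfl | ⟨k, hk, rfl⟩
      · exact (hU' j l hl).1
      · exact (hU' j l hl).2 k hk
    rw [mem_iff_word_getElem? hY, hYw]
    simp only [assemble_getElem? (P := fun l => i ∈ l) hg' hP]
    constructor
    · rintro ⟨_, rfl, j, hj, rfl, hi⟩
      exact ⟨j, hj, rfl, hi⟩
    · rintro ⟨j, hj, rfl, hi⟩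
      exact ⟨_, rfl, j, hj, rfl, hi⟩
  have hposX := hpos hw hword hU (g' := g) (fun j _ => rfl)
  have hinj : ∀ (i : Track) (p : ℤ), (i = .org ∨ ∃ k ≤ N, i = .mark k) → (∀ q ∈ X i, q = p) →
      ∀ j < n, ∀ j' < n, i ∈ ls j → i ∈ ls j' → j = j' := by
    intro i p hi hp j hj j' hj' h1 h2
    have e1 := hp _ ((hposX i hi _).2 ⟨j, hj, rfl, h1⟩)
    have e2 := hp _ ((hposX i hi _).2 ⟨j', hj', rfl, h2⟩)
    exact (position_strictMono g).injective (by omega)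
  have horg := hinj .org 0 (.inl rfl) (by simp [hXorg])
  have hmark : ∀ k ≤ N, ∀ j < n, ∀ j' < n, Track.mark k ∈ ls j → Track.mark k ∈ ls j' →
      j = j' := by
    intro k hk
    cases hval : (tm k).eval v V with
    | none =>
      refine hinj (.mark k) 0 (.inr ⟨k, hk, rfl⟩) fun q hq => ?_
      have := (hRX.2 k hk q).1 (by rwa [htm])
      rw [hXv, hXV, hval] at this
      simp at this
    | some c =>
      refine hinj (.mark k) c (.inr ⟨k, hk, rfl⟩) fun q hq => ?_
      have := (hRX.2 k hk q).1 (by rwa [htm])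
      rw [hXv, hXV, hval] at this
      exact (Option.some.inj this).symm
  obtain ⟨j₀, hj₀, h0, hj₀'⟩ := (hposX .org (.inl rfl) 0).1 (by simp [hXorg])
  -- Every marked letter carries the origin or a mark, and each of these occurs only once.
  have hn : n ≤ N + 2 := by
    have : ∀ j, ∃ k ≤ N + 1, j < n →
        (k = 0 ∧ Track.org ∈ ls j) ∨ (∃ k' ≤ N, k = k' + 1 ∧ Track.mark k' ∈ ls j) := by
      intro j
      by_cases hj : j < n
      · have := hM j hj
        simp only [markLetters, Set.mem_ofPred_eq, not_and_or, not_not, not_forall] at this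
        rcases this with h | ⟨k, hk, h⟩
        · exact ⟨0, by omega, fun _ => .inl ⟨rfl, h⟩⟩
        · exact ⟨k + 1, by omega, fun _ => .inr ⟨k, hk, rfl, h⟩⟩
      · exact ⟨0, by omega, fun h => absurd h hj⟩
    choose κ hκ hκ' using this
    rw [← Finset.card_range n, ← Finset.card_range (N + 2)]
    refine Finset.card_le_card_of_injOn κ (fun j _ => ?_) fun j hj j' hj' e => ?_
    · have := hκ j
      simp; omega
    · simp only [Finset.coe_range, Set.mem_Iio] at hj hj'
      rcases hκ' j hj with ⟨h1, h2⟩ | ⟨k, hk, h1, h2⟩ <;>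
        rcases hκ' j' hj' with ⟨h1', h2'⟩ | ⟨k', hk', h1', h2'⟩
      · exact horg j hj j' hj' h2 h2'
      · omega
      · omega
      · obtain rfl : k = k' := by omega
        exact hmark k hk j hj j' hj' h2 h2'
  -- The values of the integer terms as affine forms in the lengths of the blocks.
  let D : ℕ → Prop := fun k => ∃ j < n, Track.mark k ∈ ls j
  -- The marked letter with the mark `k`; the origin serves as the default for terms without value.
  let idx : ℕ → ℕ := fun k => if h : D k then h.choose else j₀
  have hidx : ∀ k, idx k < n := fun k => by
    simp only [idx]
    split_ifs with h
    exacts [h.choose_spec.1, hj₀]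
  have hidx' : ∀ k ≤ N, ∀ j < n, Track.mark k ∈ ls j → j = idx k := fun k hk j hj hjk => by
    have h : D k := ⟨j, hj, hjk⟩
    simp only [idx, dif_pos h]
    exact hmark k hk j hj _ h.choose_spec.1 hjk h.choose_spec.2
  have hidxD : ∀ k, D k → Track.mark k ∈ ls (idx k) := fun k h => by
    simp only [idx, dif_pos h]
    exact h.choose_spec.2
  let μ : (ℕ → ℕ) → ℕ → ℤ := fun g k => position g (idx k) - position g j₀
  let ν : ℕ → ℕ → ℤ := fun i k => (if i ≤ idx k then 1 else 0) - if i ≤ j₀ then 1 else 0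
  let ρ : ℕ → ℤ := fun k => (idx k : ℤ) - j₀
  have hlin : ∀ (g : ℕ → ℕ) (p : PresTerm), p.lin (μ g) =
      affineForm (N + 3) (fun i j => (pm j).lin (ν i)) (fun j => (pm j).lin ρ) g p.code := by
    intro g p
    have hp : pm p.code = p := PresTerm.code_inj _ _ (hpm _)
    have : μ g = fun k => ∑ i ∈ Finset.range (N + 3), (g i : ℤ) * ν i k + ρ k := by
      funext k
      have h1 := hidx k
      simp only [μ, ν, ρ]
      rw [position_eq_sum (show idx k < N + 3 by omega),
        position_eq_sum (show j₀ < N + 3 by omega)]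
      simp only [mul_sub, Finset.sum_sub_distrib]
      ring
    rw [this, PresTerm.lin_sum, affineForm]
    simp only [hp]
  have hval : ∀ {us' : ℕ → List (Set Track)} {g' : ℕ → ℕ} {Y : Config} {b : ℤ} {m' : ℕ},
      InWindow Y b m' → word Y b m' = assemble us' ls n →
      (∀ j, ∀ l ∈ us' j, l ∈ markLetters N) → (∀ j ≤ n, (us' j).length = g' j) →
      b = -position g' j₀ → (∀ k ≤ N, IsMarked (tm k) Y) →
      ∀ t : IntTerm, t.code ≤ N → ∀ c,
        t.eval (intVal Y) (setVal Y) = some c ↔ D t.code ∧ c = μ g' t.code := by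
    intro us' g' Y b m' hY hYw hU' hg' hb hmk t ht c
    have h1 := hmk t.code ht c
    have e : tm t.code = t := IntTerm.code_inj _ _ (htm _)
    rw [e] at h1
    rw [← h1, hpos hY hYw hU' hg' (.mark t.code) (.inr ⟨_, ht, rfl⟩)]
    simp only [μ]
    constructor
    · rintro ⟨j, hj, rfl, hjk⟩
      refine ⟨⟨j, hj, hjk⟩, ?_⟩
      rw [← hidx' _ ht j hj hjk]
      omega
    · rintro ⟨hD, rfl⟩
      exact ⟨_, hidx _, by omega, hidxD _ hD⟩
  have hvalX := hval hw hword hU (g' := g) (fun j _ => rfl) (by omega) hRX.2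
  -- Shorter blocks with the same signs of all Presburger terms, and a model that has these blocks.
  obtain ⟨g', hg1, hg2, hg3⟩ := exists_small_gaps (M := N + 3) (J := N + 1)
    (P := (2 ^ stateBound N).factorial) (N₀ := 2 ^ stateBound N) (C := (N + 1) * (N + 3))
    (Nat.factorial_pos _) (e := fun i j => (pm j).lin (ν i)) (γ := fun j => (pm j).lin ρ)
    (fun i _ j hj => ((pm j).abs_lin_le (B := 1) (fun k => by
      simp only [ν]; split_ifs <;> simp)).trans (by
        rw [hpm]
        have : (j + 1) * 1 ≤ (N + 1) * (N + 3) := Nat.mul_le_mul (by omega) (by omega)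
        exact_mod_cast this))
    (fun j hj => ((pm j).abs_lin_le (B := N + 3) (fun k => by
      have := hidx k
      simp only [ρ]
      rw [abs_le]
      push_cast
      omega)).trans (by
        rw [hpm]
        have : (j + 1) * (N + 3) ≤ (N + 1) * (N + 3) := Nat.mul_le_mul (by omega) le_rfl
        exact_mod_cast this)) g
  obtain ⟨us', hU', hg', heval⟩ := exists_resized_assemble M (markLetters N) hQ ls hU
    (m := n) (g' := g') fun j hj => hg1 j (by omega)
  obtain ⟨Y, hYw, hY⟩ := exists_config_word_eq (assemble us' ls n) (-position g' j₀)
  have hlen := length_assemble (ls := ls) hg'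
  have hposY := hpos hYw hY hU' hg'
  have hYorg : Y .org = {0} := by
    ext p
    rw [hposY .org (.inl rfl), Finset.mem_singleton]
    constructor
    · rintro ⟨j, hj, rfl, h1⟩
      rw [horg j hj j₀ hj₀ h1 hj₀']
      ring
    · rintro rfl
      exact ⟨j₀, hj₀, by ring, hj₀'⟩
  have hRY : R Y := by
    rw [HM Y _ _ hYorg hYw, hY, DFA.mem_accepts, heval, ← hword]
    exact hacc
  have hvalY := hval hYw hY hU' hg' rfl hRY.2
  refine ⟨intVal Y, setVal Y, ?_, ?_⟩
  · have hlen' : position g' n ≤ modelBound N := by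
      have : ∑ j ∈ Finset.range (n + 1), g' j ≤ ∑ j ∈ Finset.range (N + 3), g' j :=
        Finset.sum_le_sum_of_subset (Finset.range_subset_range.2 (by omega))
      rw [position, modelBound]
      exact add_le_add (this.trans hg3) hn
    have hj : position g' j₀ < position g' n := (position_strictMono g') hj₀
    have hb : ∀ i, ∀ p ∈ Y i, |p| ≤ modelBound N := by
      intro i p hp
      have := hYw.mem hp
      rw [hlen] at this
      rw [abs_le]
      omega
    exact ⟨fun x => abs_minVal_getD_le (hb _), fun S => hb _⟩
  · refine (φ.holds_iff_holdsGiven hφ (AllPres.imp (fun r p hp => ?_) φ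
      (φ.allPres_code_le (N := N) hN.ge))).2 hRY.1
    have hX' := PresTerm.eval_eq_some_iff hvalX p hp
    have hY' := PresTerm.eval_eq_some_iff hvalY p hp
    rw [hXv, hXV] at hX'
    change _ ↔ (Formula.presAtom r p).Holds v V
    simp only [Formula.Holds, hX', hY', and_assoc, exists_and_left, exists_eq_left]
    refine and_congr_right fun _ => r.holds_zero_iff_of_sign_eq ?_
    rw [hlin, hlin]
    exact hg2 _ (by omega)

end RQSPA

/-! ### Primitive recursive functions -/

-- Composition lemmas are tagged, so that `fun_prop` proves primitive recursiveness.

attribute [fun_prop] Primrec PrimrecPred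
attribute [fun_prop] Primrec.const Primrec.comp Primrec.fst Primrec.snd Primrec.pair
attribute [fun_prop] PrimrecPred.not PrimrecPred.and PrimrecPred.or Primrec.ite

namespace RQSPA

namespace PR

variable {α β σ : Type} [Primcodable α] [Primcodable β] [Primcodable σ]

@[fun_prop] theorem id : Primrec (fun a : α => a) := Primrec.id

@[fun_prop] theorem natAdd {f g : α → ℕ} (hf : Primrec f) (hg : Primrec g) :
    Primrec (fun a => f a + g a) := Primrec.nat_add.comp hf hg

@[fun_prop] theorem natSub {f g : α → ℕ} (hf : Primrec f) (hg : Primrec g) :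
    Primrec (fun a => f a - g a) := Primrec.nat_sub.comp hf hg

@[fun_prop] theorem natMul {f g : α → ℕ} (hf : Primrec f) (hg : Primrec g) :
    Primrec (fun a => f a * g a) := Primrec.nat_mul.comp hf hg

@[fun_prop] theorem natDiv {f g : α → ℕ} (hf : Primrec f) (hg : Primrec g) :
    Primrec (fun a => f a / g a) := Primrec.nat_div.comp hf hg

@[fun_prop] theorem natMod {f g : α → ℕ} (hf : Primrec f) (hg : Primrec g) :
    Primrec (fun a => f a % g a) := Primrec.nat_mod.comp hf hg

@[fun_prop] theorem natPair {f g : α → ℕ} (hf : Primrec f) (hg : Primrec g) :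
    Primrec (fun a => Nat.pair (f a) (g a)) := Primrec₂.natPair.comp hf hg

@[fun_prop] theorem unpair {f : α → ℕ} (hf : Primrec f) : Primrec (fun a => (f a).unpair) :=
  Primrec.unpair.comp hf

@[fun_prop] theorem eq {f g : α → β} (hf : Primrec f) (hg : Primrec g) :
    PrimrecPred (fun a => f a = g a) := Primrec.eq.comp hf hg

@[fun_prop] theorem natLt {f g : α → ℕ} (hf : Primrec f) (hg : Primrec g) :
    PrimrecPred (fun a => f a < g a) := Primrec.nat_lt.comp hf hg

@[fun_prop] theorem natLe {f g : α → ℕ} (hf : Primrec f) (hg : Primrec g) :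
    PrimrecPred (fun a => f a ≤ g a) := Primrec.nat_le.comp hf hg

@[fun_prop] theorem decide {p : α → Prop} [DecidablePred p] (hp : PrimrecPred p) :
    Primrec (fun a => Decidable.decide (p a)) := primrecPred_iff_primrec_decide.1 hp

@[fun_prop] theorem some {f : α → β} (hf : Primrec f) : Primrec (fun a => Option.some (f a)) :=
  Primrec.option_some.comp hf

@[fun_prop] theorem optionBind {o : α → Option β} {g : α → β → Option σ} (ho : Primrec o)
    (hg : Primrec (fun p : α × β => g p.1 p.2)) : Primrec (fun a => (o a).bind (g a)) :=
  Primrec.option_bind ho hg.to₂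

@[fun_prop] theorem cons {f : α → β} {L : α → List β} (hf : Primrec f) (hL : Primrec L) :
    Primrec (fun a => f a :: L a) := Primrec.list_cons.comp hf hL

@[fun_prop] theorem append {L L' : α → List β} (hL : Primrec L) (hL' : Primrec L') :
    Primrec (fun a => L a ++ L' a) := Primrec.list_append.comp hL hL'

@[fun_prop] theorem listMap {L : α → List β} {g : α → β → σ} (hL : Primrec L)
    (hg : Primrec (fun p : α × β => g p.1 p.2)) : Primrec (fun a => (L a).map (g a)) :=
  Primrec.list_map hL hg.to₂

@[fun_prop] theorem flatMap {L : α → List β} {g : α → β → List σ} (hL : Primrec L)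
    (hg : Primrec (fun p : α × β => g p.1 p.2)) : Primrec (fun a => (L a).flatMap (g a)) :=
  Primrec.list_flatMap hL hg.to₂

@[fun_prop] theorem range {f : α → ℕ} (hf : Primrec f) : Primrec (fun a => List.range (f a)) :=
  Primrec.list_range.comp hf

@[fun_prop] theorem getD {L : α → List β} {f : α → ℕ} {d : β} (hL : Primrec L) (hf : Primrec f) :
    Primrec (fun a => (L a).getD (f a) d) := (Primrec.list_getD d).comp hL hf

@[fun_prop] theorem headI [Inhabited β] {L : α → List β} (hL : Primrec L) :
    Primrec (fun a => (L a).headI) := Primrec.list_headI.comp hL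

@[fun_prop] theorem head? {L : α → List β} (hL : Primrec L) :
    Primrec (fun a => (L a).head?) := Primrec.list_head?.comp hL

theorem ball {L : α → List β} {p : α → β → Prop} (hL : Primrec L)
    (hp : PrimrecPred (fun q : α × β => p q.1 q.2)) : PrimrecPred (fun a => ∀ b ∈ L a, p a b) := by
  classical
  have h1 : Primrec (fun a => (L a).map (fun b => Decidable.decide (p a b))) := by fun_prop
  have h2 : PrimrecPred (fun l : List Bool => ∀ b ∈ l, b = true) :=
    PrimrecPred.forall_mem_list (by fun_prop)
  exact (h2.comp h1).of_eq fun a => by simp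

theorem bex {L : α → List β} {p : α → β → Prop} (hL : Primrec L)
    (hp : PrimrecPred (fun q : α × β => p q.1 q.2)) : PrimrecPred (fun a => ∃ b ∈ L a, p a b) :=
  (ball (p := fun a b => ¬ p a b) hL hp.not).not.of_eq fun a => by simp

@[fun_prop] theorem filter {L : α → List β} {p : α → β → Prop} [∀ a, DecidablePred (p a)]
    (hL : Primrec L) (hp : PrimrecPred (fun q : α × β => p q.1 q.2)) :
    Primrec (fun a => (L a).filter (fun b => p a b)) := by
  classical
  have h1 : Primrec (fun a => (L a).flatMap (fun b => if p a b then [b] else [])) := by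
    fun_prop
  refine h1.of_eq fun a => ?_
  induction L a with
  | nil => rfl
  | cons b l ih => by_cases h : p a b <;> simp [h, ih]

@[fun_prop] theorem mem {L : α → List β} {f : α → β} (hL : Primrec L) (hf : Primrec f) :
    PrimrecPred (fun a => f a ∈ L a) :=
  (bex (p := fun a b => b = f a) hL (by fun_prop)).of_eq fun a => by simp

theorem natRec {f : α → ℕ} {g : α → β} {h : α → ℕ → β → β} (hf : Primrec f) (hg : Primrec g)
    (hh : Primrec (fun p : α × ℕ × β => h p.1 p.2.1 p.2.2)) :
    Primrec (fun a => Nat.rec (motive := fun _ => β) (g a) (h a) (f a)) :=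
  Primrec.nat_rec' hf hg (h := fun a p => h a p.1 p.2) hh.to₂

@[fun_prop] theorem iterate {f : α → ℕ} {g : α → β} {h : β → β} (hf : Primrec f) (hg : Primrec g)
    (hh : Primrec h) : Primrec (fun a => h^[f a] (g a)) :=
  Primrec.nat_iterate hf hg (hh.comp Primrec.snd).to₂

@[fun_prop] theorem natPow {f g : α → ℕ} (hf : Primrec f) (hg : Primrec g) :
    Primrec (fun a => f a ^ g a) :=
  (natRec (g := fun _ => 1) (h := fun a _ r => r * f a) hg (by fun_prop) (by fun_prop)).of_eq
    fun a => by
      induction g a with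
      | zero => rfl
      | succ n ih => rw [pow_succ, ← ih]

@[fun_prop] theorem factorial {f : α → ℕ} (hf : Primrec f) :
    Primrec (fun a => (f a).factorial) :=
  (natRec (g := fun _ => 1) (h := fun _ n r => (n + 1) * r) hf (by fun_prop) (by fun_prop)).of_eq
    fun a => by
      induction f a with
      | zero => rfl
      | succ n ih => rw [Nat.factorial_succ, ← ih]

@[fun_prop] theorem tower {f : α → ℕ} (hf : Primrec f) : Primrec (fun a => tower (f a)) :=
  (natRec (g := fun _ => 4) (h := fun _ _ r => 2 ^ r) hf (by fun_prop) (by fun_prop)).of_eq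
    fun a => by
      induction f a with
      | zero => rfl
      | succ n ih => rw [RQSPA.tower, ← ih]

@[fun_prop] theorem modelBound {f : α → ℕ} (hf : Primrec f) :
    Primrec (fun a => modelBound (f a)) := by
  have h : Primrec (fun C => C * (2 * C + 2)) := by fun_prop
  unfold RQSPA.modelBound gapBound slackBound stateBound
  -- The iterated function `boxGrowth` is written out for `fun_prop`.
  change Primrec fun a => _ + _ * (2 * (2 * (fun C => C * (2 * C + 2))^[_] _ + 1)) ^ _ + _
  fun_prop

theorem sublists' : Primrec (List.sublists' : List β → List (List β)) := by
  have h := Primrec.list_foldr (α := List β) (β := β) (σ := List (List β)) (f := fun l => l)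
    (g := fun _ => [[]]) (h := fun _ q => q.2 ++ q.2.map fun s => q.1 :: s) Primrec.id
    (Primrec.const _) (by
      apply Primrec.to₂ (f := fun p : List β × β × List (List β) =>
        p.2.2 ++ p.2.2.map fun s => p.2.1 :: s)
      fun_prop)
  refine h.of_eq fun l => ?_
  induction l with
  | nil => rfl
  | cons a l ih => rw [List.sublists'_cons, ← ih]; rfl

/-! ### Primitive recursive integer arithmetic -/

@[fun_prop] theorem intToNat {f : α → ℤ} (hf : Primrec f) : Primrec (fun a => (f a).toNat) := by
  have h : Primrec (fun a => if Encodable.encode (f a) % 2 = 0 then Encodable.encode (f a) / 2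
      else 0) := by
    have := Primrec.encode.comp hf
    fun_prop
  refine h.of_eq fun a => ?_
  cases f a with
  | ofNat n =>
    have e : Encodable.encode (Int.ofNat n) = 2 * n := rfl
    rw [e]; simp
  | negSucc n =>
    have e : Encodable.encode (Int.negSucc n) = 2 * n + 1 := rfl
    rw [e, if_neg (by omega)]; rfl

@[fun_prop] theorem intNegToNat {f : α → ℤ} (hf : Primrec f) :
    Primrec (fun a => (-f a).toNat) := by
  have h : Primrec (fun a => if Encodable.encode (f a) % 2 = 0 then 0
      else Encodable.encode (f a) / 2 + 1) := by
    have := Primrec.encode.comp hf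
    fun_prop
  refine h.of_eq fun a => ?_
  cases f a with
  | ofNat n =>
    have e : Encodable.encode (Int.ofNat n) = 2 * n := rfl
    rw [e]; simp
  | negSucc n =>
    have e : Encodable.encode (Int.negSucc n) = 2 * n + 1 := rfl
    rw [e, if_neg (by omega)]
    change _ = n + 1
    omega

@[fun_prop] theorem intOfCode {f : α → ℕ} (hf : Primrec f) :
    Primrec (fun a => Equiv.intEquivNat.symm (f a)) :=
  (Primrec.ofNat ℤ).comp hf

theorem natCastSub {f g : α → ℕ} (hf : Primrec f) (hg : Primrec g) :
    Primrec (fun a => (f a : ℤ) - g a) := by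
  have h : Primrec (fun a => Equiv.intEquivNat.symm
    (if g a ≤ f a then 2 * (f a - g a) else 2 * (g a - f a - 1) + 1)) := by fun_prop
  refine h.of_eq fun a => ?_
  rw [Equiv.symm_apply_eq]
  split_ifs with h
  · obtain ⟨d, hd⟩ := Nat.exists_eq_add_of_le h
    rw [hd, show ((g a + d : ℕ) : ℤ) - g a = Int.ofNat d by simp, Nat.add_sub_cancel_left]
    rfl
  · obtain ⟨d, hd⟩ := Nat.exists_eq_add_of_lt (not_le.1 h)
    rw [hd, show (f a : ℤ) - ((f a + d + 1 : ℕ) : ℤ) = Int.negSucc d by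
      rw [Int.negSucc_eq]; push_cast; ring, show f a + d + 1 - f a - 1 = d by omega]
    rfl

@[fun_prop] theorem intAdd {f g : α → ℤ} (hf : Primrec f) (hg : Primrec g) :
    Primrec (fun a => f a + g a) :=
  (natCastSub (f := fun a => (f a).toNat + (g a).toNat)
    (g := fun a => (-f a).toNat + (-g a).toNat) (by fun_prop) (by fun_prop)).of_eq
    fun a => by push_cast; omega

@[fun_prop] theorem intSub {f g : α → ℤ} (hf : Primrec f) (hg : Primrec g) :
    Primrec (fun a => f a - g a) :=
  (natCastSub (f := fun a => (f a).toNat + (-g a).toNat)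
    (g := fun a => (-f a).toNat + (g a).toNat) (by fun_prop) (by fun_prop)).of_eq
    fun a => by push_cast; omega

@[fun_prop] theorem intLe {f g : α → ℤ} (hf : Primrec f) (hg : Primrec g) :
    PrimrecPred (fun a => f a ≤ g a) := by
  have : PrimrecPred (fun a => (f a - g a).toNat = 0) := by fun_prop
  exact this.of_eq fun a => by omega

/-- Course-of-values recursion: `f a n` is computed from the values of `f a` at four smaller numbers
that depend on `n`, each replaced by a default value if the number is not smaller than `n`. -/
theorem recFour [Inhabited σ] {f : α → ℕ → σ} {p₁ p₂ p₃ p₄ : ℕ → ℕ} (h₁ : Primrec p₁)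
    (h₂ : Primrec p₂) (h₃ : Primrec p₃) (h₄ : Primrec p₄)
    {G : (α × ℕ) × σ × σ × σ × σ → σ} (hG : Primrec G)
    (H : ∀ a n, f a n = G ((a, n), if p₁ n < n then f a (p₁ n) else default,
      if p₂ n < n then f a (p₂ n) else default, if p₃ n < n then f a (p₃ n) else default,
      if p₄ n < n then f a (p₄ n) else default)) :
    Primrec (fun q : α × ℕ => f q.1 q.2) := by
  have hlen : Primrec (fun q : α × List σ => q.2.length) := Primrec.list_length.comp Primrec.snd
  refine Primrec.nat_strong_rec f (g := fun a l => Option.some (G ((a, l.length),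
    l.getD (p₁ l.length) default, l.getD (p₂ l.length) default, l.getD (p₃ l.length) default,
    l.getD (p₄ l.length) default))) ?_ fun a n => ?_
  · apply Primrec.to₂ (f := fun q : α × List σ => Option.some (G ((q.1, q.2.length),
      q.2.getD (p₁ q.2.length) default, q.2.getD (p₂ q.2.length) default,
      q.2.getD (p₃ q.2.length) default, q.2.getD (p₄ q.2.length) default)))
    fun_prop
  · have key : ∀ k, ((List.range n).map (f a)).getD k default =
        if k < n then f a k else default := by
      intro k
      split_ifs with h
      · simp [List.getD_eq_getElem?_getD, List.getElem?_range h]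
      · rw [List.getD_eq_default]
        simpa using h
    rw [H a n]
    simp only [List.length_map, List.length_range, key]

end PR

/-! ### Recursion on codes -/

/-- The set term with a given code. -/
noncomputable def setTermOf (n : ℕ) : SetTerm := (term_code_surj n).1.choose

/-- The integer term with a given code. -/
noncomputable def intTermOf (n : ℕ) : IntTerm := (term_code_surj n).2.choose

/-- The Presburger term with a given code. -/
noncomputable def presTermOf (n : ℕ) : PresTerm := (PresTerm.code_surj n).choose

/-- The formula with a given code. -/
noncomputable def formulaOf (n : ℕ) : Formula := (Formula.code_surj n).choose

theorem code_setTermOf (n : ℕ) : (setTermOf n).code = n := (term_code_surj n).1.choose_spec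

theorem code_intTermOf (n : ℕ) : (intTermOf n).code = n := (term_code_surj n).2.choose_spec

theorem code_presTermOf (n : ℕ) : (presTermOf n).code = n := (PresTerm.code_surj n).choose_spec

theorem code_formulaOf (n : ℕ) : (formulaOf n).code = n := (Formula.code_surj n).choose_spec

@[simp] theorem setTermOf_code (s : SetTerm) : setTermOf s.code = s :=
  SetTerm.code_inj _ _ (code_setTermOf _)

@[simp] theorem intTermOf_code (t : IntTerm) : intTermOf t.code = t :=
  IntTerm.code_inj _ _ (code_intTermOf _)

@[simp] theorem presTermOf_code (p : PresTerm) : presTermOf p.code = p :=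
  PresTerm.code_inj _ _ (code_presTermOf _)

@[simp] theorem formulaOf_code (φ : Formula) : formulaOf φ.code = φ :=
  Formula.code_inj _ _ (code_formulaOf _)

namespace PR

variable {α σ τ : Type} [Primcodable α] [Primcodable σ] [Primcodable τ] [Inhabited σ] [Inhabited τ]

theorem decide_eq_of_iff {p : Prop} [Decidable p] {b : Bool} (h : p ↔ b = true) :
    Decidable.decide p = b :=
  Bool.eq_iff_iff.2 (decide_eq_true_iff.trans h)

/-- A pair of functions on terms that is defined by structural recursion with primitive recursive
clauses is primitive recursive as a pair of functions of the code. -/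
theorem termFold {fS : α → SetTerm → σ} {fT : α → IntTerm → τ}
    {sE : α → σ} {sV : α × ℕ → σ} {sS : α × τ → σ} {sU sI sD : α × σ × σ → σ}
    {iC : α × ℤ → τ} {iV : α × ℕ → τ} {iMin iMax : α × σ → τ}
    (hE : Primrec sE) (hV : Primrec sV) (hS : Primrec sS) (hU : Primrec sU) (hI : Primrec sI)
    (hD : Primrec sD) (hC : Primrec iC) (hiV : Primrec iV) (hMin : Primrec iMin)
    (hMax : Primrec iMax)
    (eE : ∀ a, fS a .empty = sE a) (eV : ∀ a S, fS a (.var S) = sV (a, S))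
    (eS : ∀ a t, fS a (.single t) = sS (a, fT a t))
    (eU : ∀ a s t, fS a (.union s t) = sU (a, fS a s, fS a t))
    (eI : ∀ a s t, fS a (.inter s t) = sI (a, fS a s, fS a t))
    (eD : ∀ a s t, fS a (.diff s t) = sD (a, fS a s, fS a t))
    (eC : ∀ a c, fT a (.const c) = iC (a, c)) (eiV : ∀ a x, fT a (.var x) = iV (a, x))
    (eMin : ∀ a s, fT a (.min s) = iMin (a, fS a s))
    (eMax : ∀ a s, fT a (.max s) = iMax (a, fS a s)) :
    Primrec (fun q : α × ℕ => fS q.1 (setTermOf q.2)) ∧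
      Primrec (fun q : α × ℕ => fT q.1 (intTermOf q.2)) := by
  suffices h : Primrec (fun q : α × ℕ => (fS q.1 (setTermOf q.2), fT q.1 (intTermOf q.2))) from
    ⟨Primrec.fst.comp h, Primrec.snd.comp h⟩
  let G : (α × ℕ) × (σ × τ) × (σ × τ) × (σ × τ) × (σ × τ) → σ × τ := fun q =>
    (if q.1.2 = 0 then sE q.1.1
      else if (q.1.2 - 1) % 5 = 0 then sV (q.1.1, (q.1.2 - 1) / 5)
      else if (q.1.2 - 1) % 5 = 1 then sS (q.1.1, q.2.2.2.1.2)
      else if (q.1.2 - 1) % 5 = 2 then sU (q.1.1, q.2.1.1, q.2.2.1.1)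
      else if (q.1.2 - 1) % 5 = 3 then sI (q.1.1, q.2.1.1, q.2.2.1.1)
      else sD (q.1.1, q.2.1.1, q.2.2.1.1),
      if q.1.2 % 4 = 0 then iC (q.1.1, Equiv.intEquivNat.symm (q.1.2 / 4))
      else if q.1.2 % 4 = 1 then iV (q.1.1, q.1.2 / 4)
      else if q.1.2 % 4 = 2 then iMin (q.1.1, q.2.2.2.2.1)
      else iMax (q.1.1, q.2.2.2.2.1))
  have hG : Primrec G := by fun_prop
  refine recFour (f := fun a n => (fS a (setTermOf n), fT a (intTermOf n)))
    (p₁ := fun n => ((n - 1) / 5).unpair.1) (p₂ := fun n => ((n - 1) / 5).unpair.2)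
    (p₃ := fun n => (n - 1) / 5) (p₄ := fun n => n / 4) (by fun_prop) (by fun_prop)
    (by fun_prop) (by fun_prop) hG fun a n => Prod.ext ?_ ?_
  · obtain ⟨s, rfl⟩ : ∃ s : SetTerm, s.code = n := ⟨_, code_setTermOf n⟩
    dsimp only [G]
    have binary : ∀ (s t : SetTerm) (i : ℕ), i < 5 →
        (5 * Nat.pair s.code t.code + i) / 5 = Nat.pair s.code t.code ∧
        (5 * Nat.pair s.code t.code + i) % 5 = i ∧
        s.code < 5 * Nat.pair s.code t.code + (i + 1) ∧
        t.code < 5 * Nat.pair s.code t.code + (i + 1) := fun s t i hi => by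
      have h3 := Nat.left_le_pair s.code t.code
      have h4 := Nat.right_le_pair s.code t.code
      omega
    rw [setTermOf_code]
    cases s with
    | empty => simp [SetTerm.code, eE]
    | var S => simp [SetTerm.code, eV]
    | single t =>
      have h1 : (5 * t.code + 1) / 5 = t.code := by omega
      have h2 : (5 * t.code + 1) % 5 = 1 := by omega
      have h3 : t.code < 5 * t.code + 2 := by omega
      simp [SetTerm.code, eS, h1, h2, h3]
    | union s t =>
      obtain ⟨h1, h2, h3, h4⟩ := binary s t 2 (by norm_num)
      simp only [Nat.reduceAdd] at h1 h2 h3 h4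
      simp [SetTerm.code, eU, h1, h2, h3, h4]
    | inter s t =>
      obtain ⟨h1, h2, h3, h4⟩ := binary s t 3 (by norm_num)
      simp only [Nat.reduceAdd] at h1 h2 h3 h4
      simp [SetTerm.code, eI, h1, h2, h3, h4]
    | diff s t =>
      obtain ⟨h1, h2, h3, h4⟩ := binary s t 4 (by norm_num)
      simp only [Nat.reduceAdd] at h1 h2 h3 h4
      simp [SetTerm.code, eD, h1, h2, h3, h4]
  · obtain ⟨t, rfl⟩ : ∃ t : IntTerm, t.code = n := ⟨_, code_intTermOf n⟩
    dsimp only [G]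
    rw [intTermOf_code]
    cases t with
    | const c => simp [IntTerm.code, eC]
    | var x =>
      have h1 : (4 * x + 1) / 4 = x := by omega
      have h2 : (4 * x + 1) % 4 = 1 := by omega
      simp [IntTerm.code, eiV, h1, h2]
    | min s =>
      have h1 : (4 * s.code + 2) / 4 = s.code := by omega
      have h2 : (4 * s.code + 2) % 4 = 2 := by omega
      have h3 : s.code < 4 * s.code + 2 := by omega
      simp [IntTerm.code, eMin, h1, h2, h3]
    | max s =>
      have h1 : (4 * s.code + 3) / 4 = s.code := by omega
      have h2 : (4 * s.code + 3) % 4 = 3 := by omega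
      have h3 : s.code < 4 * s.code + 3 := by omega
      simp [IntTerm.code, eMax, h1, h2, h3]

/-- Structural recursion on Presburger terms. The clause for integer terms receives their code. -/
theorem presFold {f : α → PresTerm → σ} {b : α × ℕ → σ} {pA pS : α × σ × σ → σ}
    (hb : Primrec b) (hA : Primrec pA) (hS : Primrec pS)
    (eb : ∀ a t, f a (.base t) = b (a, t.code))
    (eA : ∀ a p q, f a (.add p q) = pA (a, f a p, f a q))
    (eS : ∀ a p q, f a (.sub p q) = pS (a, f a p, f a q)) :
    Primrec (fun q : α × ℕ => f q.1 (presTermOf q.2)) := by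
  let G : (α × ℕ) × σ × σ × σ × σ → σ := fun q =>
    if q.1.2 % 3 = 0 then b (q.1.1, q.1.2 / 3)
      else if q.1.2 % 3 = 1 then pA (q.1.1, q.2.1, q.2.2.1)
      else pS (q.1.1, q.2.1, q.2.2.1)
  have hG : Primrec G := by fun_prop
  refine recFour (f := fun a n => f a (presTermOf n))
    (p₁ := fun n => (n / 3).unpair.1) (p₂ := fun n => (n / 3).unpair.2)
    (p₃ := fun n => n) (p₄ := fun n => n) (by fun_prop) (by fun_prop)
    (by fun_prop) (by fun_prop) hG fun a n => ?_
  obtain ⟨p, rfl⟩ : ∃ p : PresTerm, p.code = n := ⟨_, code_presTermOf n⟩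
  dsimp only [G]
  rw [presTermOf_code]
  cases p with
  | base t => simp [PresTerm.code, eb]
  | add p q =>
    have h3 := Nat.left_le_pair p.code q.code
    have h4 := Nat.right_le_pair p.code q.code
    have e1 : (3 * Nat.pair p.code q.code + 1) / 3 = Nat.pair p.code q.code := by omega
    have e2 : (3 * Nat.pair p.code q.code + 1) % 3 = 1 := by omega
    have e3 : p.code < 3 * Nat.pair p.code q.code + 1 := by omega
    have e4 : q.code < 3 * Nat.pair p.code q.code + 1 := by omega
    simp [PresTerm.code, eA, e1, e2, e3, e4]
  | sub p q =>
    have h3 := Nat.left_le_pair p.code q.code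
    have h4 := Nat.right_le_pair p.code q.code
    have e1 : (3 * Nat.pair p.code q.code + 2) / 3 = Nat.pair p.code q.code := by omega
    have e2 : (3 * Nat.pair p.code q.code + 2) % 3 = 2 := by omega
    have e3 : p.code < 3 * Nat.pair p.code q.code + 2 := by omega
    have e4 : q.code < 3 * Nat.pair p.code q.code + 2 := by omega
    simp [PresTerm.code, eS, e1, e2, e3, e4]

/-- Structural recursion on formulas. The clause for atoms receives their code, and the clauses for
quantifiers the name of the variable and the code of the quantified formula. -/
theorem formulaFold {f : α → Formula → σ} {b : α × ℕ → σ} {gA : α × σ × σ → σ} {gN : α × σ → σ}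
    {gI gS : α × ℕ × ℕ × σ → σ}
    (hb : Primrec b) (hA : Primrec gA) (hN : Primrec gN) (hI : Primrec gI) (hS : Primrec gS)
    (e0 : ∀ a r s t, f a (.setAtom r s t) = b (a, (Formula.setAtom r s t).code))
    (e1 : ∀ a r s t c, f a (.diffAtom r s t c) = b (a, (Formula.diffAtom r s t c).code))
    (e2 : ∀ a r p, f a (.presAtom r p) = b (a, (Formula.presAtom r p).code))
    (eA : ∀ a φ ψ, f a (.and φ ψ) = gA (a, f a φ, f a ψ))
    (eN : ∀ a φ, f a (.neg φ) = gN (a, f a φ))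
    (eI : ∀ a x φ, f a (.allInt x φ) = gI (a, x, φ.code, f a φ))
    (eS : ∀ a x φ, f a (.allSet x φ) = gS (a, x, φ.code, f a φ)) :
    Primrec (fun q : α × ℕ => f q.1 (formulaOf q.2)) := by
  let G : (α × ℕ) × σ × σ × σ × σ → σ := fun q =>
    if q.1.2 % 7 < 3 then b (q.1.1, q.1.2)
      else if q.1.2 % 7 = 3 then gA (q.1.1, q.2.1, q.2.2.1)
      else if q.1.2 % 7 = 4 then gN (q.1.1, q.2.2.2.1)
      else if q.1.2 % 7 = 5 then
        gI (q.1.1, (q.1.2 / 7).unpair.1, (q.1.2 / 7).unpair.2, q.2.2.1)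
      else gS (q.1.1, (q.1.2 / 7).unpair.1, (q.1.2 / 7).unpair.2, q.2.2.1)
  have hG : Primrec G := by fun_prop
  refine recFour (f := fun a n => f a (formulaOf n))
    (p₁ := fun n => (n / 7).unpair.1) (p₂ := fun n => (n / 7).unpair.2)
    (p₃ := fun n => n / 7) (p₄ := fun n => n) (by fun_prop) (by fun_prop)
    (by fun_prop) (by fun_prop) hG fun a n => ?_
  obtain ⟨φ, rfl⟩ : ∃ φ : Formula, φ.code = n := ⟨_, code_formulaOf n⟩
  dsimp only [G]
  rw [formulaOf_code]
  have pairs : ∀ (x y i : ℕ), 3 ≤ i → i < 7 → (7 * Nat.pair x y + i) / 7 = Nat.pair x y ∧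
      (7 * Nat.pair x y + i) % 7 = i ∧ x < 7 * Nat.pair x y + i ∧
      y < 7 * Nat.pair x y + i := fun x y i hi hi' => by
    have h3 := Nat.left_le_pair x y
    have h4 := Nat.right_le_pair x y
    omega
  cases φ with
  | setAtom r s t =>
    rw [e0, if_pos]
    simp only [Formula.code]; omega
  | diffAtom r s t c =>
    rw [e1, if_pos]
    simp only [Formula.code]; omega
  | presAtom r p =>
    rw [e2, if_pos]
    simp only [Formula.code]; omega
  | and φ ψ =>
    obtain ⟨h1, h2, h3, h4⟩ := pairs φ.code ψ.code 3 (by norm_num) (by norm_num)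
    simp [Formula.code, eA, h1, h2, h3, h4]
  | neg φ =>
    have h1 : (7 * φ.code + 4) / 7 = φ.code := by omega
    have h2 : (7 * φ.code + 4) % 7 = 4 := by omega
    have h3 : φ.code < 7 * φ.code + 4 := by omega
    simp [Formula.code, eN, h1, h2, h3]
  | allInt x φ =>
    obtain ⟨h1, h2, h3, h4⟩ := pairs x φ.code 5 (by norm_num) (by norm_num)
    simp [Formula.code, eI, h1, h2, h4]
  | allSet x φ =>
    obtain ⟨h1, h2, h3, h4⟩ := pairs x φ.code 6 (by norm_num) (by norm_num)
    simp [Formula.code, eS, h1, h2, h4]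

open Classical in
theorem hasInt : Primrec (fun q : ℕ × ℕ => Decidable.decide ((presTermOf q.2).HasInt q.1)) := by
  have or {τ : Type} [Primcodable τ] : Primrec (fun q : τ × Bool × Bool => q.2.1 || q.2.2) :=
    Primrec.or.comp (by fun_prop) (by fun_prop)
  have h : Primrec (fun q : ℕ × ℕ => Decidable.decide ((setTermOf q.2).HasInt q.1)) ∧
      Primrec (fun q : ℕ × ℕ => Decidable.decide ((intTermOf q.2).HasInt q.1)) := by
    refine termFold (fS := fun x s => Decidable.decide (s.HasInt x))
      (fT := fun x t => Decidable.decide (t.HasInt x)) (sE := fun _ => false) (sV := fun _ => false)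
      (sS := fun q => q.2) (iC := fun _ => false)
      (iV := fun q => Decidable.decide (q.2 = q.1)) (iMin := fun q => q.2)
      (iMax := fun q => q.2) (by fun_prop) (by fun_prop) (by fun_prop) or or or (by fun_prop)
      (by fun_prop) (by fun_prop) (by fun_prop) ?_ ?_ ?_ ?_ ?_ ?_ ?_ ?_ ?_ ?_ <;> intros <;>
    exact decide_eq_of_iff (by simp [SetTerm.HasInt, IntTerm.HasInt])
  refine presFold (f := fun x p => Decidable.decide (p.HasInt x)) h.2 or or ?_ ?_ ?_ <;> intros <;>
  exact decide_eq_of_iff (by simp [PresTerm.HasInt])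

open Classical in
theorem hasSet : Primrec (fun q : ℕ × ℕ => Decidable.decide ((presTermOf q.2).HasSet q.1)) := by
  have or {τ : Type} [Primcodable τ] : Primrec (fun q : τ × Bool × Bool => q.2.1 || q.2.2) :=
    Primrec.or.comp (by fun_prop) (by fun_prop)
  have h : Primrec (fun q : ℕ × ℕ => Decidable.decide ((setTermOf q.2).HasSet q.1)) ∧
      Primrec (fun q : ℕ × ℕ => Decidable.decide ((intTermOf q.2).HasSet q.1)) := by
    refine termFold (fS := fun x s => Decidable.decide (s.HasSet x))
      (fT := fun x t => Decidable.decide (t.HasSet x)) (sE := fun _ => false)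
      (sV := fun q => Decidable.decide (q.2 = q.1))
      (sS := fun q => q.2) (iC := fun _ => false) (iV := fun _ => false) (iMin := fun q => q.2)
      (iMax := fun q => q.2) (by fun_prop) (by fun_prop) (by fun_prop) or or or (by fun_prop)
      (by fun_prop) (by fun_prop) (by fun_prop) ?_ ?_ ?_ ?_ ?_ ?_ ?_ ?_ ?_ ?_ <;> intros <;>
    exact decide_eq_of_iff (by simp [SetTerm.HasSet, IntTerm.HasSet])
  refine presFold (f := fun x p => Decidable.decide (p.HasSet x)) h.2 or or ?_ ?_ ?_ <;> intros <;>
  exact decide_eq_of_iff (by simp [PresTerm.HasSet])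

end PR

theorem presAtom_code_div {r : IntRel} {p : PresTerm} :
    (Formula.presAtom r p).code / 7 / 3 = p.code ∧ (Formula.presAtom r p).code / 7 % 3 = r.code ∧
      (Formula.presAtom r p).code % 7 = 2 := by
  have := r.code_lt
  simp only [Formula.code]
  omega

theorem setAtom_code_mod {r : SetRel} {s t : SetTerm} :
    (Formula.setAtom r s t).code / 7 / 5 = Nat.pair s.code t.code ∧
      (Formula.setAtom r s t).code / 7 % 5 = r.code ∧ (Formula.setAtom r s t).code % 7 = 0 := by
  have := r.code_lt
  simp only [Formula.code]
  omega

theorem diffAtom_code_mod {r : IntRel} {s t : IntTerm} {c : ℤ} :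
    (Formula.diffAtom r s t c).code / 7 / 3 =
      Nat.pair s.code (Nat.pair t.code (Equiv.intEquivNat c)) ∧
      (Formula.diffAtom r s t c).code / 7 % 3 = r.code ∧
      (Formula.diffAtom r s t c).code % 7 = 1 := by
  have := r.code_lt
  simp only [Formula.code]
  omega

namespace PR

open Classical in
theorem presAvoidsInt :
    Primrec (fun q : ℕ × ℕ => Decidable.decide ((formulaOf q.2).PresAvoidsInt q.1)) := by
  have hb : Primrec (fun q : ℕ × ℕ => Decidable.decide
      (¬ (q.2 % 7 = 2 ∧ Decidable.decide ((presTermOf (q.2 / 7 / 3)).HasInt q.1) = true))) := by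
    have := hasInt.comp (f := fun q : ℕ × ℕ => Decidable.decide ((presTermOf q.2).HasInt q.1))
      (g := fun q : ℕ × ℕ => (q.1, q.2 / 7 / 3)) (by fun_prop)
    fun_prop
  refine formulaFold (f := fun x φ => Decidable.decide (φ.PresAvoidsInt x))
    (gA := fun q => q.2.1 && q.2.2) (gN := fun q => q.2)
    (gI := fun q => Decidable.decide (q.2.1 = q.1) || q.2.2.2) (gS := fun q => q.2.2.2)
    hb (Primrec.and.comp (by fun_prop) (by fun_prop)) (by fun_prop)
    (Primrec.or.comp (by fun_prop) (by fun_prop)) (by fun_prop) ?_ ?_ ?_ ?_ ?_ ?_ ?_ <;>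
  intros <;>
  exact decide_eq_of_iff (by
    simp [Formula.PresAvoidsInt, setAtom_code_mod, diffAtom_code_mod, presAtom_code_div])

open Classical in
theorem presAvoidsSet :
    Primrec (fun q : ℕ × ℕ => Decidable.decide ((formulaOf q.2).PresAvoidsSet q.1)) := by
  have hb : Primrec (fun q : ℕ × ℕ => Decidable.decide
      (¬ (q.2 % 7 = 2 ∧ Decidable.decide ((presTermOf (q.2 / 7 / 3)).HasSet q.1) = true))) := by
    have := hasSet.comp (f := fun q : ℕ × ℕ => Decidable.decide ((presTermOf q.2).HasSet q.1))
      (g := fun q : ℕ × ℕ => (q.1, q.2 / 7 / 3)) (by fun_prop)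
    fun_prop
  refine formulaFold (f := fun x φ => Decidable.decide (φ.PresAvoidsSet x))
    (gA := fun q => q.2.1 && q.2.2) (gN := fun q => q.2)
    (gI := fun q => q.2.2.2) (gS := fun q => Decidable.decide (q.2.1 = q.1) || q.2.2.2)
    hb (Primrec.and.comp (by fun_prop) (by fun_prop)) (by fun_prop)
    (by fun_prop) (Primrec.or.comp (by fun_prop) (by fun_prop)) ?_ ?_ ?_ ?_ ?_ ?_ ?_ <;>
  intros <;>
  exact decide_eq_of_iff (by
    simp [Formula.PresAvoidsSet, setAtom_code_mod, diffAtom_code_mod, presAtom_code_div])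

open Classical in
theorem isRQSPA :
    Primrec (fun n : ℕ => Decidable.decide ((formulaOf n).IsRQSPA)) := by
  have hI := presAvoidsInt.comp (g := fun q : Unit × ℕ × ℕ × Bool => (q.2.1, q.2.2.1))
    (by fun_prop)
  have hS := presAvoidsSet.comp (g := fun q : Unit × ℕ × ℕ × Bool => (q.2.1, q.2.2.1))
    (by fun_prop)
  have : Primrec (fun q : Unit × ℕ => Decidable.decide ((formulaOf q.2).IsRQSPA)) := by
    refine formulaFold (f := fun _ φ => Decidable.decide φ.IsRQSPA)
      (b := fun _ => true) (gA := fun q => q.2.1 && q.2.2) (gN := fun q => q.2)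
      (gI := fun q => Decidable.decide ((formulaOf q.2.2.1).PresAvoidsInt q.2.1) && q.2.2.2)
      (gS := fun q => Decidable.decide ((formulaOf q.2.2.1).PresAvoidsSet q.2.1) && q.2.2.2)
      (by fun_prop) (Primrec.and.comp (by fun_prop) (by fun_prop)) (by fun_prop)
      (Primrec.and.comp hI (by fun_prop)) (Primrec.and.comp hS (by fun_prop))
      ?_ ?_ ?_ ?_ ?_ ?_ ?_ <;> intros <;>
    exact decide_eq_of_iff (by simp [Formula.IsRQSPA])
  exact this.comp (g := fun n : ℕ => ((), n)) (by fun_prop)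

end PR

/-! ### Evaluation in finite environments -/

/-- The integers of absolute value at most `W`, listed in the order of their codes. -/
def intWindow (W : ℕ) : List ℤ := (List.range (2 * W + 1)).map Equiv.intEquivNat.symm

theorem mem_intWindow {W : ℕ} {n : ℤ} : n ∈ intWindow W ↔ |n| ≤ W := by
  have h : n ∈ intWindow W ↔ Equiv.intEquivNat n < 2 * W + 1 := by
    rw [intWindow, List.mem_map]
    constructor
    · rintro ⟨k, hk, rfl⟩
      simpa using hk
    · exact fun h => ⟨_, List.mem_range.2 h, Equiv.symm_apply_apply _ _⟩
  rw [h]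
  cases n with
  | ofNat n =>
    rw [show Equiv.intEquivNat (Int.ofNat n) = 2 * n from rfl, Int.ofNat_eq_natCast,
      abs_of_nonneg (by omega)]
    omega
  | negSucc n =>
    rw [show Equiv.intEquivNat (Int.negSucc n) = 2 * n + 1 from rfl, Int.negSucc_eq,
      abs_of_neg (by omega)]
    omega

/-- Lists for the finite sets of integers of absolute value at most `W`; a list also stands for
the integer that is its head. -/
def valueLists (W : ℕ) : List (List ℤ) := (intWindow W).sublists'

theorem valueLists_subset {W W' : ℕ} (h : W ≤ W') : valueLists W ⊆ valueLists W' := fun l hl => by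
  rw [valueLists, List.mem_sublists'] at hl ⊢
  refine hl.trans (List.Sublist.map _ ?_)
  exact List.range_sublist.2 (by omega)

theorem abs_le_of_mem_valueLists {W : ℕ} {l : List ℤ} (hl : l ∈ valueLists W) {n : ℤ}
    (hn : n ∈ l) : |n| ≤ W :=
  mem_intWindow.1 ((List.mem_sublists'.1 hl).subset hn)

theorem abs_headI_le_of_mem_valueLists {W : ℕ} {l : List ℤ} (hl : l ∈ valueLists W) :
    |l.headI| ≤ W := by
  cases l with
  | nil => simp
  | cons a l => exact abs_le_of_mem_valueLists hl (by simp)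

theorem exists_mem_valueLists_headI {W : ℕ} {n : ℤ} (hn : |n| ≤ W) :
    ∃ l ∈ valueLists W, l.headI = n :=
  ⟨[n], List.mem_sublists'.2 (List.singleton_sublist.2 (mem_intWindow.2 hn)), rfl⟩

theorem exists_mem_valueLists_toFinset {W : ℕ} {A : Finset ℤ} (hA : ∀ p ∈ A, |p| ≤ W) :
    ∃ l ∈ valueLists W, l.toFinset = A := by
  refine ⟨(intWindow W).filter (· ∈ A), List.mem_sublists'.2 List.filter_sublist, ?_⟩
  ext p
  simp only [List.mem_toFinset, List.mem_filter, decide_eq_true_eq, mem_intWindow]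
  exact ⟨fun h => h.2, fun h => ⟨hA p h, h⟩⟩

/-- The integer assignment of an environment: entry `2 * x` stands for the variable `x`. -/
def envInt (e : List (List ℤ)) (x : ℕ) : ℤ := (e.getD (2 * x) []).headI

/-- The set assignment of an environment: entry `2 * S + 1` stands for the variable `S`. -/
def envSet (e : List (List ℤ)) (S : ℕ) : Finset ℤ := (e.getD (2 * S + 1) []).toFinset

/-- The environment `e`, cut or padded to length `k`, with entry `i` replaced by `l`. -/
def envUpdate (k : ℕ) (e : List (List ℤ)) (i : ℕ) (l : List ℤ) : List (List ℤ) :=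
  (List.range k).map fun j => if j = i then l else e.getD j []

theorem length_envUpdate {k : ℕ} {e : List (List ℤ)} {i : ℕ} {l : List ℤ} :
    (envUpdate k e i l).length = k := by simp [envUpdate]

theorem getD_envUpdate {k : ℕ} {e : List (List ℤ)} {i : ℕ} {l : List ℤ} (he : e.length = k)
    (hi : i < k) (j : ℕ) : (envUpdate k e i l).getD j [] = if j = i then l else e.getD j [] := by
  by_cases hj : j < k
  · simp [envUpdate, List.getD_eq_getElem?_getD, hj]
  · rw [List.getD_eq_default _ _ (by rw [length_envUpdate]; omega), if_neg (by omega),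
      List.getD_eq_default _ _ (by omega)]

theorem envInt_envUpdate_int {k : ℕ} {e : List (List ℤ)} {x : ℕ} {l : List ℤ} (he : e.length = k)
    (hx : 2 * x < k) :
    envInt (envUpdate k e (2 * x) l) = Function.update (envInt e) x l.headI := by
  funext y
  rw [envInt, getD_envUpdate he hx, Function.update_apply, envInt]
  by_cases h : y = x <;> simp [h]

theorem envSet_envUpdate_int {k : ℕ} {e : List (List ℤ)} {x : ℕ} {l : List ℤ} (he : e.length = k)
    (hx : 2 * x < k) : envSet (envUpdate k e (2 * x) l) = envSet e := by
  funext y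
  rw [envSet, getD_envUpdate he hx, if_neg (by omega), envSet]

theorem envInt_envUpdate_set {k : ℕ} {e : List (List ℤ)} {x : ℕ} {l : List ℤ} (he : e.length = k)
    (hx : 2 * x + 1 < k) : envInt (envUpdate k e (2 * x + 1) l) = envInt e := by
  funext y
  rw [envInt, getD_envUpdate he hx, if_neg (by omega), envInt]

theorem envSet_envUpdate_set {k : ℕ} {e : List (List ℤ)} {x : ℕ} {l : List ℤ} (he : e.length = k)
    (hx : 2 * x + 1 < k) :
    envSet (envUpdate k e (2 * x + 1) l) = Function.update (envSet e) x l.toFinset := by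
  funext y
  rw [envSet, getD_envUpdate he hx, Function.update_apply, envSet]
  by_cases h : y = x <;> simp [h]

/-- All lists of length `k` with entries in `vals`. -/
def tuples (vals : List (List ℤ)) (k : ℕ) : List (List (List ℤ)) :=
  Nat.rec [[]] (fun _ E => E.flatMap fun e => vals.map fun l => l :: e) k

theorem mem_tuples {vals : List (List ℤ)} {k : ℕ} {e : List (List ℤ)} :
    e ∈ tuples vals k ↔ e.length = k ∧ ∀ l ∈ e, l ∈ vals := by
  induction k generalizing e with
  | zero =>
    change e ∈ [[]] ↔ _
    simp only [List.mem_singleton, List.length_eq_zero_iff]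
    exact ⟨fun h => ⟨h, by simp [h]⟩, fun h => h.1⟩
  | succ k ih =>
    change e ∈ (tuples vals k).flatMap _ ↔ _
    cases e with
    | nil => simp
    | cons l e =>
      simp only [List.mem_flatMap, List.mem_map, List.cons.injEq, List.length_cons,
        Nat.add_right_cancel_iff, List.forall_mem_cons]
      constructor
      · rintro ⟨e', he', l', hl', rfl, rfl⟩
        exact ⟨(ih.1 he').1, hl', (ih.1 he').2⟩
      · rintro ⟨h1, h2, h3⟩
        exact ⟨e, ih.2 ⟨h1, h3⟩, l, h2, rfl, rfl⟩

/-- Every bounded assignment agrees on the first `N + 1` variables with an environment. -/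
theorem exists_mem_tuples {N W : ℕ} {v : ℕ → ℤ} {V : ℕ → Finset ℤ} (h : Bounded v V W) :
    ∃ e ∈ tuples (valueLists W) (2 * N + 2),
      (∀ x ≤ N, v x = envInt e x) ∧ ∀ S ≤ N, V S = envSet e S := by
  choose f hf hf' using fun x => exists_mem_valueLists_headI (h.int x)
  choose g hg hg' using fun S => exists_mem_valueLists_toFinset (h.set S)
  let c : ℕ → List ℤ := fun j => if j % 2 = 0 then f (j / 2) else g (j / 2)
  have key : ∀ j < 2 * N + 2, ((List.range (2 * N + 2)).map c).getD j [] = c j := fun j hj => by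
    simp [List.getD_eq_getElem?_getD, hj]
  refine ⟨(List.range (2 * N + 2)).map c, mem_tuples.2 ⟨by simp, ?_⟩, fun x hx => ?_,
    fun S hS => ?_⟩
  · intro l hl
    obtain ⟨j, -, rfl⟩ := List.mem_map.1 hl
    dsimp only [c]
    split_ifs
    exacts [hf _, hg _]
  · rw [envInt, key _ (by omega)]
    simp [c, hf']
  · rw [envSet, key _ (by omega)]
    simp only [c]
    rw [if_neg (by omega), show (2 * S + 1) / 2 = S by omega, hg']

theorem bounded_env {e : List (List ℤ)} {k W : ℕ} (he : e ∈ tuples (valueLists W) k) :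
    Bounded (envInt e) (envSet e) W := by
  have key : ∀ j, e.getD j [] ∈ valueLists W := fun j => by
    by_cases hj : j < e.length
    · rw [List.getD_eq_getElem _ _ hj]
      exact (mem_tuples.1 he).2 _ (List.getElem_mem hj)
    · rw [List.getD_eq_default _ _ (by omega)]
      exact List.mem_sublists'.2 (List.nil_sublist _)
  exact ⟨fun x => abs_headI_le_of_mem_valueLists (key _),
    fun S p hp => abs_le_of_mem_valueLists (key _) (List.mem_toFinset.1 hp)⟩

theorem envUpdate_mem_tuples {vals : List (List ℤ)} {k : ℕ} {e : List (List ℤ)} {i : ℕ}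
    {l : List ℤ} (he : e ∈ tuples vals k) (hl : l ∈ vals) :
    envUpdate k e i l ∈ tuples vals k := by
  refine mem_tuples.2 ⟨length_envUpdate, fun m hm => ?_⟩
  obtain ⟨j, hj, rfl⟩ := List.mem_map.1 hm
  split_ifs
  · exact hl
  · rw [List.mem_range, ← (mem_tuples.1 he).1] at hj
    rw [List.getD_eq_getElem _ _ hj]
    exact (mem_tuples.1 he).2 _ (List.getElem_mem hj)

/-- The minimum of a list of integers, undefined for the empty list. -/
def listMin (l : List ℤ) : Option ℤ := (l.filter fun a => ∀ b ∈ l, a ≤ b).head?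

/-- The maximum of a list of integers, undefined for the empty list. -/
def listMax (l : List ℤ) : Option ℤ := (l.filter fun a => ∀ b ∈ l, b ≤ a).head?

theorem minVal_toFinset (l : List ℤ) : minVal l.toFinset = listMin l := by
  unfold minVal
  split_ifs with h
  · have hm : (l.toFinset.min' h) ∈ l.filter fun a => ∀ b ∈ l, a ≤ b := by
      simpa using ⟨List.mem_toFinset.1 (l.toFinset.min'_mem h), fun b hb =>
        l.toFinset.min'_le b (List.mem_toFinset.2 hb)⟩
    cases hs : listMin l with
    | none => rw [List.head?_eq_none_iff.1 hs] at hm; simp at hm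
    | some n =>
      have hn := List.mem_of_mem_head? hs
      simp only [List.mem_filter, decide_eq_true_eq] at hm hn
      exact congrArg _ (le_antisymm (hm.2 _ hn.1) (hn.2 _ hm.1))
  · obtain rfl : l = [] := by simpa using h
    rfl

theorem maxVal_toFinset (l : List ℤ) : maxVal l.toFinset = listMax l := by
  unfold maxVal
  split_ifs with h
  · have hm : (l.toFinset.max' h) ∈ l.filter fun a => ∀ b ∈ l, b ≤ a := by
      simpa using ⟨List.mem_toFinset.1 (l.toFinset.max'_mem h), fun b hb =>
        l.toFinset.le_max' b (List.mem_toFinset.2 hb)⟩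
    cases hs : listMax l with
    | none => rw [List.head?_eq_none_iff.1 hs] at hm; simp at hm
    | some n =>
      have hn := List.mem_of_mem_head? hs
      simp only [List.mem_filter, decide_eq_true_eq] at hm hn
      exact congrArg _ (le_antisymm (hn.2 _ hm.1) (hm.2 _ hn.1))
  · obtain rfl : l = [] := by simpa using h
    rfl

mutual
/-- The value of a set term in an environment, as a list. -/
def SetTerm.evalEnv (e : List (List ℤ)) : SetTerm → Option (List ℤ)
  | .empty => some []
  | .var S => some (e.getD (2 * S + 1) [])
  | .single t => (t.evalEnv e).bind fun n => some [n]
  | .union s t => (s.evalEnv e).bind fun A => (t.evalEnv e).bind fun B => some (A ++ B)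
  | .inter s t =>
      (s.evalEnv e).bind fun A => (t.evalEnv e).bind fun B => some (A.filter fun a => a ∈ B)
  | .diff s t =>
      (s.evalEnv e).bind fun A => (t.evalEnv e).bind fun B => some (A.filter fun a => ¬ a ∈ B)

/-- The value of an integer term in an environment. -/
def IntTerm.evalEnv (e : List (List ℤ)) : IntTerm → Option ℤ
  | .const c => some c
  | .var x => some (e.getD (2 * x) []).headI
  | .min s => (s.evalEnv e).bind listMin
  | .max s => (s.evalEnv e).bind listMax
end

mutual
theorem SetTerm.eval_env (e : List (List ℤ)) :
    ∀ s : SetTerm, s.eval (envInt e) (envSet e) = (s.evalEnv e).map List.toFinset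
  | .empty => rfl
  | .var S => rfl
  | .single t => by
      rw [SetTerm.eval, SetTerm.evalEnv, t.eval_env e]
      cases t.evalEnv e <;> rfl
  | .union s t => by
      rw [SetTerm.eval, SetTerm.evalEnv, s.eval_env e, t.eval_env e]
      cases s.evalEnv e <;> cases t.evalEnv e <;> simp
  | .inter s t => by
      rw [SetTerm.eval, SetTerm.evalEnv, s.eval_env e, t.eval_env e]
      cases s.evalEnv e <;> cases t.evalEnv e <;> simp
      ext; simp
  | .diff s t => by
      rw [SetTerm.eval, SetTerm.evalEnv, s.eval_env e, t.eval_env e]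
      cases s.evalEnv e <;> cases t.evalEnv e <;> simp
      ext; simp

theorem IntTerm.eval_env (e : List (List ℤ)) :
    ∀ t : IntTerm, t.eval (envInt e) (envSet e) = t.evalEnv e
  | .const c => rfl
  | .var x => rfl
  | .min s => by
      rw [IntTerm.eval, IntTerm.evalEnv, s.eval_env e]
      cases s.evalEnv e <;> simp [minVal_toFinset]
  | .max s => by
      rw [IntTerm.eval, IntTerm.evalEnv, s.eval_env e]
      cases s.evalEnv e <;> simp [maxVal_toFinset]
end

/-- The set comparison with code `r` between the sets of elements of two lists. -/
def setCompare (r : ℕ) (A B : List ℤ) : Prop :=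
  (r = 0 ∧ (∀ a ∈ A, a ∈ B) ∧ ∀ b ∈ B, b ∈ A) ∨ (r = 1 ∧ ∀ a ∈ A, a ∈ B) ∨
    (r = 2 ∧ ∀ b ∈ B, b ∈ A) ∨ (r = 3 ∧ (∀ a ∈ A, a ∈ B) ∧ ¬ ∀ b ∈ B, b ∈ A) ∨
    (r = 4 ∧ (∀ b ∈ B, b ∈ A) ∧ ¬ ∀ a ∈ A, a ∈ B)

theorem SetRel.holds_toFinset (r : SetRel) (A B : List ℤ) :
    r.Holds A.toFinset B.toFinset ↔ setCompare r.code A B := by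
  cases r <;>
  simp [SetRel.Holds, setCompare, SetRel.code, ssubset_iff_subset_not_subset,
    Finset.Subset.antisymm_iff, Finset.subset_iff]

/-- The integer comparison with code `r`. -/
def intCompare (r : ℕ) (m n : ℤ) : Prop := (r = 0 ∧ m = n) ∨ (r = 1 ∧ m ≤ n) ∨ (r = 2 ∧ n ≤ m)

theorem IntRel.holds_iff (r : IntRel) (m n : ℤ) : r.Holds m n ↔ intCompare r.code m n := by
  cases r <;> simp [IntRel.Holds, intCompare, IntRel.code]

open Classical in
/-- The truth value in an environment of the atomic formula with code `n`, undefined when a term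
is undefined. -/
noncomputable def atomValue (e : List (List ℤ)) (n : ℕ) : Option Bool :=
  if n % 7 = 0 then
    ((setTermOf (n / 7 / 5).unpair.1).evalEnv e).bind fun A =>
      ((setTermOf (n / 7 / 5).unpair.2).evalEnv e).bind fun B =>
        some (decide (setCompare (n / 7 % 5) A B))
  else if n % 7 = 1 then
    ((intTermOf (n / 7 / 3).unpair.1).evalEnv e).bind fun a =>
      ((intTermOf (n / 7 / 3).unpair.2.unpair.1).evalEnv e).bind fun b =>
        some (decide (intCompare (n / 7 % 3) a
          (b + Equiv.intEquivNat.symm (n / 7 / 3).unpair.2.unpair.2)))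
  else
    ((presTermOf (n / 7 / 3)).eval (envInt e) (envSet e)).bind fun a =>
      some (decide (intCompare (n / 7 % 3) a 0))

theorem atomValue_setAtom {e : List (List ℤ)} {r : SetRel} {s t : SetTerm} :
    atomValue e (Formula.setAtom r s t).code = some true ↔
      (Formula.setAtom r s t).Holds (envInt e) (envSet e) := by
  obtain ⟨h1, h2, h3⟩ := setAtom_code_mod (r := r) (s := s) (t := t)
  rw [atomValue, if_pos h3, h1, h2, Nat.unpair_pair, setTermOf_code, setTermOf_code, Formula.Holds,
    s.eval_env, t.eval_env]
  cases s.evalEnv e <;> cases t.evalEnv e <;> simp [SetRel.holds_toFinset]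

theorem atomValue_diffAtom {e : List (List ℤ)} {r : IntRel} {s t : IntTerm} {c : ℤ} :
    atomValue e (Formula.diffAtom r s t c).code = some true ↔
      (Formula.diffAtom r s t c).Holds (envInt e) (envSet e) := by
  obtain ⟨h1, h2, h3⟩ := diffAtom_code_mod (r := r) (s := s) (t := t) (c := c)
  rw [atomValue, if_neg (by omega), if_pos h3, h1, h2, Nat.unpair_pair, Nat.unpair_pair,
    intTermOf_code, intTermOf_code, Equiv.symm_apply_apply, Formula.Holds, s.eval_env, t.eval_env]
  cases s.evalEnv e <;> cases t.evalEnv e <;> simp [IntRel.holds_iff]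

theorem atomValue_presAtom {e : List (List ℤ)} {r : IntRel} {p : PresTerm} :
    atomValue e (Formula.presAtom r p).code = some true ↔
      (Formula.presAtom r p).Holds (envInt e) (envSet e) := by
  obtain ⟨h1, h2, h3⟩ := presAtom_code_div (r := r) (p := p)
  rw [atomValue, if_neg (by omega), if_neg (by omega), h1, h2, presTermOf_code, Formula.Holds]
  cases p.eval (envInt e) (envSet e) <;> simp [IntRel.holds_iff]

/-! ### Evaluation with bounded quantifiers -/

/-- The bound on the values below `i` nested quantifiers, for a formula whose code is at most
`N`. -/
def nestedBound (N i : ℕ) : ℕ := (i + 1) * (modelBound N + tower (2 * N + 20))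

theorem nestedBound_mono {N i j : ℕ} (h : i ≤ j) : nestedBound N i ≤ nestedBound N j :=
  Nat.mul_le_mul_right _ (by omega)

theorem nestedBound_add_tower_le {N n i : ℕ} (h : n ≤ N) :
    nestedBound N i + tower (2 * n + 20) ≤ nestedBound N (i + 1) := by
  have := tower_mono (show 2 * n + 20 ≤ 2 * N + 20 by omega)
  unfold nestedBound
  rw [add_mul (i + 1)]
  omega

/-- Truth of a formula in an environment of length `2 * N + 2` when the quantifiers range over
windows only. The window of a quantifier is determined by the code of the quantified formula:
codes decrease towards subformulas, so each window exceeds the windows of the quantifiers around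
it. -/
def Formula.HoldsEnv (N : ℕ) : Formula → List (List ℤ) → Prop
  | .setAtom r s t, e => (Formula.setAtom r s t).Holds (envInt e) (envSet e)
  | .diffAtom r t u c, e => (Formula.diffAtom r t u c).Holds (envInt e) (envSet e)
  | .presAtom r p, e => (Formula.presAtom r p).Holds (envInt e) (envSet e)
  | .and φ ψ, e => φ.HoldsEnv N e ∧ ψ.HoldsEnv N e
  | .neg φ, e => ¬ φ.HoldsEnv N e
  | .allInt x φ, e => ∀ l ∈ valueLists (nestedBound N (N + 1 - (7 * Nat.pair x φ.code + 5))),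
      φ.HoldsEnv N (envUpdate (2 * N + 2) e (2 * x) l)
  | .allSet S φ, e => ∀ l ∈ valueLists (nestedBound N (N + 1 - (7 * Nat.pair S φ.code + 6))),
      φ.HoldsEnv N (envUpdate (2 * N + 2) e (2 * S + 1) l)

/-- Bounding the quantifiers does not change the truth of an RQSPA formula with code at most `N`, in
an environment within the window of the formula. -/
theorem Formula.holdsEnv_iff {N : ℕ} : ∀ (φ : Formula) {e : List (List ℤ)}, φ.IsRQSPA →
    φ.code ≤ N → e.length = 2 * N + 2 →
    Bounded (envInt e) (envSet e) (nestedBound N (N - φ.code)) →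
    (φ.HoldsEnv N e ↔ φ.Holds (envInt e) (envSet e))
  | .setAtom r s t, e, _, _, _, _ => Iff.rfl
  | .diffAtom r t u c, e, _, _, _, _ => Iff.rfl
  | .presAtom r p, e, _, _, _, _ => Iff.rfl
  | .and φ ψ, e, hφ, hN, he, hb => by
      have h3 := Nat.left_le_pair φ.code ψ.code
      have h4 := Nat.right_le_pair φ.code ψ.code
      simp only [Formula.code] at hN hb
      exact and_congr
        (φ.holdsEnv_iff hφ.1 (by omega) he (hb.mono (nestedBound_mono (by omega))))
        (ψ.holdsEnv_iff hφ.2 (by omega) he (hb.mono (nestedBound_mono (by omega))))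
  | .neg φ, e, hφ, hN, he, hb => by
      simp only [Formula.code] at hN hb
      exact not_congr (φ.holdsEnv_iff hφ (by omega) he (hb.mono (nestedBound_mono (by omega))))
  | .allInt x φ, e, hφ, hN, he, hb => by
      have h3 := Nat.left_le_pair x φ.code
      have h4 := Nat.right_le_pair x φ.code
      simp only [Formula.code] at hN hb
      have hi : 2 * x < 2 * N + 2 := by omega
      have hW := nestedBound_add_tower_le (N := N) (n := φ.code)
        (i := N - (7 * Nat.pair x φ.code + 5)) (by omega)
      rw [← Nat.sub_add_comm hN] at hW
      have ih : ∀ n : ℤ, |n| ≤ nestedBound N (N + 1 - (7 * Nat.pair x φ.code + 5)) → ∀ l,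
          l.headI = n → (φ.HoldsEnv N (envUpdate (2 * N + 2) e (2 * x) l) ↔
            φ.Holds (Function.update (envInt e) x n) (envSet e)) := fun n hn l hl => by
        rw [φ.holdsEnv_iff hφ.2 (by omega) length_envUpdate, envInt_envUpdate_int he hi,
          envSet_envUpdate_int he hi, hl]
        rw [envInt_envUpdate_int he hi, envSet_envUpdate_int he hi, hl]
        exact (hb.update_int (by omega) x hn).mono (nestedBound_mono (by omega))
      rw [Formula.allInt_holds_iff_bounded hφ hb hW, Formula.HoldsEnv]
      constructor
      · intro H n hn
        obtain ⟨l, hl, hl'⟩ := exists_mem_valueLists_headI hn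
        exact (ih n hn l hl').1 (H l hl)
      · exact fun H l hl => (ih _ (abs_headI_le_of_mem_valueLists hl) l rfl).2
          (H _ (abs_headI_le_of_mem_valueLists hl))
  | .allSet x φ, e, hφ, hN, he, hb => by
      have h3 := Nat.left_le_pair x φ.code
      have h4 := Nat.right_le_pair x φ.code
      simp only [Formula.code] at hN hb
      have hi : 2 * x + 1 < 2 * N + 2 := by omega
      have hW := nestedBound_add_tower_le (N := N) (n := φ.code)
        (i := N - (7 * Nat.pair x φ.code + 6)) (by omega)
      rw [← Nat.sub_add_comm hN] at hW
      have ih : ∀ A : Finset ℤ,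
          (∀ p ∈ A, |p| ≤ nestedBound N (N + 1 - (7 * Nat.pair x φ.code + 6))) → ∀ l,
          l.toFinset = A → (φ.HoldsEnv N (envUpdate (2 * N + 2) e (2 * x + 1) l) ↔
            φ.Holds (envInt e) (Function.update (envSet e) x A)) := fun A hA l hl => by
        rw [φ.holdsEnv_iff hφ.2 (by omega) length_envUpdate, envInt_envUpdate_set he hi,
          envSet_envUpdate_set he hi, hl]
        rw [envInt_envUpdate_set he hi, envSet_envUpdate_set he hi, hl]
        exact (hb.update_set (by omega) x hA).mono (nestedBound_mono (by omega))
      rw [Formula.allSet_holds_iff_bounded hφ hb hW, Formula.HoldsEnv]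
      constructor
      · intro H A hA
        obtain ⟨l, hl, hl'⟩ := exists_mem_valueLists_toFinset hA
        exact (ih A hA l hl').1 (H l hl)
      · intro H l hl
        have hA : ∀ p ∈ l.toFinset, |p| ≤ _ := fun p hp =>
          abs_le_of_mem_valueLists hl (List.mem_toFinset.1 hp)
        exact (ih _ hA l rfl).2 (H _ hA)

namespace PR

variable {α : Type} [Primcodable α]

/-! ### The decision procedure -/

@[fun_prop] theorem intWindow {f : α → ℕ} (hf : Primrec f) :
    Primrec (fun a => intWindow (f a)) := by
  unfold RQSPA.intWindow
  fun_prop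

@[fun_prop] theorem valueLists {f : α → ℕ} (hf : Primrec f) :
    Primrec (fun a => valueLists (f a)) :=
  sublists'.comp (intWindow hf)

@[fun_prop] theorem envUpdate {k i : α → ℕ} {e : α → List (List ℤ)} {l : α → List ℤ}
    (hk : Primrec k) (he : Primrec e) (hi : Primrec i) (hl : Primrec l) :
    Primrec (fun a => envUpdate (k a) (e a) (i a) (l a)) := by
  unfold RQSPA.envUpdate
  fun_prop

@[fun_prop] theorem tuples {vals : α → List (List ℤ)} {k : α → ℕ} (hv : Primrec vals)
    (hk : Primrec k) : Primrec (fun a => tuples (vals a) (k a)) :=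
  natRec (g := fun _ => [[]])
    (h := fun a _ E => E.flatMap fun e => (vals a).map fun l => l :: e) hk (by fun_prop)
    (by fun_prop)

@[fun_prop] theorem nestedBound {f g : α → ℕ} (hf : Primrec f) (hg : Primrec g) :
    Primrec (fun a => nestedBound (f a) (g a)) :=
  natMul (by fun_prop) (natAdd (modelBound hf) (tower (by fun_prop)))

@[fun_prop] theorem listMin {f : α → List ℤ} (hf : Primrec f) :
    Primrec (fun a => listMin (f a)) := by
  have : PrimrecPred (fun q : List ℤ × ℤ => ∀ b ∈ q.1, q.2 ≤ b) :=
    ball (L := fun q : List ℤ × ℤ => q.1) (p := fun q b => q.2 ≤ b) (by fun_prop) (by fun_prop)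
  have h : Primrec (fun l : List ℤ => RQSPA.listMin l) := by
    unfold RQSPA.listMin
    exact head? (filter (p := fun l a => ∀ b ∈ l, a ≤ b) (by fun_prop) this)
  exact h.comp hf

@[fun_prop] theorem listMax {f : α → List ℤ} (hf : Primrec f) :
    Primrec (fun a => listMax (f a)) := by
  have : PrimrecPred (fun q : List ℤ × ℤ => ∀ b ∈ q.1, b ≤ q.2) :=
    ball (L := fun q : List ℤ × ℤ => q.1) (p := fun q b => b ≤ q.2) (by fun_prop) (by fun_prop)
  have h : Primrec (fun l : List ℤ => RQSPA.listMax l) := by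
    unfold RQSPA.listMax
    exact head? (filter (p := fun l a => ∀ b ∈ l, b ≤ a) (by fun_prop) this)
  exact h.comp hf

theorem termEval :
    Primrec (fun q : List (List ℤ) × ℕ => (setTermOf q.2).evalEnv q.1) ∧
      Primrec (fun q : List (List ℤ) × ℕ => (intTermOf q.2).evalEnv q.1) :=
  termFold (α := List (List ℤ)) (fS := fun e s => s.evalEnv e) (fT := fun e t => t.evalEnv e)
    (sE := fun _ => Option.some []) (sV := fun q => Option.some (q.1.getD (2 * q.2 + 1) []))
    (sS := fun q => q.2.bind fun n => Option.some [n])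
    (sU := fun q => q.2.1.bind fun A => q.2.2.bind fun B => Option.some (A ++ B))
    (sI := fun q => q.2.1.bind fun A => q.2.2.bind fun B =>
      Option.some (A.filter fun a => a ∈ B))
    (sD := fun q => q.2.1.bind fun A => q.2.2.bind fun B =>
      Option.some (A.filter fun a => ¬ a ∈ B))
    (iC := fun q => Option.some q.2) (iV := fun q => Option.some (q.1.getD (2 * q.2) []).headI)
    (iMin := fun q => q.2.bind RQSPA.listMin) (iMax := fun q => q.2.bind RQSPA.listMax)
    (by fun_prop) (by fun_prop) (by fun_prop) (by fun_prop) (by fun_prop) (by fun_prop)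
    (by fun_prop) (by fun_prop) (by fun_prop) (by fun_prop)
    (fun _ => rfl) (fun _ _ => rfl) (fun _ _ => rfl) (fun _ _ _ => rfl) (fun _ _ _ => rfl)
    (fun _ _ _ => rfl) (fun _ _ => rfl) (fun _ _ => rfl) (fun _ _ => rfl) (fun _ _ => rfl)

theorem presEval :
    Primrec (fun q : List (List ℤ) × ℕ => (presTermOf q.2).eval (envInt q.1) (envSet q.1)) := by
  have := termEval.2
  refine presFold (f := fun e p => p.eval (envInt e) (envSet e))
    (b := fun q => (intTermOf q.2).evalEnv q.1)
    (pA := fun q => q.2.1.bind fun m => q.2.2.bind fun n => Option.some (m + n))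
    (pS := fun q => q.2.1.bind fun m => q.2.2.bind fun n => Option.some (m - n))
    this (by fun_prop) (by fun_prop) (fun e t => ?_) (fun _ _ _ => rfl) (fun _ _ _ => rfl)
  rw [intTermOf_code, PresTerm.eval, t.eval_env]

@[fun_prop] theorem setCompare {r : α → ℕ} {A B : α → List ℤ} (hr : Primrec r) (hA : Primrec A)
    (hB : Primrec B) : PrimrecPred (fun a => setCompare (r a) (A a) (B a)) := by
  have h1 : PrimrecPred fun a => ∀ x ∈ A a, x ∈ B a :=
    ball (p := fun a x => x ∈ B a) hA (by fun_prop)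
  have h2 : PrimrecPred fun a => ∀ x ∈ B a, x ∈ A a :=
    ball (p := fun a x => x ∈ A a) hB (by fun_prop)
  unfold RQSPA.setCompare
  fun_prop

@[fun_prop] theorem intCompare {r : α → ℕ} {m n : α → ℤ} (hr : Primrec r) (hm : Primrec m)
    (hn : Primrec n) : PrimrecPred (fun a => intCompare (r a) (m a) (n a)) := by
  unfold RQSPA.intCompare
  fun_prop

theorem atomValue : Primrec (fun q : List (List ℤ) × ℕ => atomValue q.1 q.2) := by
  have h1 := fun {g : List (List ℤ) × ℕ → ℕ} (hg : Primrec g) =>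
    termEval.1.comp (g := fun q : List (List ℤ) × ℕ => (q.1, g q)) (by fun_prop)
  have h2 := fun {g : List (List ℤ) × ℕ → ℕ} (hg : Primrec g) =>
    termEval.2.comp (g := fun q : List (List ℤ) × ℕ => (q.1, g q)) (by fun_prop)
  have h3 := presEval.comp (g := fun q : List (List ℤ) × ℕ => (q.1, q.2 / 7 / 3)) (by fun_prop)
  have s1 := h1 (g := fun q => (q.2 / 7 / 5).unpair.1) (by fun_prop)
  have s2 := h1 (g := fun q => (q.2 / 7 / 5).unpair.2) (by fun_prop)
  have t1 := h2 (g := fun q => (q.2 / 7 / 3).unpair.1) (by fun_prop)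
  have t2 := h2 (g := fun q => (q.2 / 7 / 3).unpair.2.unpair.1) (by fun_prop)
  unfold RQSPA.atomValue
  refine Primrec.ite (by fun_prop) (optionBind s1 (optionBind (s2.comp Primrec.fst)
    (by fun_prop))) (Primrec.ite (by fun_prop) (optionBind t1 (optionBind (t2.comp Primrec.fst)
    (by fun_prop))) (optionBind h3 (by fun_prop)))

end PR

/-- All environments that can occur in the evaluation of a formula with code at most `N`. -/
def environments (N : ℕ) : List (List (List ℤ)) :=
  tuples (valueLists (nestedBound N (N + 1))) (2 * N + 2)

open Classical in
/-- The environments that satisfy a formula, with bounded quantifiers. -/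
noncomputable def Formula.table (N : ℕ) (φ : Formula) : List (List (List ℤ)) :=
  (environments N).filter (φ.HoldsEnv N)

theorem Formula.mem_table {N : ℕ} {φ : Formula} {e : List (List ℤ)} :
    e ∈ φ.table N ↔ e ∈ environments N ∧ φ.HoldsEnv N e := by
  classical
  simp [Formula.table]

namespace PR

variable {α : Type} [Primcodable α]

@[fun_prop] theorem environments {f : α → ℕ} (hf : Primrec f) :
    Primrec (fun a => environments (f a)) :=
  tuples (valueLists (nestedBound hf (by fun_prop))) (by fun_prop)

open Classical in
theorem quantifierTable {N i j : α → ℕ} {T : α → List (List (List ℤ))} (hN : Primrec N)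
    (hi : Primrec i) (hj : Primrec j) (hT : Primrec T) :
    Primrec (fun a => (RQSPA.environments (N a)).filter fun e =>
      ∀ l ∈ RQSPA.valueLists (RQSPA.nestedBound (N a) (N a + 1 - j a)),
        RQSPA.envUpdate (2 * N a + 2) e (i a) l ∈ T a) :=
  filter (environments hN) (ball (valueLists (nestedBound (by fun_prop) (by fun_prop)))
    (mem (by fun_prop) (envUpdate (by fun_prop) (by fun_prop) (by fun_prop) (by fun_prop))))

open Classical in
/-- The tables are computed by recursion on formulas: the environments that a quantifier asks for
occur among all environments, so it is decided by membership in the table of the quantified formula.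
-/
theorem table : Primrec (fun q : ℕ × ℕ => (formulaOf q.2).table q.1) := by
  have hb : PrimrecPred (fun q : (ℕ × ℕ) × List (List ℤ) =>
      RQSPA.atomValue q.2 q.1.2 = Option.some true) := by
    have := atomValue.comp (g := fun q : (ℕ × ℕ) × List (List ℤ) => (q.2, q.1.2)) (by fun_prop)
    fun_prop
  have hI := quantifierTable (α := ℕ × ℕ × ℕ × List (List (List ℤ))) (N := fun q => q.1)
    (i := fun q => 2 * q.2.1) (j := fun q => 7 * Nat.pair q.2.1 q.2.2.1 + 5)
    (T := fun q => q.2.2.2) (by fun_prop) (by fun_prop)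
    (natAdd (natMul (by fun_prop) (natPair (by fun_prop) (by fun_prop))) (by fun_prop))
    (by fun_prop)
  have hS := quantifierTable (α := ℕ × ℕ × ℕ × List (List (List ℤ))) (N := fun q => q.1)
    (i := fun q => 2 * q.2.1 + 1) (j := fun q => 7 * Nat.pair q.2.1 q.2.2.1 + 6)
    (T := fun q => q.2.2.2) (by fun_prop) (by fun_prop)
    (natAdd (natMul (by fun_prop) (natPair (by fun_prop) (by fun_prop))) (by fun_prop))
    (by fun_prop)
  have filter_eq : ∀ {N : ℕ} {p q : List (List ℤ) → Prop} [DecidablePred p] [DecidablePred q],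
      (∀ e ∈ RQSPA.environments N, p e ↔ q e) →
      (RQSPA.environments N).filter (fun e => Decidable.decide (p e)) =
        (RQSPA.environments N).filter (fun e => Decidable.decide (q e)) := fun h =>
    List.filter_congr fun e he => decide_eq_decide.2 (h e he)
  have upd : ∀ {N : ℕ} {φ : Formula} {e : List (List ℤ)} {i j : ℕ}, e ∈ RQSPA.environments N →
      ∀ l ∈ RQSPA.valueLists (RQSPA.nestedBound N (N + 1 - j)),
        (φ.HoldsEnv N (RQSPA.envUpdate (2 * N + 2) e i l) ↔
          RQSPA.envUpdate (2 * N + 2) e i l ∈ φ.table N) := fun he l hl => by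
    rw [Formula.mem_table, and_iff_right]
    exact envUpdate_mem_tuples he (valueLists_subset (nestedBound_mono (by omega)) hl)
  refine formulaFold (f := Formula.table)
    (b := fun q => (RQSPA.environments q.1).filter fun e =>
      RQSPA.atomValue e q.2 = Option.some true)
    (gA := fun q => (RQSPA.environments q.1).filter fun e => e ∈ q.2.1 ∧ e ∈ q.2.2)
    (gN := fun q => (RQSPA.environments q.1).filter fun e => ¬ e ∈ q.2)
    (filter (by fun_prop) hb) (by fun_prop) (by fun_prop) hI hS ?_ ?_ ?_ ?_ ?_ ?_
    ?_ <;> intros <;> refine filter_eq fun e he => ?_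
  · exact atomValue_setAtom.symm
  · exact atomValue_diffAtom.symm
  · exact atomValue_presAtom.symm
  · rw [Formula.mem_table, Formula.mem_table, and_iff_right he, and_iff_right he, Formula.HoldsEnv]
  · rw [Formula.mem_table, and_iff_right he, Formula.HoldsEnv]
  · rw [Formula.HoldsEnv]
    exact forall₂_congr (upd he)
  · rw [Formula.HoldsEnv]
    exact forall₂_congr (upd he)

end PR

/-- An RQSPA formula has a model if and only if its table contains an environment whose entries are
within the bound for small models. -/
theorem Formula.satisfiable_iff {φ : Formula} (hφ : φ.IsRQSPA) :
    φ.Satisfiable ↔ ∃ e ∈ tuples (valueLists (nestedBound φ.code 0)) (2 * φ.code + 2),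
      e ∈ φ.table φ.code := by
  constructor
  · intro h
    obtain ⟨v, V, hb, hv⟩ := Formula.exists_small_model hφ h
    have hle : modelBound φ.code ≤ nestedBound φ.code 0 := by
      unfold nestedBound
      omega
    obtain ⟨e, he, hvi, hvs⟩ := exists_mem_tuples (N := φ.code) (hb.mono hle)
    refine ⟨e, he, Formula.mem_table.2 ⟨?_, ?_⟩⟩
    · exact mem_tuples.2 ⟨(mem_tuples.1 he).1, fun l hl =>
        valueLists_subset (nestedBound_mono (by omega)) ((mem_tuples.1 he).2 l hl)⟩
    · rw [φ.holdsEnv_iff hφ le_rfl (mem_tuples.1 he).1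
        ((bounded_env he).mono (nestedBound_mono (by omega)))]
      exact (φ.holds_congr le_rfl hvi hvs).1 hv
  · rintro ⟨e, he, he'⟩
    exact ⟨_, _, (φ.holdsEnv_iff hφ le_rfl (mem_tuples.1 he).1
      ((bounded_env he).mono (nestedBound_mono (by omega)))).1 (Formula.mem_table.1 he').2⟩

theorem primrecPred_isRQSPA_and_satisfiable :
    PrimrecPred (fun φ : Formula => φ.IsRQSPA ∧ φ.Satisfiable) := by
  classical
  have h1 : PrimrecPred (fun n : ℕ => (formulaOf n).IsRQSPA) :=
    primrecPred_iff_primrec_decide.2 PR.isRQSPA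
  have h2 : PrimrecPred (fun n : ℕ => ∃ e ∈ tuples (valueLists (nestedBound n 0)) (2 * n + 2),
      e ∈ (formulaOf n).table n) := by
    have := PR.table.comp (g := fun q : ℕ × List (List ℤ) => (q.1, q.1)) (by fun_prop)
    exact PR.bex (p := fun n e => e ∈ (formulaOf n).table n) (by fun_prop) (by fun_prop)
  refine ((h1.and h2).comp Primrec.encode).of_eq fun φ => ?_
  rw [Formula.encode_eq, formulaOf_code]
  exact and_congr_right fun hφ => (φ.satisfiable_iff hφ).symm

end RQSPA

/-- The satisfiability problem of RQSPA is decidable: there is an algorithm that, given a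
formula, tells whether it is an RQSPA formula that has a model. -/
theorem mainTheorem2 :
    ComputablePred (fun φ : RQSPA.Formula => φ.IsRQSPA ∧ φ.Satisfiable) :=
  RQSPA.primrecPred_isRQSPA_and_satisfiable.computablePred
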